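/- Let $k$ be a field and let $A$ be a finite-dimensional associative unital $k$-algebra with a symmetric Frobenius structure, that is, a non-degenerate bilinear form $\eta : A\times A\to k$ with $\eta(a,b)=\eta(b,a)$ and $\eta(ab,c)=\eta(a,bc)$ for all $a,b,c\in A$. Let $CH^n(A,A)=\mathrm{Hom}_k(A^{\otimes n},A)$ be the Hochschild cochains with the Hochschild differential $$(\partial f)(a_1,\dots,a_{n+1})=a_1f(a_2,\dots,a_{n+1})+\sum_{i=1}^{n}(-1)^i f(\dots,a_ia_{i+1},\dots)+(-1)^{n+1}f(a_1,\dots,a_n)a_{n+1},$$ let $HH^*(A,A)$ be its cohomology, and for $f\in CH^m(A,A)$, $g\in CH^n(A,A)$ put $$(f\cup g)(a_1,\dots,a_{m+n})=f(a_1,\dots,a_m)\,g(a_{m+1},\dots,a_{m+n}),$$ $$f\circ g=\sum_{i=1}^m(-1)^{(i-1)(n-1)}f\circ_i g,\qquad [f,g]=f\circ g-(-1)^{(m-1)(n-1)}g\circ f,$$ where $f\circ_i g$ is the insertion of $g$ into the $i$-th argument of $f$ (so $[\,,]$ is Gerstenhaber's bracket). For $f\in CH^n(A,A)$ let $\tilde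 f(a_0,\dots,a_n)=\eta(a_0,f(a_1,\dots,a_n))$; since $\eta$ is non-degenerate, $f\mapsto\tilde f$ identifies $CH^n(A,A)$ with the dual of $A^{\otimes (n+1)}$. Let $\Delta:CH^{n+1}(A,A)\to CH^{n}(A,A)$ be the operator with $\widetilde{\Delta f}=\tilde f\circ B$, where $B=(1-t)sN:A^{\otimes (n+1)}\to A^{\otimes (n+2)}$ is Connes' operator, with $t(a_0,\dots,a_r)=(-1)^r(a_r,a_0,\dots,a_{r-1})$ on $A^{\otimes (r+1)}$, $N=1+t+\dots+t^n$ on $A^{\otimes(n+1)}$ and $s(a_0,\dots,a_n)=(1,a_0,\dots,a_n)$; put $\Delta=0$ on $CH^0(A,A)$. Then $\cup$, $\Delta$ and $[\,,]$ map cocycles to cocycles and induce well-defined operations on $HH^*(A,A)$, and $HH^*(A,A)$ with the product induced by $\cup$, the class of $1\in A$ as unit and the operator induced by $\Delta$ is a BV algebra: the product is associative, unital and graded commutative, $\Delta$ has degree $-1$, $\Delta^2=0$, and for homogeneous $a,b,c$ $$\Delta(abc)=\Delta(ab)c+(-1)^{|a|}a\Delta(bc)+(-1)^{(|a|-1)|b|}b\Delta(ac)-\Delta(a)bc-(-1)^{|a|}a\Delta(b)c-(-1)^{|a|+|b|}ab\Delta(c).$$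 Moreover the bracket induced by the BV operator is the Gerstenhaber bracket: for homogeneous $a,b\in HH^*(A,A)$ $$[a,b]=-(-1)^{(|a|-1)|b|}\bigl(\Delta(ab)-\Delta(a)b-(-1)^{|a|}a\Delta(b)\bigr).$$ -/

import Mathlib

open scoped DirectSum

namespace HochschildBV

universe u v w

section Cochains

variable (k : Type u) [Field k] (A : Type v) [Ring A] [Algebra k A]

/-- The Hochschild cochains `CH^n(A, A) = Hom(A^{⊗ n}, A)`, as `k`-multilinear maps. -/
abbrev Cochain (n : ℕ) : Type v :=
  MultilinearMap k (fun _ : Fin n => A) A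

variable {k A}

/-- The product of cochains as a function of the arguments `a_1, …, a_{m+n}`:
`f (a_1, …, a_m) * g (a_{m+1}, …, a_{m+n})`. -/
def cupFun {m n p : ℕ} (h : m + n = p) (f : Cochain k A m) (g : Cochain k A n)
    (a : Fin p → A) : A :=
  f (fun i => a ⟨i, by omega⟩) * g (fun j => a ⟨m + j, by omega⟩)

theorem cupFun_update {m n p : ℕ} (h : m + n = p) (f : Cochain k A m) (g : Cochain k A n)
    (a : Fin p → A) (q : Fin p) :
    (∃ i : Fin m, ∃ b : Fin m → A, ∃ c : A, ∀ x : A,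
        cupFun h f g (Function.update a q x) = f (Function.update b i x) * c) ∨
    (∃ j : Fin n, ∃ b : Fin n → A, ∃ c : A, ∀ x : A,
        cupFun h f g (Function.update a q x) = c * g (Function.update b j x)) := by
  by_cases hq : (q : ℕ) < m
  · refine Or.inl ⟨⟨q, hq⟩, fun i => a ⟨i, by omega⟩, g (fun j => a ⟨m + j, by omega⟩), fun x => ?_⟩
    unfold cupFun
    congr 2
    · funext i
      simp only [Function.update_apply, Fin.ext_iff]
    · funext j
      rw [Function.update_of_ne]
      intro e
      have := congrArg Fin.val e
      simp only at this
      omega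
  · refine Or.inr ⟨⟨q - m, by omega⟩, fun j => a ⟨m + j, by omega⟩,
      f (fun i => a ⟨i, by omega⟩), fun x => ?_⟩
    unfold cupFun
    congr 2
    · funext i
      rw [Function.update_of_ne]
      intro e
      have := congrArg Fin.val e
      simp only at this
      omega
    · funext j
      have : (m + (j : ℕ) = q) ↔ ((j : ℕ) = q - m) := by omega
      simp only [Function.update_apply, Fin.ext_iff, this]

/-- The cup product of Hochschild cochains,
`(f ∪ g)(a_1, …, a_{m+n}) = f (a_1, …, a_m) * g (a_{m+1}, …, a_{m+n})`. -/
def cup {m n p : ℕ} (h : m + n = p) (f : Cochain k A m) (g : Cochain k A n) : Cochain k A p :=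
  MultilinearMap.mk' (cupFun h f g)
    (by
      intro a q x y
      rcases cupFun_update h f g a q with ⟨i, b, c, e⟩ | ⟨j, b, c, e⟩
      · simp only [e, MultilinearMap.map_update_add, add_mul]
      · simp only [e, MultilinearMap.map_update_add, mul_add])
    (by
      intro a q r x
      rcases cupFun_update h f g a q with ⟨i, b, c, e⟩ | ⟨j, b, c, e⟩
      · simp only [e, MultilinearMap.map_update_smul, smul_mul_assoc]
      · simp only [e, MultilinearMap.map_update_smul, mul_smul_comm])

/-- The arguments that `f` receives in the insertion of `g` at the place `i`:
`(a_0, …, a_{i-1}, g (a_i, …, a_{i+n-1}), a_{i+n}, …, a_{m+n-2})`, with places counted from `0`. -/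
def insertArgs {m n p : ℕ} (h : m + n = p + 1) (g : Cochain k A n) (i : Fin m)
    (a : Fin p → A) (j : Fin m) : A :=
  if h₁ : (j : ℕ) < i then a ⟨j, by omega⟩
  else if h₂ : (j : ℕ) = i then g (fun l => a ⟨i + l, by omega⟩)
  else a ⟨j + n - 1, by omega⟩

theorem insertArgs_update {m n p : ℕ} (h : m + n = p + 1) (g : Cochain k A n) (i : Fin m)
    (a : Fin p → A) (q : Fin p) :
    (∃ j : Fin m, ∀ x : A, insertArgs h g i (Function.update a q x) =
        Function.update (insertArgs h g i a) j x) ∨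
    (∃ l : Fin n, ∃ b : Fin n → A, ∀ x : A, insertArgs h g i (Function.update a q x) =
        Function.update (insertArgs h g i a) i (g (Function.update b l x))) := by
  by_cases h₁ : (q : ℕ) < i
  · refine Or.inl ⟨⟨q, by omega⟩, fun x => ?_⟩
    funext j
    simp only [insertArgs, Function.update_apply, Fin.ext_iff]
    split_ifs <;> first | rfl | omega | skip
    congr 1
    funext l
    rw [if_neg (by omega)]
  · by_cases h₂ : (q : ℕ) < i + n
    · refine Or.inr ⟨⟨q - i, by omega⟩, fun l => a ⟨i + l, by omega⟩, fun x => ?_⟩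
      funext j
      simp only [insertArgs, Function.update_apply, Fin.ext_iff]
      split_ifs <;> first | rfl | omega | skip
      congr 1
      funext l
      have : ((i : ℕ) + l = q) ↔ ((l : ℕ) = q - i) := by omega
      simp only [Function.update_apply, Fin.ext_iff, this]
    · refine Or.inl ⟨⟨q + 1 - n, by omega⟩, fun x => ?_⟩
      funext j
      simp only [insertArgs, Function.update_apply, Fin.ext_iff]
      split_ifs <;> first | rfl | omega | skip
      congr 1
      funext l
      rw [if_neg (by omega)]

/-- The insertion `f ∘_i g` of the cochain `g` into the place `i` (counted from `0`) of `f`. -/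
def insertAt {m n p : ℕ} (h : m + n = p + 1) (f : Cochain k A m) (g : Cochain k A n)
    (i : Fin m) : Cochain k A p :=
  MultilinearMap.mk' (fun a => f (insertArgs h g i a))
    (by
      intro a q x y
      rcases insertArgs_update h g i a q with ⟨j, e⟩ | ⟨l, b, e⟩
      · simp only [e, MultilinearMap.map_update_add]
      · simp only [e, MultilinearMap.map_update_add])
    (by
      intro a q r x
      rcases insertArgs_update h g i a q with ⟨j, e⟩ | ⟨l, b, e⟩
      · simp only [e, MultilinearMap.map_update_smul]
      · simp only [e, MultilinearMap.map_update_smul])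

/-- Gerstenhaber's circle product `f ∘ g = ∑_{i = 1}^{m} (-1)^{(i-1)(n-1)} f ∘_i g`. -/
def circ {m n p : ℕ} (h : m + n = p + 1) (f : Cochain k A m) (g : Cochain k A n) :
    Cochain k A p :=
  ∑ i : Fin m, (-1 : k) ^ ((i : ℕ) * (n + 1)) • insertAt h f g i

/-- Gerstenhaber's bracket `[f, g] = f ∘ g - (-1)^{(m-1)(n-1)} g ∘ f` of an `m`-cochain and an
`n`-cochain, which is an `(m + n - 1)`-cochain. -/
def gerstenhaberBracket {m n p : ℕ} (h : m + n = p + 1) (f : Cochain k A m)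
    (g : Cochain k A n) : Cochain k A p :=
  circ h f g - (-1 : k) ^ ((m + 1) * (n + 1)) • circ (by omega) g f

/-- The identity of `A` as a `1`-cochain. -/
def idCochain : Cochain k A 1 :=
  MultilinearMap.ofSubsingleton k A A 0 LinearMap.id

/-- The multiplication of `A` as a `2`-cochain. -/
def mulCochain : Cochain k A 2 :=
  MultilinearMap.mkPiAlgebraFin k 2 A

/-- The Hochschild differential `CH^n(A, A) → CH^{n+1}(A, A)`, a linear map; its values are
spelled out in `differential_apply`. -/
def differential (n : ℕ) : Cochain k A n →ₗ[k] Cochain k A (n + 1) where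
  toFun f := cup (by omega) (idCochain : Cochain k A 1) f
    + ∑ i : Fin n, (-1 : k) ^ ((i : ℕ) + 1) • insertAt (by omega) f (mulCochain : Cochain k A 2) i
    + (-1 : k) ^ (n + 1) • cup (by omega) f (idCochain : Cochain k A 1)
  map_add' f g := by
    ext a
    simp only [cup, insertAt, cupFun, add_apply, sum_apply,
      smul_apply, MultilinearMap.mk'_apply, mul_add, add_mul, smul_add,
      Finset.sum_add_distrib]
    abel
  map_smul' c f := by
    ext a
    simp only [cup, insertAt, cupFun, add_apply, sum_apply,
      smul_apply, MultilinearMap.mk'_apply, mul_smul_comm, smul_mul_assoc,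
      smul_add, Finset.smul_sum, RingHom.id_apply]
    simp only [smul_comm _ c]

/-- The Hochschild differential of `f` on `a_0, …, a_n` is
`a_0 f (a_1, …, a_n) + ∑_i (-1)^{i+1} f (a_0, …, a_i a_{i+1}, …, a_n)
  + (-1)^{n+1} f (a_0, …, a_{n-1}) a_n`. -/
theorem differential_apply {n : ℕ} (f : Cochain k A n) (a : Fin (n + 1) → A) :
    differential n f a = a 0 * f (fun j => a j.succ)
      + ∑ i : Fin n, (-1 : k) ^ ((i : ℕ) + 1) • f (Fin.contractNth i.castSucc (· * ·) a)
      + (-1 : k) ^ (n + 1) • (f (fun j => a j.castSucc) * a (Fin.last n)) := by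
  simp only [differential, LinearMap.coe_mk, AddHom.coe_mk,
    add_apply, sum_apply, smul_apply, cup, cupFun,
    insertAt, MultilinearMap.mk'_apply]
  congr 1
  · congr 1
    · congr 1
      congr 1
      funext j
      congr 1
      ext
      simp [Nat.add_comm]
    · refine Finset.sum_congr rfl fun i _ => ?_
      congr 2
      funext j
      simp only [insertArgs, Fin.contractNth, mulCochain, Fin.val_castSucc,
        MultilinearMap.mkPiAlgebraFin_apply]
      split_ifs with h₁ h₂
      · rfl
      · have : j = i := Fin.ext h₂
        subst this
        simp [Fin.castSucc, Fin.succ, Fin.castAdd, Fin.castLE]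
      · rfl
variable (k A)

/-- The Hochschild cocycles of degree `n`. -/
def cocycles (n : ℕ) : Submodule k (Cochain k A n) :=
  LinearMap.ker (differential n)

instance instAddCommGroupCocycles (n : ℕ) : AddCommGroup (cocycles k A n) :=
  inferInstance

/-- The Hochschild coboundaries of degree `n`. -/
def coboundaries : (n : ℕ) → Submodule k (Cochain k A n)
  | 0 => ⊥
  | n + 1 => LinearMap.range (differential n)

/-- The Hochschild cohomology `HH^n(A, A)`: cocycles modulo coboundaries. -/
abbrev HH (n : ℕ) : Type v :=
  cocycles k A n ⧸ (coboundaries k A n).submoduleOf (cocycles k A n)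

variable {k A}

/-- The cohomology class of a cocycle, in the total cohomology `⨁ n, HH^n(A, A)`. -/
def cohomologyClass {n : ℕ} (f : Cochain k A n) (hf : f ∈ cocycles k A n) : ⨁ n, HH k A n :=
  DirectSum.lof k ℕ (HH k A) n (Submodule.Quotient.mk ⟨f, hf⟩)

/-- The unit of `A` as a `0`-cochain. -/
def unitCochain : Cochain k A 0 :=
  MultilinearMap.constOfIsEmpty k (fun _ : Fin 0 => A) 1

end Cochains

section Connes

variable {k : Type u} [Field k] {A : Type v} [Ring A] [Algebra k A]

variable (k A) in
/-- The dual of the space `A^{⊗ (n + 1)}` of Hochschild chains of degree `n`. -/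
abbrev Form (n : ℕ) : Type (max u v) :=
  MultilinearMap k (fun _ : Fin (n + 1) => A) k

/-- The dual of the operator `t (a_0, …, a_n) = (-1)^n (a_n, a_0, …, a_{n-1})`. -/
def dualT {n : ℕ} (φ : Form k A n) : Form k A n :=
  (-1 : k) ^ n • φ.domDomCongr (finRotate (n + 1)).symm

/-- The dual of the operator `N = 1 + t + ⋯ + t^n` on `A^{⊗ (n + 1)}`. -/
def dualN {n : ℕ} (φ : Form k A n) : Form k A n :=
  ∑ i ∈ Finset.range (n + 1), dualT^[i] φ

/-- The dual of the operator `s (a_0, …, a_n) = (1, a_0, …, a_n)`. -/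
def dualS {n : ℕ} (φ : Form k A (n + 1)) : Form k A n :=
  φ.curryLeft 1

/-- The dual `φ ↦ φ ∘ B` of Connes' operator `B = (1 - t) s N`, which maps `A^{⊗ (n + 1)}` to
`A^{⊗ (n + 2)}`; here `N` and `t` act on `A^{⊗ (n + 1)}` and on `A^{⊗ (n + 2)}`. -/
def dualConnesB {n : ℕ} (φ : Form k A (n + 1)) : Form k A n :=
  dualN (dualS (φ - dualT φ))

/-- The form `f̃ (a_0, …, a_n) = η (a_0, f (a_1, …, a_n))` of a cochain `f`. -/
def toForm (η : LinearMap.BilinForm k A) {n : ℕ} (f : Cochain k A n) : Form k A n :=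
  LinearMap.uncurryLeft
    { toFun := fun a => (η a).compMultilinearMap f
      map_add' := fun a b => by ext; simp
      map_smul' := fun c a => by ext; simp }

theorem toForm_apply (η : LinearMap.BilinForm k A) {n : ℕ} (f : Cochain k A n)
    (a : Fin (n + 1) → A) : toForm η f a = η (a 0) (f (fun j => a j.succ)) :=
  rfl

theorem dualT_apply {n : ℕ} (φ : Form k A n) (a : Fin (n + 1) → A) :
    dualT φ a = (-1 : k) ^ n • φ (Fin.cons (a (Fin.last n)) (fun j : Fin n => a j.castSucc)) := by
  simp only [dualT, smul_apply, MultilinearMap.domDomCongr_apply]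
  congr 2
  funext j
  refine Fin.cases ?_ (fun j => ?_) j
  · simp only [Fin.cons_zero]
    rw [(Equiv.symm_apply_eq _).2 finRotate_last.symm]
  · simp only [Fin.cons_succ]
    congr 1
    rw [Equiv.symm_apply_eq, finRotate_apply, Fin.coeSucc_eq_succ]

theorem dualS_apply {n : ℕ} (φ : Form k A (n + 1)) (a : Fin (n + 1) → A) :
    dualS φ a = φ (Fin.cons 1 a) :=
  rfl

variable [FiniteDimensional k A]

/-- The cochain corresponding to a form under the identification of `Hom(A^{⊗ n}, A)` with the
dual of `A^{⊗ (n + 1)}` by `f ↦ f̃`, for a symmetric non-degenerate `η`. -/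
noncomputable def ofForm (η : LinearMap.BilinForm k A) (hη : η.Nondegenerate) {n : ℕ}
    (φ : Form k A n) : Cochain k A n :=
  ((η.toDual hη).symm : Module.Dual k A →ₗ[k] A).compMultilinearMap
    (MultilinearMap.curryRight (M := fun _ => A)
      (φ.domDomCongr (finRotate (n + 1)).symm))

theorem ofForm_spec (η : LinearMap.BilinForm k A) (hη : η.Nondegenerate)
    (hsymm : ∀ a b : A, η a b = η b a) {n : ℕ} (φ : Form k A n) :
    toForm η (ofForm η hη φ) = φ := by
  ext a
  rw [toForm_apply, hsymm]
  simp only [ofForm, LinearMap.compMultilinearMap_apply, LinearEquiv.coe_coe,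
    LinearMap.BilinForm.apply_toDual_symm_apply, MultilinearMap.curryRight_apply,
    MultilinearMap.domDomCongr_apply]
  congr 1
  funext j
  refine Fin.cases ?_ (fun j => ?_) j
  · have : (finRotate (n + 1)).symm 0 = Fin.last n := by
      rw [Equiv.symm_apply_eq, finRotate_last]
    rw [this, Fin.snoc_last]
  · have : (finRotate (n + 1)).symm j.succ = j.castSucc := by
      rw [Equiv.symm_apply_eq, finRotate_apply, Fin.coeSucc_eq_succ]
    rw [this, Fin.snoc_castSucc]

/-- The operator `Δ : CH^{n+1}(A, A) → CH^n(A, A)` which corresponds to the dual of Connes'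
operator `B` under the identification by `η`, that is, `(Δ f)~ = f̃ ∘ B`. -/
noncomputable def bvOperator (η : LinearMap.BilinForm k A) (hη : η.Nondegenerate) {n : ℕ}
    (f : Cochain k A (n + 1)) : Cochain k A n :=
  ofForm η hη (dualConnesB (toForm η f))

theorem toForm_bvOperator (η : LinearMap.BilinForm k A) (hη : η.Nondegenerate)
    (hsymm : ∀ a b : A, η a b = η b a) {n : ℕ} (f : Cochain k A (n + 1)) :
    toForm η (bvOperator η hη f) = dualConnesB (toForm η f) :=
  ofForm_spec η hη hsymm _

end Connes

/-- A structure of BV algebra over `k` on a graded module `H`. All identities are written in the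
total module `⨁ n, H n`, with homogeneous elements included by `DirectSum.lof`. -/
structure BVAlgebra (k : Type u) [Field k] (H : ℕ → Type w) [∀ n, AddCommGroup (H n)]
    [∀ n, Module k (H n)] where
  /-- The product. -/
  mul : (⨁ n, H n) →ₗ[k] (⨁ n, H n) →ₗ[k] (⨁ n, H n)
  /-- The unit, of degree `0`. -/
  one : H 0
  /-- The BV operator. -/
  Δ : (⨁ n, H n) →ₗ[k] (⨁ n, H n)
  mul_mem : ∀ (m n : ℕ) (a : H m) (b : H n),
    mul (DirectSum.lof k ℕ H m a) (DirectSum.lof k ℕ H n b) ∈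
      LinearMap.range (DirectSum.lof k ℕ H (m + n))
  mul_assoc : ∀ x y z : ⨁ n, H n, mul (mul x y) z = mul x (mul y z)
  one_mul : ∀ x : ⨁ n, H n, mul (DirectSum.lof k ℕ H 0 one) x = x
  mul_one : ∀ x : ⨁ n, H n, mul x (DirectSum.lof k ℕ H 0 one) = x
  /-- Graded commutativity. -/
  mul_comm : ∀ (m n : ℕ) (a : H m) (b : H n),
    mul (DirectSum.lof k ℕ H m a) (DirectSum.lof k ℕ H n b) =
      (-1 : k) ^ (m * n) • mul (DirectSum.lof k ℕ H n b) (DirectSum.lof k ℕ H m a)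
  /-- The BV operator has degree `-1`. -/
  Δ_zero : ∀ a : H 0, Δ (DirectSum.lof k ℕ H 0 a) = 0
  Δ_succ : ∀ (n : ℕ) (a : H (n + 1)),
    Δ (DirectSum.lof k ℕ H (n + 1) a) ∈ LinearMap.range (DirectSum.lof k ℕ H n)
  Δ_Δ : ∀ x : ⨁ n, H n, Δ (Δ x) = 0
  /-- The BV operator is a differential operator of order two with respect to the product. -/
  Δ_mul_mul : ∀ (l m n : ℕ) (a : H l) (b : H m) (c : H n) (x y z : ⨁ n, H n),
    x = DirectSum.lof k ℕ H l a → y = DirectSum.lof k ℕ H m b → z = DirectSum.lof k ℕ H n c →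
    Δ (mul (mul x y) z) =
      mul (Δ (mul x y)) z
        + (-1 : k) ^ l • mul x (Δ (mul y z))
        + (-1 : k) ^ ((l + 1) * m) • mul y (Δ (mul x z))
        - mul (mul (Δ x) y) z
        - (-1 : k) ^ l • mul (mul x (Δ y)) z
        - (-1 : k) ^ (l + m) • mul (mul x y) (Δ z)

/-- The bracket induced by the BV operator, on elements `a` of degree `m` and `b` of degree `n`:
`[a, b] = -(-1)^{(m-1)n} (Δ(ab) - Δ(a) b - (-1)^m a Δ(b))`.
The sign is the one that belongs to Gerstenhaber's sign conventions, in which the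
bracket and the product satisfy `[ab, c] = [a, c] b + (-1)^{|a|(|c|-1)} a [b, c]`. -/
def BVAlgebra.bracket {k : Type u} [Field k] {H : ℕ → Type w} [∀ n, AddCommGroup (H n)]
    [∀ n, Module k (H n)] (S : BVAlgebra k H) (m n : ℕ) (x y : ⨁ n, H n) : ⨁ n, H n :=
  -((-1 : k) ^ ((m + 1) * n) •
    (S.Δ (S.mul x y) - S.mul (S.Δ x) y - (-1 : k) ^ m • S.mul x (S.Δ y)))

end HochschildBV

/-!
The Hochschild cochains of all degrees are studied at once as functions on words, `List A → A`:
a cochain of degree `n` is extended by zero to words of other lengths (`toWord`). The cup product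
is the convolution `⌢` for deconcatenation of words, the sum over all places of an inserted cochain
is a recursion along the word, and the Hochschild differential becomes
`wordDiff k F = letter ⌢ F - twist (-1) F ⌢ letter - bar F`, where `letter` is the identity of `A`
and `bar` is dual to the differential of the bar construction. Signs that depend on the degree of a
cochain are carried by a scalar `θ = ±1`.

The insertion `F ↦ insertion θ f F` of a cocycle `f` is dual to a coderivation of the bar coalgebra
that commutes with its differential up to sign, and it is a derivation of `⌢`. This gives the two
homotopies of Gerstenhaber: the circle product shows that `⌢` is graded commutative in cohomology
(`conv_comm_mem`), and the simultaneous insertion of two cocycles into a third one shows that the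
bracket with a cocycle is a derivation of the product (`bracket_conv_mem`).

The form `tr = η 1` is a trace with `tr (a * x) = η a x`, so a cochain `K` is determined by the
values `tr (a * K w)`, which may be any multilinear function of `a` and `w`. The operator `Δ` is
compared with the cochain `rotationCochain f` whose form is `f̃` composed with `s N`, the sum over
the rotations of the cyclic word `a w`. The remaining part `t s N` of Connes' operator contains `f`
only with the unit as its first argument. For a cocycle `f` the function `f (1, ·)` satisfies
`letter ⌢ f (1, ·) = ∂ f (1, ·)`, and sums over rotations anticommute with the differential, so that
this part is a coboundary (`bvOperator_sub_rotationCochain_mem`). It is therefore not necessary to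
pass to normalized cochains. That `Δ ∘ Δ` vanishes holds already for forms: `φ ∘ B` is invariant
under `t`, hence killed by `1 - t`.

The bracket formula rests on one more homotopy. In `f̃ ∘ s N` for a product `f ⌢ g` the marked
letter `a` lies among the arguments of `f` or of `g`. The sum over the rotations of `g` in which `f`
is inserted behind `a` is the form of a cochain, whose differential compares the second part with
`f ⌢ Δ g` and the circle product of `g` and `f` (`form_wordDiff_of_rotation_insertion`). This and
the same with `f` and `g` exchanged give `[f, g] ∼ -(-1)^{(m-1)n} (Δ(fg) - Δ(f) g - (-1)^m f Δ(g))`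
(`bracket_add_mem`). Since the bracket is a derivation and the product is commutative, the second
order identity of the BV operator follows (`rotationCochain_conv_conv_mem`).

Finally, the total cohomology embeds into the functions of words modulo coboundaries
(`wordClass_injective`), so that identities between classes are identities of words up to
coboundaries (`Represents.eq_of_sub_mem`).
-/

set_option linter.unusedSectionVars false

namespace HochschildBV

/-! ### Sums over splittings of words, and the bar differential -/

section Words

variable {k : Type*} [Field k] {A : Type*}
variable {M : Type*} [AddCommGroup M] [Module k M] {N : Type*} [AddCommGroup N]

/-- The sum of `H u v` over all ways to cut a word `w` into `w = u ++ v`. -/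
def splitSum (H : List A → List A → M) (w : List A) : M :=
  ∑ i ∈ Finset.range (w.length + 1), H (w.take i) (w.drop i)

@[simp] theorem splitSum_nil (H : List A → List A → M) : splitSum H [] = H [] [] := by
  simp [splitSum]

theorem splitSum_cons (H : List A → List A → M) (a : A) (w : List A) :
    splitSum H (a :: w) = H [] (a :: w) + splitSum (fun u v => H (a :: u) v) w := by
  rw [splitSum, List.length_cons, Finset.sum_range_succ' _ (w.length + 1), add_comm]
  rfl

theorem splitSum_congr {H H' : List A → List A → M} {w : List A}
    (h : ∀ u v, u ++ v = w → H u v = H' u v) : splitSum H w = splitSum H' w :=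
  Finset.sum_congr rfl fun _ _ => h _ _ (List.take_append_drop _ _)

theorem splitSum_add (H H' : List A → List A → M) (w : List A) :
    splitSum (fun u v => H u v + H' u v) w = splitSum H w + splitSum H' w :=
  Finset.sum_add_distrib

theorem splitSum_sub (H H' : List A → List A → M) (w : List A) :
    splitSum (fun u v => H u v - H' u v) w = splitSum H w - splitSum H' w :=
  Finset.sum_sub_distrib _ _

theorem splitSum_neg (H : List A → List A → M) (w : List A) :
    splitSum (fun u v => - H u v) w = - splitSum H w :=
  Finset.sum_neg_distrib _

theorem splitSum_smul (c : k) (H : List A → List A → M) (w : List A) :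
    splitSum (fun u v => c • H u v) w = c • splitSum H w :=
  Finset.smul_sum.symm

theorem splitSum_eq_zero {H : List A → List A → M} {w : List A}
    (h : ∀ u v, u ++ v = w → H u v = 0) : splitSum H w = 0 :=
  Finset.sum_eq_zero fun _ _ => h _ _ (List.take_append_drop _ _)

@[simp] theorem splitSum_zero (w : List A) :
    splitSum (fun _ _ : List A => (0 : M)) w = 0 :=
  Finset.sum_const_zero

theorem map_splitSum {Φ : Type*} [FunLike Φ M N] [AddMonoidHomClass Φ M N] (φ : Φ)
    (H : List A → List A → M) (w : List A) :
    φ (splitSum H w) = splitSum (fun u v => φ (H u v)) w :=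
  map_sum φ _ _

theorem splitSum_mul {A : Type*} [Ring A] (H : List A → List A → A) (w : List A) (x : A) :
    splitSum H w * x = splitSum (fun u v => H u v * x) w :=
  Finset.sum_mul _ _ _

theorem mul_splitSum {A : Type*} [Ring A] (H : List A → List A → A) (w : List A) (x : A) :
    x * splitSum H w = splitSum (fun u v => x * H u v) w :=
  Finset.mul_sum _ _ _

theorem splitSum_assoc (H : List A → List A → List A → M) (w : List A) :
    splitSum (fun u v => splitSum (fun u₁ u₂ => H u₁ u₂ v) u) w =
      splitSum (fun u v => splitSum (fun v₁ v₂ => H u v₁ v₂) v) w := by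
  induction w generalizing H with
  | nil => simp
  | cons a w ih =>
    simp only [splitSum_cons, splitSum_nil, splitSum_add, ih fun u => H (a :: u)]
    abel

/-- The sum of `H u x` over all ways to write `w = u ++ [x]`: one term, or none if `w` is empty. -/
def lastSum (H : List A → A → M) (w : List A) : M :=
  splitSum (fun u y => match y with | [x] => H u x | _ => 0) w

@[simp] theorem lastSum_nil (H : List A → A → M) : lastSum H [] = 0 := by
  simp [lastSum]

@[simp] theorem lastSum_singleton (H : List A → A → M) (a : A) : lastSum H [a] = H [] a := by
  simp [lastSum, splitSum_cons]

theorem lastSum_cons_cons (H : List A → A → M) (a b : A) (w : List A) :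
    lastSum H (a :: b :: w) = lastSum (fun u x => H (a :: u) x) (b :: w) := by
  simp [lastSum, splitSum_cons]

theorem lastSum_congr {H H' : List A → A → M} {w : List A}
    (h : ∀ u x, u ++ [x] = w → H u x = H' u x) : lastSum H w = lastSum H' w :=
  splitSum_congr fun u v e => by
    rcases v with _ | ⟨x, _ | ⟨y, v⟩⟩
    · rfl
    · exact h u x e
    · rfl

theorem lastSum_smul (c : k) (H : List A → A → M) (w : List A) :
    lastSum (fun u x => c • H u x) w = c • lastSum H w := by
  rw [lastSum, lastSum, ← splitSum_smul]
  refine splitSum_congr fun u v _ => ?_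
  rcases v with _ | ⟨x, _ | ⟨y, v⟩⟩ <;> simp

theorem map_lastSum {Φ : Type*} [FunLike Φ M N] [AddMonoidHomClass Φ M N] (φ : Φ)
    (H : List A → A → M) (w : List A) :
    φ (lastSum H w) = lastSum (fun u x => φ (H u x)) w := by
  rw [lastSum, lastSum, map_splitSum]
  refine splitSum_congr fun u v _ => ?_
  rcases v with _ | ⟨x, _ | ⟨y, v⟩⟩ <;> simp

theorem lastSum_neg (H : List A → A → M) (w : List A) :
    lastSum (fun u x => - H u x) w = - lastSum H w := by
  rw [lastSum, lastSum, ← splitSum_neg]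
  refine splitSum_congr fun u v _ => ?_
  rcases v with _ | ⟨x, _ | ⟨y, v⟩⟩ <;> simp

theorem lastSum_splitSum (H : List A → List A → A → M) (w : List A) :
    lastSum (fun u x => splitSum (fun u₁ u₂ => H u₁ u₂ x) u) w =
      splitSum (fun u v => lastSum (fun v₁ x => H u v₁ x) v) w := by
  simp only [lastSum]
  rw [← splitSum_assoc]
  refine splitSum_congr fun u v _ => ?_
  rcases v with _ | ⟨x, _ | ⟨y, v⟩⟩ <;> simp

variable [Ring A]

/-- The function `F` with its first letter multiplied by `a` from the left; zero on the empty
word. -/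
def headMul (a : A) (F : List A → M) : List A → M
  | [] => 0
  | c :: w => F ((a * c) :: w)

@[simp] theorem headMul_nil (a : A) (F : List A → M) : headMul a F [] = 0 := rfl
@[simp] theorem headMul_cons (a c : A) (F : List A → M) (w : List A) :
    headMul a F (c :: w) = F ((a * c) :: w) := rfl

/-- The dual `F ↦ F ∘ b'` of the differential
`b' (a_1, …, a_n) = ∑ i, (-1)^{i-1} (a_1, …, a_i a_{i+1}, …, a_n)` of the bar construction. -/
def bar : (List A → M) → List A → M
  | _, [] => 0
  | F, a :: w => headMul a F w - bar (fun z => F (a :: z)) w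

@[simp] theorem bar_nil (F : List A → M) : bar F [] = 0 := by simp [bar]
theorem bar_cons (F : List A → M) (a : A) (w : List A) :
    bar F (a :: w) = headMul a F w - bar (fun z => F (a :: z)) w := by rw [bar]

theorem headMul_add (a : A) (F G : List A → M) (w : List A) :
    headMul a (fun z => F z + G z) w = headMul a F w + headMul a G w := by
  cases w <;> simp

theorem map_headMul {Φ : Type*} [FunLike Φ M N] [AddMonoidHomClass Φ M N] (φ : Φ)
    (a : A) (F : List A → M) (w : List A) :
    headMul a (fun z => φ (F z)) w = φ (headMul a F w) := by
  cases w <;> simp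

theorem bar_add (F G : List A → M) (w : List A) :
    bar (fun z => F z + G z) w = bar F w + bar G w := by
  induction w generalizing F G with
  | nil => simp
  | cons a w ih => rw [bar_cons, bar_cons, bar_cons, ih, headMul_add]; abel

theorem map_bar {Φ : Type*} [FunLike Φ M N] [AddMonoidHomClass Φ M N] (φ : Φ)
    (F : List A → M) (w : List A) :
    bar (fun z => φ (F z)) w = φ (bar F w) := by
  induction w generalizing F with
  | nil => simp
  | cons a w ih => rw [bar_cons, bar_cons, ih, map_headMul, map_sub]

theorem bar_smul (c : k) (F : List A → M) (w : List A) :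
    bar (fun z => c • F z) w = c • bar F w :=
  map_bar (LinearMap.lsmul k M c) F w

theorem bar_neg (F : List A → M) (w : List A) : bar (fun z => - F z) w = - bar F w := by
  induction w generalizing F with
  | nil => simp
  | cons a w ih =>
    rw [bar_cons, bar_cons, ih]
    cases w <;> simp [add_comm, sub_eq_add_neg]

theorem bar_sub (F G : List A → M) (w : List A) :
    bar (fun z => F z - G z) w = bar F w - bar G w := by
  simp only [sub_eq_add_neg, bar_add, bar_neg]

theorem headMul_bar (a : A) (F : List A → M) (w : List A) :
    headMul a (bar F) w = bar (headMul a F) w := by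
  rcases w with _ | ⟨c, _ | ⟨d, w⟩⟩
  · simp
  · simp [bar_cons]
  · simp [bar_cons, mul_assoc]

theorem bar_bar (F : List A → M) (w : List A) : bar (bar F) w = 0 := by
  induction w generalizing F with
  | nil => simp
  | cons a w ih =>
    have h : (fun z => bar F (a :: z)) =
        fun z => headMul a F z - bar (fun y => F (a :: y)) z := by
      funext z; rw [bar_cons]
    rw [bar_cons, h, bar_sub, ih, headMul_bar]
    simp

/-- The bar differential is a coderivation for deconcatenation. -/
theorem bar_splitSum (H : List A → List A → M) (w : List A) :
    bar (splitSum H) w =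
      splitSum (fun u v => bar (fun z => H z v) u + (-1 : k) ^ u.length • bar (H u) v) w := by
  induction w generalizing H with
  | nil => simp
  | cons a w ih =>
    have h : (fun z => splitSum H (a :: z)) =
        fun z => H [] (a :: z) + splitSum (fun u v => H (a :: u) v) z := by
      funext z; rw [splitSum_cons]
    rw [bar_cons, h, bar_add, ih, splitSum_cons]
    have h₂ : headMul a (splitSum H) w = headMul a (H []) w +
        splitSum (fun u v => headMul a (fun z => H z v) u) w := by
      cases w <;> simp [splitSum_cons]
    simp only [h₂, bar_cons, List.length_cons, pow_succ, splitSum_add, splitSum_sub, bar_nil,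
      List.length_nil, pow_zero, one_smul, mul_neg, mul_one, neg_smul, splitSum_neg]
    abel

/-- The behaviour of the bar differential under concatenation: the letters multiplied lie both in
`v`, or are the last letter of `v` and the first one of `z`, or lie both in `z`. -/
theorem bar_append (F : List A → M) (v z : List A) :
    bar F (v ++ z) = bar (fun v => F (v ++ z)) v
      + lastSum (fun v' x => (-1 : k) ^ v'.length • headMul x (fun y => F (v' ++ y)) z) v
      + (-1 : k) ^ v.length • bar (fun y => F (v ++ y)) z := by
  induction v generalizing F with
  | nil => simp
  | cons a v ih =>
    rw [List.cons_append, bar_cons, ih, bar_cons]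
    rcases v with _ | ⟨b, v⟩
    · simp [sub_eq_add_neg]
    · rw [lastSum_cons_cons]
      simp only [headMul_cons, List.cons_append, List.length_cons, pow_succ, mul_neg, mul_one,
        neg_smul, lastSum_neg]
      abel

end Words

/-! ### Cochains as functions of words, the cup product and the differential -/

section Operators

variable {k : Type*} [Field k] {A : Type*} [Ring A] [Algebra k A]
variable {M : Type*} [AddCommGroup M] [Module k M]

variable (k) in
/-- Multilinearity of a function of words: linearity in each letter. -/
structure IsMulti (F : List A → M) : Prop where
  add : ∀ u x y v, F (u ++ (x + y) :: v) = F (u ++ x :: v) + F (u ++ y :: v)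
  smul : ∀ u (c : k) x v, F (u ++ (c • x) :: v) = c • F (u ++ x :: v)

namespace IsMulti

theorem zero {F : List A → M} (hF : IsMulti k F) (u v : List A) : F (u ++ 0 :: v) = 0 := by
  simpa using hF.smul u 0 0 v

theorem shift {F : List A → M} (hF : IsMulti k F) (u : List A) :
    IsMulti k (fun w => F (u ++ w)) :=
  ⟨fun v => by simpa using hF.add (u ++ v), fun v => by simpa using hF.smul (u ++ v)⟩

theorem cons {F : List A → M} (hF : IsMulti k F) (a : A) : IsMulti k (fun w => F (a :: w)) :=
  hF.shift [a]

theorem head_add {F : List A → M} (hF : IsMulti k F) (x y : A) (v : List A) :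
    F ((x + y) :: v) = F (x :: v) + F (y :: v) := hF.add [] x y v

theorem head_smul {F : List A → M} (hF : IsMulti k F) (c : k) (x : A) (v : List A) :
    F ((c • x) :: v) = c • F (x :: v) := hF.smul [] c x v

theorem head_zero {F : List A → M} (hF : IsMulti k F) (v : List A) : F (0 :: v) = 0 :=
  hF.zero [] v

/-- A multilinear function of words as a linear function of the first letter. -/
def headLin {F : List A → M} (hF : IsMulti k F) : A →ₗ[k] (List A → M) where
  toFun a := fun v => F (a :: v)
  map_add' x y := funext fun v => hF.head_add x y v
  map_smul' c x := funext fun v => hF.head_smul c x v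

end IsMulti

/-- The value of `H` on the first letter and the rest of a word; zero on the empty word. -/
def headTerm (H : A → List A → M) : List A → M
  | [] => 0
  | c :: w => H c w

@[simp] theorem headTerm_nil (H : A → List A → M) : headTerm H [] = 0 := rfl
@[simp] theorem headTerm_cons (H : A → List A → M) (c : A) (w : List A) :
    headTerm H (c :: w) = H c w := rfl

/-- The convolution product for deconcatenation of words, which is the cup product of cochains. -/
def conv (F G : List A → A) (w : List A) : A :=
  splitSum (fun u v => F u * G v) w

/-- The convolution product of functions of words. -/
infixl:70 " ⌢ " => conv

/-- The identity of `A` as a function of words, supported on words of one letter. -/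
def letter : List A → A
  | [a] => a
  | _ => 0

@[simp] theorem letter_nil : letter ([] : List A) = 0 := rfl
@[simp] theorem letter_singleton (a : A) : letter [a] = a := rfl
@[simp] theorem letter_cons_cons (a b : A) (w : List A) : letter (a :: b :: w) = 0 := rfl

/-- The function `w ↦ θ ^ |w| F w`; for `θ = -1` the sign automorphism of the grading by
length. -/
def twist (θ : k) (F : List A → M) (w : List A) : M := θ ^ w.length • F w

@[simp] theorem conv_nil (F G : List A → A) : (F ⌢ G) [] = F [] * G [] := by simp [conv]

theorem conv_cons (F G : List A → A) (a : A) (w : List A) :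
    (F ⌢ G) (a :: w) = F [] * G (a :: w) + ((fun z => F (a :: z)) ⌢ G) w := by
  simp [conv, splitSum_cons]

theorem conv_letter (F : List A → A) (w : List A) :
    (F ⌢ letter) w = lastSum (fun u x => F u * x) w := by
  refine splitSum_congr fun u v _ => ?_
  rcases v with _ | ⟨x, _ | ⟨y, v⟩⟩ <;> simp

theorem letter_conv (F : List A → A) (w : List A) :
    (letter ⌢ F) w = headTerm (fun a z => a * F z) w := by
  rcases w with _ | ⟨a, w⟩
  · simp
  · rw [conv_cons]
    rcases w with _ | ⟨b, w⟩
    · simp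
    · simp only [letter_nil, zero_mul, zero_add, conv_cons, letter_singleton, headTerm_cons]
      rw [conv, splitSum_eq_zero fun u v _ => by simp, add_zero]

theorem conv_assoc (F G H : List A → A) : F ⌢ G ⌢ H = F ⌢ (G ⌢ H) := by
  funext w
  simp only [conv, splitSum_mul, mul_splitSum, splitSum_assoc, mul_assoc]

theorem add_conv (F F' G : List A → A) : (F + F') ⌢ G = F ⌢ G + F' ⌢ G := by
  funext w
  simp [conv, add_mul, splitSum_add]

theorem conv_add (F G G' : List A → A) : F ⌢ (G + G') = F ⌢ G + F ⌢ G' := by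
  funext w
  simp [conv, mul_add, splitSum_add]

theorem smul_conv (c : k) (F G : List A → A) : (c • F) ⌢ G = c • (F ⌢ G) := by
  funext w
  simp only [conv, Pi.smul_apply, smul_mul_assoc]
  exact splitSum_smul c _ w

theorem conv_smul (c : k) (F G : List A → A) : F ⌢ (c • G) = c • (F ⌢ G) := by
  funext w
  simp only [conv, Pi.smul_apply, mul_smul_comm]
  exact splitSum_smul c _ w

theorem neg_conv (F G : List A → A) : (-F) ⌢ G = -(F ⌢ G) := by
  funext w
  simp [conv, splitSum_neg]

theorem conv_neg (F G : List A → A) : F ⌢ (-G) = -(F ⌢ G) := by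
  funext w
  simp [conv, splitSum_neg]

theorem sub_conv (F F' G : List A → A) : (F - F') ⌢ G = F ⌢ G - F' ⌢ G := by
  simp [sub_eq_add_neg, add_conv, neg_conv]

theorem conv_sub (F G G' : List A → A) : F ⌢ (G - G') = F ⌢ G - F ⌢ G' := by
  simp [sub_eq_add_neg, conv_add, conv_neg]

theorem zero_conv (G : List A → A) : 0 ⌢ G = 0 :=
  funext fun _ => splitSum_eq_zero fun _ _ _ => zero_mul _

theorem conv_zero (F : List A → A) : F ⌢ 0 = 0 :=
  funext fun _ => splitSum_eq_zero fun _ _ _ => mul_zero _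

theorem twist_conv (θ : k) (F G : List A → A) : twist θ (F ⌢ G) = twist θ F ⌢ twist θ G := by
  funext w
  rw [twist, conv, ← splitSum_smul]
  refine splitSum_congr fun u v e => ?_
  rw [← e, List.length_append, pow_add, twist, twist, smul_mul_smul_comm]

theorem twist_letter (θ : k) : twist θ (letter : List A → A) = θ • letter := by
  funext w
  rcases w with _ | ⟨x, _ | ⟨y, v⟩⟩ <;> simp [twist]

theorem twist_twist {θ : k} (hθ : θ * θ = 1) (F : List A → M) : twist θ (twist θ F) = F := by
  funext w
  simp [twist, smul_smul, ← mul_pow, hθ]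

theorem twist_add (θ : k) (F G : List A → M) : twist θ (F + G) = twist θ F + twist θ G := by
  funext w
  simp [twist]

theorem twist_smul (θ c : k) (F : List A → M) : twist θ (c • F) = c • twist θ F := by
  funext w
  simp [twist, smul_comm (θ ^ w.length) c]

theorem twist_neg (θ : k) (F : List A → M) : twist θ (-F) = -twist θ F := by
  funext w
  simp [twist]

theorem twist_sub (θ : k) (F G : List A → M) : twist θ (F - G) = twist θ F - twist θ G := by
  simp [sub_eq_add_neg, twist_add, twist_neg]

theorem headMul_twist (θ : k) (a : A) (F : List A → M) (w : List A) :
    headMul a (twist θ F) w = twist θ (headMul a F) w := by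
  cases w <;> simp [twist]

theorem bar_twist {θ : k} (hθ : θ * θ = 1) (F : List A → M) :
    bar (twist θ F) = θ • twist θ (bar F) := by
  funext w
  rw [Pi.smul_apply]
  induction w generalizing F with
  | nil => simp [twist]
  | cons a w ih =>
    have h : (fun z => twist θ F (a :: z)) = fun z => θ • twist θ (fun z => F (a :: z)) z := by
      funext z; simp [twist, pow_succ', smul_smul]
    rw [bar_cons, h, bar_smul, ih, headMul_twist]
    simp only [twist, bar_cons, List.length_cons, pow_succ', smul_sub, smul_smul, ← mul_assoc, hθ,
      one_mul]

theorem bar_letter : bar (letter : List A → A) = letter ⌢ letter := by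
  funext w
  rw [letter_conv]
  rcases w with _ | ⟨a, _ | ⟨b, w⟩⟩
  · simp
  · simp [bar_cons]
  · have : bar (fun z => letter (a :: z)) (b :: w) = 0 := by
      generalize b :: w = w
      have h : ∀ (w : List A) (F : List A → A), (∀ c z, F (c :: z) = 0) → bar F w = 0 := by
        intro w
        induction w with
        | nil => simp
        | cons a w ih =>
          intro F hF
          rw [bar_cons, ih (fun z => F (a :: z)) fun c z => hF _ _]
          cases w <;> simp [hF]
      exact h w _ fun c z => rfl
    rw [bar_cons, this]
    cases w <;> simp

variable (k) in
theorem bar_conv (F G : List A → A) :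
    bar (F ⌢ G) = bar F ⌢ G + twist (-1 : k) F ⌢ bar G := by
  funext w
  have := bar_splitSum (k := k) (fun u v => F u * G v) w
  rw [Pi.add_apply]
  refine this.trans ?_
  rw [splitSum_add]
  congr 1
  · refine splitSum_congr fun u v _ => ?_
    exact map_bar (AddMonoidHom.mulRight (G v)) F u
  · refine splitSum_congr fun u v _ => ?_
    rw [show bar (fun v => F u * G v) v = F u * bar G v from
      map_bar (AddMonoidHom.mulLeft (F u)) G v]
    simp [twist]

variable (k) in
/-- The Hochschild differential of functions of words, in terms of the cup product with the identity
of `A` from both sides and the bar differential. -/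
def wordDiff (F : List A → A) : List A → A :=
  letter ⌢ F - twist (-1 : k) F ⌢ letter - bar F

theorem wordDiff_wordDiff (F : List A → A) : wordDiff k (wordDiff k F) = 0 := by
  have h₁ : bar (bar F) = 0 := funext (bar_bar F)
  have h₂ : bar (wordDiff k F) = bar (letter ⌢ F) - bar (twist (-1 : k) F ⌢ letter) := by
    have : bar (wordDiff k F) = bar (letter ⌢ F) - bar (twist (-1 : k) F ⌢ letter)
        - bar (bar F) := by
      funext w
      rw [wordDiff]
      exact (bar_sub _ _ w).trans (congrArg (· - _) (bar_sub _ _ w))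
    rw [this, h₁, sub_zero]
  rw [wordDiff, h₂]
  simp only [wordDiff, bar_conv k, bar_letter,
    bar_twist (show (-1 : k) * -1 = 1 by simp), twist_sub, twist_conv, twist_letter,
    conv_sub, sub_conv, neg_smul, one_smul, neg_conv, conv_neg, conv_assoc,
    twist_twist (show (-1 : k) * -1 = 1 by simp)]
  abel

/-- The graded Leibniz rule for the cup product. -/
theorem wordDiff_conv (F G : List A → A) :
    wordDiff k (F ⌢ G) = wordDiff k F ⌢ G + twist (-1 : k) F ⌢ wordDiff k G := by
  simp only [wordDiff, bar_conv k, twist_conv, conv_sub, sub_conv, conv_assoc]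
  abel

end Operators

/-! ### Insertion of cochains -/

section Insertion

variable {k : Type*} [Field k] {A : Type*} [Ring A] [Algebra k A]
variable {M : Type*} [AddCommGroup M] [Module k M]

/-- The sum of `P F` over all places of a word, `P` acting behind the letters in front of that
place, with the sign `θ` for each of these letters. -/
def sweep (θ : k) (P : (List A → M) →ₗ[k] (List A → M)) :
    (List A → M) →ₗ[k] (List A → M) where
  toFun F w := splitSum (fun u v => θ ^ u.length • P (fun z => F (u ++ z)) v) w
  map_add' F G := by
    funext w
    rw [Pi.add_apply, ← splitSum_add]
    refine splitSum_congr fun u v _ => ?_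
    rw [← smul_add, ← Pi.add_apply, ← map_add]
    rfl
  map_smul' c F := by
    funext w
    rw [Pi.smul_apply, RingHom.id_apply, ← splitSum_smul]
    refine splitSum_congr fun u v _ => ?_
    rw [smul_comm, ← Pi.smul_apply c, ← map_smul]
    rfl

theorem sweep_apply (θ : k) (P : (List A → M) →ₗ[k] (List A → M)) (F : List A → M)
    (w : List A) :
    sweep θ P F w = splitSum (fun u v => θ ^ u.length • P (fun z => F (u ++ z)) v) w := rfl

theorem sweep_nil (θ : k) (P : (List A → M) →ₗ[k] (List A → M)) (F : List A → M) :
    sweep θ P F [] = P F [] := by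
  simp [sweep_apply]

theorem sweep_cons (θ : k) (P : (List A → M) →ₗ[k] (List A → M)) (F : List A → M) (a : A)
    (w : List A) :
    sweep θ P F (a :: w) = P F (a :: w) + θ • sweep θ P (fun z => F (a :: z)) w := by
  simp only [sweep_apply, splitSum_cons, ← splitSum_smul, smul_smul, List.length_cons, pow_succ',
    List.length_nil, pow_zero, one_smul, List.nil_append, List.cons_append]

/-- The sum over all initial subwords `y` of the operator that puts `f y` in front and applies
`T` to the rest of the word. -/
def headThen (f : List A → A) (T : (List A → M) →ₗ[k] (List A → M)) :
    (List A → M) →ₗ[k] (List A → M) where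
  toFun F w := splitSum (fun y z => T (fun x => F (f y :: x)) z) w
  map_add' F G := by
    funext w
    rw [Pi.add_apply, ← splitSum_add]
    refine splitSum_congr fun u v _ => ?_
    rw [← Pi.add_apply, ← map_add]
    rfl
  map_smul' c F := by
    funext w
    rw [Pi.smul_apply, RingHom.id_apply, ← splitSum_smul]
    refine splitSum_congr fun u v _ => ?_
    rw [← Pi.smul_apply, ← map_smul]
    rfl

theorem headThen_apply (f : List A → A) (T : (List A → M) →ₗ[k] (List A → M)) (F : List A → M)
    (w : List A) :
    headThen f T F w = splitSum (fun y z => T (fun x => F (f y :: x)) z) w := rfl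

/-- The dual of the coderivation of the bar coalgebra that extends `f`: the sum of
`±F (u, f y, z)` over all ways to write a word as `u ++ y ++ z`, with the sign `θ` for each letter
of `u`. For `f` of degree `n` it is used with `θ = (-1)^(n - 1)`; this relation between `θ` and the
degree of `f` is expressed by `twist (-1) f = -θ • f`. -/
def insertion (θ : k) (f : List A → A) : (List A → M) →ₗ[k] (List A → M) :=
  sweep θ (headThen f LinearMap.id)

/-- The simultaneous insertion of `f` and, to the right of it, of `g`. -/
def insertion₂ (θ σ : k) (f g : List A → A) : (List A → M) →ₗ[k] (List A → M) :=
  sweep (θ * σ) (headThen f (insertion σ g))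

/-- If `P` commutes up to `P'` with the bar differential, with a correction for the product of
the first letter with what `P` inserts, then so does the sum of `P` over all places. -/
theorem bar_sweep {θ : k} (hθ : θ * θ = 1) {P P' : (List A → M) →ₗ[k] (List A → M)}
    (h : ∀ F : List A → M, IsMulti k F → ∀ w, bar (P F) w - θ • P (bar F) w
      - headTerm (fun a z => P (headMul a F) z) w = P' F w)
    {F : List A → M} (hF : IsMulti k F) :
    bar (sweep θ P F) = θ • sweep θ P (bar F) + sweep (-θ) P' F := by
  funext w
  rw [Pi.add_apply, Pi.smul_apply]
  induction w generalizing F with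
  | nil =>
    have := h F hF []
    simp only [sweep_nil, bar_nil, headTerm_nil, sub_zero, zero_sub] at this ⊢
    rw [← this]; simp
  | cons a w ih =>
    have h₁ : (fun z => sweep θ P F (a :: z)) =
        fun z => P F (a :: z) + θ • sweep θ P (fun z => F (a :: z)) z := by
      funext z; rw [sweep_cons]
    have h₂ : (fun z => bar F (a :: z)) = headMul a F - bar (fun z => F (a :: z)) := by
      funext z; rw [bar_cons]; rfl
    have h₃ : headMul a (sweep θ P F) w =
        headMul a (P F) w - P (headMul a F) w + sweep θ P (headMul a F) w := by
      rcases w with _ | ⟨c, w⟩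
      · simp [sweep_nil]
      · simp only [headMul_cons, sweep_cons]
        abel
    have h₄ := h F hF (a :: w)
    rw [bar_cons, headTerm_cons] at h₄
    rw [bar_cons, h₁, bar_add, bar_smul, ih (hF.cons a), sweep_cons, sweep_cons, h₂, map_sub, h₃,
      ← h₄, Pi.sub_apply]
    simp only [smul_sub, smul_add, smul_smul, hθ, one_smul, neg_smul]
    abel

theorem splitSum_conv_letter (H : A →ₗ[k] (List A → M)) (f : List A → A) (w : List A) :
    splitSum (fun y z => H ((f ⌢ letter) y) z) w =
      splitSum (fun y z => headTerm (fun c x => H (f y * c) x) z) w := by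
  have key := splitSum_assoc (fun y x z => match x with | [c] => H (f y * c) z | _ => 0) w
  refine Eq.trans (splitSum_congr fun y z _ => ?_) (key.trans (splitSum_congr fun y z _ => ?_))
  · rw [conv_letter]
    exact map_lastSum ((LinearMap.proj z : (List A → M) →ₗ[k] M) ∘ₗ H) (fun u x => f u * x) y
  · rcases z with _ | ⟨c, _ | ⟨d, z⟩⟩
    · simp
    · simp [splitSum_cons]
    · simp only [splitSum_cons, headTerm_cons, zero_add]
      rw [splitSum_eq_zero fun u v _ => rfl, add_zero]

theorem splitSum_letter_conv (H : A →ₗ[k] (List A → M)) (f : List A → A) (w : List A) :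
    splitSum (fun y z => H ((letter ⌢ f) y) z) w =
      headTerm (fun a w => splitSum (fun y z => H (a * f y) z) w) w := by
  rcases w with _ | ⟨a, w⟩
  · simp
  · simp [splitSum_cons, letter_conv]

/-- The commutator of the bar differential with the operator `headThen f T`, up to the product of
the first letter with what is inserted. In it `R` is the part of `T` that inserts at the first
place. -/
theorem bar_headThen {θ t : k} (ht : t * t = 1) {f : List A → A}
    (hf : twist (-1 : k) f = -θ • f) {T : (List A → M) →ₗ[k] (List A → M)}
    (hT : ∀ F, IsMulti k F → bar (T F) = t • T (bar F)) {R : A → (List A → M) → (List A → M)}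
    (hR : ∀ x F z, T (headMul x F) z = R x F z +
      t • headTerm (fun c y => T (fun z => F ((x * c) :: z)) y) z)
    {F : List A → M} (hF : IsMulti k F) (w : List A) :
    bar (headThen f T F) w - (θ * t) • headThen f T (bar F) w
      - headTerm (fun a z => headThen f T (headMul a F) z) w =
    - headThen (wordDiff k f) T F w - (θ * t) • splitSum (fun y z => R (f y) F z) w := by
  set H : A →ₗ[k] (List A → M) := T ∘ₗ hF.headLin with hH
  have hHT : ∀ x, T (fun z => F (x :: z)) = H x := fun x => rfl
  have hS : ∀ (g : List A → A) (w), headThen g T F w = splitSum (fun y z => H (g y) z) w :=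
    fun g w => rfl
  have h₁ : bar (headThen f T F) w = splitSum (fun y z => H (bar f y) z) w
      - (θ * t) • splitSum (fun y z => T (bar fun x => F (f y :: x)) z) w := by
    refine (bar_splitSum (k := k) (fun y z => H (f y) z) w).trans ?_
    rw [← splitSum_smul, ← splitSum_sub]
    refine splitSum_congr fun y z _ => ?_
    rw [sub_eq_add_neg]
    congr 1
    · exact map_bar ((LinearMap.proj z : (List A → M) →ₗ[k] M) ∘ₗ H) f y
    · rw [← hHT, hT _ (hF.cons _)]
      have e : (-1 : k) ^ y.length • f y = -θ • f y := congrFun hf y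
      have := congrArg (fun x => t • T (bar (hF.headLin x)) z) e
      have hb : ∀ (c : k) (x : A), T (bar (hF.headLin (c • x))) = c • T (bar (hF.headLin x)) := by
        intro c x
        rw [map_smul, show bar (c • hF.headLin x) = c • bar (hF.headLin x) from
          funext fun w => bar_smul c (hF.headLin x) w, map_smul]
      simp only [hb, Pi.smul_apply] at this
      rw [Pi.smul_apply, smul_comm]
      refine this.trans ?_
      rw [smul_smul, ← neg_smul, mul_neg, mul_comm]
      rfl
  have h₂ : headThen f T (bar F) w = splitSum (fun y z => R (f y) F z) w
      + t • splitSum (fun y z => H ((f ⌢ letter) y) z) w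
      - splitSum (fun y z => T (bar fun x => F (f y :: x)) z) w := by
    rw [splitSum_conv_letter, ← splitSum_smul, ← splitSum_add, ← splitSum_sub, headThen_apply]
    refine splitSum_congr fun y z _ => ?_
    have : (fun x => bar F (f y :: x)) = headMul (f y) F - bar fun x => F (f y :: x) := by
      funext x; rw [bar_cons]; rfl
    rw [this, map_sub, Pi.sub_apply, hR]
    rfl
  have h₃ : headTerm (fun a z => headThen f T (headMul a F) z) w =
      splitSum (fun y z => H ((letter ⌢ f) y) z) w := by
    rw [splitSum_letter_conv]
    rfl
  have h₄ : headThen (wordDiff k f) T F w = splitSum (fun y z => H ((letter ⌢ f) y) z) w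
      + θ • splitSum (fun y z => H ((f ⌢ letter) y) z) w
      - splitSum (fun y z => H (bar f y) z) w := by
    rw [hS, ← splitSum_smul, ← splitSum_add, ← splitSum_sub]
    refine splitSum_congr fun y z _ => ?_
    rw [wordDiff, hf, smul_conv]
    simp only [Pi.sub_apply, Pi.smul_apply, map_sub, map_smul, neg_smul, sub_neg_eq_add,
      Pi.add_apply, map_add]
  rw [h₁, h₂, h₃, h₄]
  simp only [smul_add, smul_sub, smul_smul, mul_assoc, ht, mul_one]
  abel

/-- The coderivation that extends `f` commutes, up to sign, with the bar differential if `f` is a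
cocycle; in general the commutator is the coderivation that extends the differential of `f`. -/
theorem bar_insertion {θ : k} (hθ : θ * θ = 1) {f : List A → A} (hf : twist (-1 : k) f = -θ • f)
    {F : List A → M} (hF : IsMulti k F) :
    bar (insertion θ f F) = θ • insertion θ f (bar F) - insertion (-θ) (wordDiff k f) F := by
  have := bar_sweep (θ := θ) hθ (P := headThen f LinearMap.id)
    (P' := - headThen (wordDiff k f) LinearMap.id) (fun F hF w => by
      have := bar_headThen (t := 1) (by simp) hf (T := LinearMap.id) (fun F _ => by simp)
        (R := fun _ _ _ => 0) (fun x F z => by cases z <;> simp) hF w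
      simpa using this) hF
  rw [insertion, this, insertion, sub_eq_add_neg]
  congr 1
  funext w
  simp [sweep_apply, splitSum_neg]

theorem bar_insertion_of_cocycle {θ : k} (hθ : θ * θ = 1) {f : List A → A}
    (hf : twist (-1 : k) f = -θ • f) (hf' : wordDiff k f = 0) {F : List A → M}
    (hF : IsMulti k F) : bar (insertion θ f F) = θ • insertion θ f (bar F) := by
  rw [bar_insertion hθ hf hF, hf', sub_eq_self]
  funext w
  rw [insertion, sweep_apply, Pi.zero_apply]
  refine splitSum_eq_zero fun u v _ => ?_
  exact (congrArg _ (splitSum_eq_zero fun y z _ => hF.zero u z)).trans (smul_zero _)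

theorem insertion_headMul (θ : k) (f : List A → A) (x : A) (F : List A → M) (z : List A) :
    insertion θ f (headMul x F) z = splitSum (fun y z => F ((x * f y) :: z)) z +
      θ • headTerm (fun c y => insertion θ f (fun z => F ((x * c) :: z)) y) z := by
  rcases z with _ | ⟨c, z⟩
  · simp [insertion, sweep_nil, headThen_apply]
  · rw [insertion, sweep_cons]
    simp [headThen_apply]

/-- The commutator of the bar differential with the simultaneous insertion of two cocycles is the
insertion of their product: the term in which the two inserted values are neighbours. -/
theorem bar_insertion₂ {θ σ : k} (hθ : θ * θ = 1) (hσ : σ * σ = 1) {f g : List A → A}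
    (hf : twist (-1 : k) f = -θ • f) (hg : twist (-1 : k) g = -σ • g)
    (hf' : wordDiff k f = 0) (hg' : wordDiff k g = 0) {F : List A → M} (hF : IsMulti k F) :
    bar (insertion₂ θ σ f g F) =
      (θ * σ) • insertion₂ θ σ f g (bar F) - (θ * σ) • insertion (-(θ * σ)) (f ⌢ g) F := by
  have := bar_sweep (θ := θ * σ) (by linear_combination (σ * σ) * hθ + hσ)
    (P := headThen f (insertion σ g))
    (P' := -((θ * σ) • headThen (f ⌢ g) LinearMap.id)) (fun F hF w => by
      rw [bar_headThen hσ hf (fun F hF => bar_insertion_of_cocycle hσ hg hg' hF)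
        (fun x F z => insertion_headMul σ g x F z) hF w, hf',
        ← splitSum_assoc (fun y y' z => F ((f y * g y') :: z)), headThen_apply,
        splitSum_eq_zero fun y z _ => ?_, neg_zero, zero_sub]
      · simp only [LinearMap.neg_apply, Pi.neg_apply, LinearMap.smul_apply, Pi.smul_apply,
          headThen_apply]
        congr 2
        refine splitSum_congr fun y z _ => ?_
        exact (map_splitSum ((LinearMap.proj z : (List A → M) →ₗ[k] M) ∘ₗ hF.headLin)
          (fun u v => f u * g v) y).symm
      · have : (fun x => F ((0 : List A → A) y :: x)) = 0 := funext fun x => hF.head_zero x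
        rw [this, map_zero, Pi.zero_apply]) hF
  rw [insertion₂, this, insertion, sub_eq_add_neg]
  congr 1
  funext w
  simp only [sweep_apply, LinearMap.neg_apply, LinearMap.smul_apply, Pi.neg_apply, Pi.smul_apply,
    smul_neg, splitSum_neg, smul_comm _ (θ * σ), splitSum_smul, insertion]

/-- If the head operator `P` is a derivation of the convolution product up to `E F ⌢ G'`, then so
is the sum of `P` over all places. -/
theorem sweep_conv {θ : k} {P E : (List A → A) →ₗ[k] (List A → A)} {G G' : List A → A}
    (hmul : ∀ (x : A) F w, P (fun z => x * F z) w = x * P F w)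
    (h : ∀ F, IsMulti k F → ∀ w,
      P (F ⌢ G) w = F [] * P G w + (P F ⌢ G) w + (E F ⌢ G') w)
    {F : List A → A} (hF : IsMulti k F) :
    sweep θ P (F ⌢ G) =
      sweep θ P F ⌢ G + twist θ F ⌢ sweep θ P G + sweep θ E F ⌢ G' := by
  have hmul' : ∀ (x : A) F w, sweep θ P (fun z => x * F z) w = x * sweep θ P F w := by
    intro x F w
    rw [sweep_apply, sweep_apply, mul_splitSum]
    refine splitSum_congr fun u v _ => ?_
    rw [hmul, mul_smul_comm]
  have hcons : ∀ (P : (List A → A) →ₗ[k] (List A → A)) (F G : List A → A) (a w),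
      (sweep θ P F ⌢ G) (a :: w) =
        (P F ⌢ G) (a :: w) + θ • (sweep θ P (fun z => F (a :: z)) ⌢ G) w := by
    intro P F G a w
    have : (fun z => sweep θ P F (a :: z)) =
        (fun z => P F (a :: z)) + θ • sweep θ P (fun z => F (a :: z)) :=
      funext fun z => sweep_cons _ _ _ _ _
    rw [conv_cons, conv_cons, this, add_conv, smul_conv, sweep_nil, Pi.add_apply, Pi.smul_apply,
      add_assoc]
  funext w
  rw [Pi.add_apply, Pi.add_apply]
  induction w generalizing F with
  | nil => simp [sweep_nil, h F hF, twist, add_comm, add_assoc]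
  | cons a w ih =>
    have h₁ : (fun z => (F ⌢ G) (a :: z)) =
        (fun z => F [] * G (a :: z)) + (fun z => F (a :: z)) ⌢ G :=
      funext fun z => conv_cons _ _ _ _
    have h₂ : (fun z => twist θ F (a :: z)) = θ • twist θ (fun z => F (a :: z)) :=
      funext fun z => by simp [twist, pow_succ', smul_smul]
    have h₃ : twist θ F [] = F [] := by simp [twist]
    rw [sweep_cons, h F hF, h₁, map_add, Pi.add_apply, hmul', ih (hF.cons a), hcons, hcons,
      conv_cons (twist θ F), h₂, smul_conv, Pi.smul_apply, h₃, sweep_cons, mul_add,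
      mul_smul_comm]
    simp only [smul_add]
    abel

theorem insertion_mul_left (θ : k) (f : List A → A) (x : A) (F : List A → A) (w : List A) :
    insertion θ f (fun z => x * F z) w = x * insertion θ f F w := by
  simp only [insertion, sweep_apply, headThen_apply, LinearMap.id_apply, mul_splitSum,
    mul_smul_comm]

/-- The coderivation that extends `f` acts on the convolution product as a derivation. -/
theorem insertion_conv (θ : k) (f : List A → A) {F : List A → A} (hF : IsMulti k F)
    (G : List A → A) :
    insertion θ f (F ⌢ G) = insertion θ f F ⌢ G + twist θ F ⌢ insertion θ f G := by
  have := sweep_conv (θ := θ) (P := headThen f LinearMap.id) (E := 0) (G := G) (G' := 0)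
    (fun x F w => by simp only [headThen_apply, LinearMap.id_apply, mul_splitSum])
    (fun F _ w => by
      simp only [headThen_apply, LinearMap.id_apply, conv_cons, splitSum_add, mul_splitSum,
        LinearMap.zero_apply]
      rw [show ((0 : List A → A) ⌢ 0) w = 0 from splitSum_eq_zero fun u v _ => by simp, add_zero]
      congr 1
      change splitSum (fun y z => splitSum (fun z₁ z₂ => F (f y :: z₁) * G z₂) z) w =
        splitSum (fun u v => splitSum (fun y z => F (f y :: z)) u * G v) w
      simp only [splitSum_mul]
      exact (splitSum_assoc (fun y z v => F (f y :: z) * G v) w).symm) hF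
  have h₀ : sweep θ (0 : (List A → A) →ₗ[k] (List A → A)) F ⌢ 0 = 0 :=
    funext fun w => splitSum_eq_zero fun u v _ => by simp
  rw [h₀, add_zero] at this
  exact this

/-- The operator `twist σ`, as a linear map. -/
def twistₗ (σ : k) : (List A → M) →ₗ[k] (List A → M) where
  toFun := twist σ
  map_add' := twist_add σ
  map_smul' c F := twist_smul σ c F

/-- The simultaneous insertion on a product: both `f` and `g` are inserted into one of the
factors, or one into each of them. -/
theorem insertion₂_conv {θ σ c : k} (hc : c * c = 1) {f : List A → A} (g : List A → A)
    (hf : twist σ f = c • f) {F : List A → A} (hF : IsMulti k F) (G : List A → A) :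
    insertion₂ θ σ f g (F ⌢ G) = insertion₂ θ σ f g F ⌢ G
      + twist (θ * σ) F ⌢ insertion₂ θ σ f g G
      + c • (twist σ (insertion θ f F) ⌢ insertion σ g G) := by
  have := sweep_conv (θ := θ * σ) (P := headThen f (insertion σ g))
    (E := c • twistₗ σ ∘ₗ headThen f LinearMap.id) (G := G) (G' := insertion σ g G)
    (fun x F w => by simp only [headThen_apply, insertion_mul_left, mul_splitSum])
    (fun F hF w => by
      have h₁ : ∀ x, (fun z => (F ⌢ G) (x :: z)) =
          (fun z => F [] * G (x :: z)) + (fun z => F (x :: z)) ⌢ G :=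
        fun x => funext fun z => conv_cons _ _ _ _
      simp only [headThen_apply, h₁, map_add, Pi.add_apply, insertion_mul_left, splitSum_add,
        mul_splitSum, insertion_conv σ g (hF.cons _)]
      rw [add_assoc]
      congr 2
      · change splitSum (fun y z => splitSum (fun z₁ z₂ =>
            insertion σ g (fun x => F (f y :: x)) z₁ * G z₂) z) w =
          splitSum (fun u v =>
            splitSum (fun y z => insertion σ g (fun x => F (f y :: x)) z) u * G v) w
        simp only [splitSum_mul]
        exact (splitSum_assoc
          (fun y z v => insertion σ g (fun x => F (f y :: x)) z * G v) w).symm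
      · refine (splitSum_assoc (fun y z v => twist σ (fun z => F (f y :: z)) z *
          insertion σ g G v) w).symm.trans ?_
        refine splitSum_congr fun u v _ => ?_
        rw [← splitSum_mul]
        congr 1
        change _ = c • σ ^ u.length • splitSum (fun y z => F (f y :: z)) u
        rw [← splitSum_smul (k := k) (M := A), ← splitSum_smul (k := k) (M := A)]
        refine splitSum_congr fun y z e => ?_
        have : σ ^ y.length • f y = c • f y := congrFun hf y
        rw [← e, List.length_append, pow_add, mul_comm, mul_smul, smul_comm c, ← hF.head_smul,
          ← hF.head_smul, this]
        simp [twist, smul_smul, hc]) hF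
  have h₀ : sweep (θ * σ) (c • twistₗ σ ∘ₗ headThen f LinearMap.id) F =
      c • twist σ (insertion θ f F) := by
    funext w
    rw [Pi.smul_apply, twist, insertion, sweep_apply, sweep_apply, ← splitSum_smul (k := k),
      ← splitSum_smul (k := k) (M := A)]
    refine splitSum_congr fun u v e => ?_
    simp only [LinearMap.smul_apply, LinearMap.comp_apply, Pi.smul_apply, twistₗ,
      LinearMap.coe_mk, AddHom.coe_mk, twist, smul_smul, ← e, List.length_append, mul_pow, pow_add]
    congr 1
    ring
  rw [h₀, smul_conv] at this
  exact this

theorem insertion_letter (θ : k) (f : List A → A) :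
    insertion θ f (letter : List A → A) = f := by
  funext w
  rcases w with _ | ⟨a, w⟩
  · rw [insertion, sweep_nil, headThen_apply]
    simp
  · rw [insertion, sweep_cons, headThen_apply]
    have h₁ : sweep θ (headThen f LinearMap.id) (fun z => letter (a :: z)) w = 0 := by
      rw [sweep_apply]
      refine splitSum_eq_zero fun u v _ => ?_
      rw [headThen_apply, splitSum_eq_zero fun y z _ => ?_, smul_zero]
      rcases u with _ | ⟨b, u⟩ <;> rfl
    have h₂ : ∀ (w : List A) (f : List A → A),
        splitSum (fun y z => letter (f y :: z)) w = f w := by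
      intro w
      induction w with
      | nil => simp
      | cons b w ih => intro f; rw [splitSum_cons, ih fun u => f (b :: u)]; simp
    rw [h₁, smul_zero, add_zero]
    exact h₂ _ _

theorem insertion₂_letter (θ σ : k) (f g : List A → A) :
    insertion₂ θ σ f g (letter : List A → A) = 0 := by
  have h : ∀ (u v z : List A) (a b : A), letter (u ++ a :: (v ++ b :: z)) = 0 := by
    rintro (_ | ⟨c, _ | ⟨d, u⟩⟩) (_ | ⟨e, v⟩) z a b <;> rfl
  funext w
  rw [insertion₂, sweep_apply]
  refine splitSum_eq_zero fun u v _ => ?_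
  rw [headThen_apply, splitSum_eq_zero fun y z _ => ?_, smul_zero]
  rw [insertion, sweep_apply]
  refine splitSum_eq_zero fun u' v' _ => ?_
  exact (congrArg (σ ^ u'.length • ·) (splitSum_eq_zero fun y' z _ => h u u' z (f y) (g y'))).trans
    (smul_zero _)

theorem isMulti_letter : IsMulti k (letter : List A → A) := by
  constructor
  · rintro (_ | ⟨c, _ | ⟨d, u⟩⟩) x y (_ | ⟨e, v⟩) <;> simp [letter]
  · rintro (_ | ⟨c, _ | ⟨d, u⟩⟩) x y (_ | ⟨e, v⟩) <;> simp [letter]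

end Insertion

/-! ### Multilinearity and the differential of insertions -/

section Homotopies

variable {k : Type*} [Field k] {A : Type*} [Ring A] [Algebra k A]
variable {M : Type*} [AddCommGroup M] [Module k M] {N : Type*} [AddCommGroup N] [Module k N]

theorem splitSum_append_cons (H : List A → List A → M) (v : List A) (a : A) (u : List A) :
    splitSum H (v ++ a :: u) = splitSum (fun v₁ v₂ => H v₁ (v₂ ++ a :: u)) v
      + splitSum (fun u₁ u₂ => H (v ++ a :: u₁) u₂) u := by
  induction v generalizing H with
  | nil => simp [splitSum_cons]
  | cons b v ih =>
    rw [List.cons_append, splitSum_cons, ih, splitSum_cons, ← add_assoc]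
    rfl

namespace IsMulti

theorem splitSum {H : List A → List A → M} (h₁ : ∀ v, IsMulti k fun u => H u v)
    (h₂ : ∀ u, IsMulti k (H u)) : IsMulti k (splitSum H) := by
  constructor
  · intro u x y v
    simp only [splitSum_append_cons, (h₁ _).add, (h₂ _).add, splitSum_add]
    abel
  · intro u c x v
    simp only [splitSum_append_cons, (h₁ _).smul, (h₂ _).smul, splitSum_smul, smul_add]

theorem map {F : List A → M} (hF : IsMulti k F) (φ : M →ₗ[k] N) :
    IsMulti k (fun w => φ (F w)) :=
  ⟨fun u x y v => by rw [hF.add, map_add], fun u c x v => by rw [hF.smul, map_smul]⟩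

theorem add' {F G : List A → M} (hF : IsMulti k F) (hG : IsMulti k G) : IsMulti k (F + G) :=
  ⟨fun u x y v => by simp only [Pi.add_apply, hF.add, hG.add]; abel,
    fun u c x v => by simp only [Pi.add_apply, hF.smul, hG.smul, smul_add]⟩

theorem smul' {F : List A → M} (hF : IsMulti k F) (c : k) : IsMulti k (c • F) :=
  hF.map (LinearMap.lsmul k M c)

theorem zero' : IsMulti k (0 : List A → M) :=
  ⟨fun _ _ _ _ => by simp, fun _ _ _ _ => by simp⟩

theorem twist {F : List A → M} (hF : IsMulti k F) (θ : k) : IsMulti k (twist θ F) := by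
  constructor
  · intro u x y v
    simp only [HochschildBV.twist, hF.add, smul_add, List.length_append, List.length_cons]
  · intro u c x v
    simp only [HochschildBV.twist, hF.smul, List.length_append, List.length_cons, smul_comm c]

theorem sweep {P : (List A → M) →ₗ[k] (List A → M)} (hP : ∀ F, IsMulti k F → IsMulti k (P F))
    {F : List A → M} (hF : IsMulti k F) (θ : k) : IsMulti k (sweep θ P F) := by
  refine splitSum (H := fun u v => θ ^ u.length • P (fun z => F (u ++ z)) v)
    (fun v => ⟨fun u x y u' => ?_, fun u c x u' => ?_⟩) fun u => (hP _ (hF.shift u)).smul' _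
  · have : (fun z => F (u ++ (x + y) :: u' ++ z)) =
        (fun z => F (u ++ x :: u' ++ z)) + fun z => F (u ++ y :: u' ++ z) := by
      funext z; simpa using hF.add u x y (u' ++ z)
    simp only [this, map_add, Pi.add_apply, smul_add, List.length_append, List.length_cons]
  · have : (fun z => F (u ++ (c • x) :: u' ++ z)) = c • fun z => F (u ++ x :: u' ++ z) := by
      funext z; simpa using hF.smul u c x (u' ++ z)
    simp only [this, map_smul, Pi.smul_apply, List.length_append, List.length_cons, smul_comm c]

theorem headThen {T : (List A → M) →ₗ[k] (List A → M)}
    (hT : ∀ F, IsMulti k F → IsMulti k (T F)) {F : List A → M} (hF : IsMulti k F)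
    {f : List A → A} (hf : IsMulti k f) : IsMulti k (headThen f T F) :=
  splitSum (fun z => hf.map ((LinearMap.proj z : (List A → M) →ₗ[k] M) ∘ₗ T ∘ₗ hF.headLin))
    fun _ => hT _ (hF.cons _)

theorem insertion {F : List A → M} (hF : IsMulti k F) {f : List A → A} (hf : IsMulti k f)
    (θ : k) : IsMulti k (insertion θ f F) :=
  sweep (fun _ h => headThen (fun _ h => h) h hf) hF θ

theorem insertion₂ {F : List A → M} (hF : IsMulti k F) {f g : List A → A} (hf : IsMulti k f)
    (hg : IsMulti k g) (θ σ : k) : IsMulti k (insertion₂ θ σ f g F) :=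
  sweep (fun _ h => headThen (fun _ h => h.insertion hg σ) h hf) hF _

end IsMulti

theorem twist_sweep {t : k} (θ : k) {P : (List A → M) →ₗ[k] (List A → M)}
    (hP : ∀ F, IsMulti k F → twist (-1 : k) (P F) = t • P (twist (-1 : k) F))
    {F : List A → M} (hF : IsMulti k F) :
    twist (-1 : k) (sweep θ P F) = t • sweep θ P (twist (-1 : k) F) := by
  funext w
  rw [twist, Pi.smul_apply, sweep_apply, sweep_apply, ← splitSum_smul, ← splitSum_smul]
  refine splitSum_congr fun u v e => ?_
  have h₁ : (fun z => twist (-1 : k) F (u ++ z)) =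
      (-1 : k) ^ u.length • twist (-1 : k) (fun z => F (u ++ z)) := by
    funext z; simp [twist, pow_add, smul_smul]
  have h₂ := congrFun (hP _ (hF.shift u)) v
  rw [twist, Pi.smul_apply] at h₂
  rw [h₁, map_smul, ← e, List.length_append, pow_add, mul_smul, smul_comm _ (θ ^ u.length),
    h₂, Pi.smul_apply]
  simp only [smul_smul]
  congr 1
  ring

theorem twist_headThen {θ t : k} {f : List A → A}
    (hf : twist (-1 : k) f = -θ • f) {T : (List A → M) →ₗ[k] (List A → M)}
    (hT : ∀ F, IsMulti k F → twist (-1 : k) (T F) = t • T (twist (-1 : k) F))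
    {F : List A → M} (hF : IsMulti k F) :
    twist (-1 : k) (headThen f T F) = (θ * t) • headThen f T (twist (-1 : k) F) := by
  funext w
  rw [twist, Pi.smul_apply, headThen_apply, headThen_apply, ← splitSum_smul, ← splitSum_smul]
  refine splitSum_congr fun y z e => ?_
  have h₁ : (fun z => twist (-1 : k) F (f y :: z)) =
      - twist (-1 : k) (fun z => F (f y :: z)) := by
    funext z; simp [twist, pow_add]
  have h₂ := congrFun (hT _ (hF.cons (f y))) z
  have h₃ : (-1 : k) ^ y.length • f y = -θ • f y := congrFun hf y
  have h₄ := congrArg (fun x => T (hF.headLin x) z) h₃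
  simp only [map_smul, Pi.smul_apply] at h₄
  rw [twist, Pi.smul_apply] at h₂
  rw [← e, List.length_append, pow_add, mul_comm, mul_smul]
  refine (congrArg _ h₄).trans ?_
  rw [h₁, map_neg, Pi.neg_apply, smul_comm]
  refine (congrArg _ h₂).trans ?_
  rw [smul_smul, smul_neg, neg_mul, neg_smul]

theorem twist_insertion {θ : k} {f : List A → A} (hf : twist (-1 : k) f = -θ • f)
    {F : List A → M} (hF : IsMulti k F) :
    twist (-1 : k) (insertion θ f F) = θ • insertion θ f (twist (-1 : k) F) :=
  twist_sweep θ (fun F hF => by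
    simpa using twist_headThen (t := 1) hf (T := LinearMap.id) (by simp) hF) hF

theorem twist_insertion₂ {θ σ : k} {f g : List A → A}
    (hf : twist (-1 : k) f = -θ • f) (hg : twist (-1 : k) g = -σ • g)
    {F : List A → M} (hF : IsMulti k F) :
    twist (-1 : k) (insertion₂ θ σ f g F) = (θ * σ) • insertion₂ θ σ f g (twist (-1 : k) F) :=
  twist_sweep _ (fun _ hF => twist_headThen hf (fun _ hF => twist_insertion hg hF) hF) hF

theorem bar_of_cocycle {F : List A → A} (hF : wordDiff k F = 0) :
    bar F = letter ⌢ F - twist (-1 : k) F ⌢ letter :=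
  (sub_eq_zero.1 hF).symm

/-- The circle product of cocycles is a homotopy between their products in the two orders. -/
theorem wordDiff_insertion {θ : k} (hθ : θ * θ = 1) {f g : List A → A}
    (hg : twist (-1 : k) g = -θ • g) (hf' : wordDiff k f = 0) (hg' : wordDiff k g = 0)
    (hf : IsMulti k f) :
    wordDiff k (insertion θ g f) = θ • (twist θ (twist (-1 : k) f) ⌢ g - g ⌢ f) := by
  rw [wordDiff, twist_insertion hg hf, bar_insertion_of_cocycle hθ hg hg' hf, bar_of_cocycle hf',
    map_sub, insertion_conv θ g isMulti_letter, insertion_conv θ g (hf.twist _), insertion_letter,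
    twist_letter]
  simp only [smul_conv, smul_sub, smul_add, smul_smul, hθ, one_smul]
  abel

/-- The simultaneous insertion of two cocycles into a third one is a homotopy for the Leibniz rule
of the circle product in its second argument. -/
theorem wordDiff_insertion₂ {θ σ c : k} (hθ : θ * θ = 1) (hσ : σ * σ = 1) (hc : c * c = 1)
    {f g h : List A → A} (hf : twist (-1 : k) f = -θ • f) (hg : twist (-1 : k) g = -σ • g)
    (hfc : twist σ f = c • f)
    (hf' : wordDiff k f = 0) (hg' : wordDiff k g = 0) (hh' : wordDiff k h = 0)
    (hh : IsMulti k h) :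
    wordDiff k (insertion₂ θ σ f g h) = (θ * σ) • (insertion (-(θ * σ)) (f ⌢ g) h
      - f ⌢ insertion σ g h + c • (twist σ (insertion θ f (twist (-1 : k) h)) ⌢ g)) := by
  have hϑ : (θ * σ) * (θ * σ) = 1 := by linear_combination (σ * σ) * hθ + hσ
  rw [wordDiff, twist_insertion₂ hf hg hh, bar_insertion₂ hθ hσ hf hg hf' hg' hh,
    bar_of_cocycle hh', map_sub, insertion₂_conv hc g hfc isMulti_letter,
    insertion₂_conv hc g hfc (hh.twist _), insertion₂_letter, insertion_letter, insertion_letter,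
    twist_letter, hfc]
  simp only [smul_conv, smul_sub, smul_add, smul_smul, zero_conv, conv_zero, hc, hϑ,
    one_smul, smul_zero]
  abel

end Homotopies

/-! ### Sums over rotations and the trace -/

section Rotation

variable {k : Type*} [Field k] {A : Type*} [Ring A] [Algebra k A]
variable {M : Type*} [AddCommGroup M] [Module k M]

/-- The sum over the cyclic rotations of the word `a :: w` of the values of `g` on them, an
operator `T` being applied to the letters behind `a`. The sign is `θ` for each letter that is moved
in front of `a`. For `T = id` this is the dual of `s N`, where `s` and `N` are the operators in
Connes' `B = (1 - t) s N`. -/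
def rotation (θ : k) (T : (List A → M) →ₗ[k] (List A → M)) (g : List A → M) (a : A)
    (w : List A) : M :=
  splitSum (fun u v => θ ^ v.length • T (fun z => g (v ++ a :: z)) u) w

/-- The bar differential of `g` in the letters behind a marked letter `a`, which itself is behind
`v`. It is `bar g` without the products of neighbours inside `v`, of the last letter of `v` with
`a`, and of `a` with the letter behind it. -/
theorem bar_tail (g : List A → M) (a : A) (v : List A) :
    (bar fun z => g (v ++ a :: z)) = (-1 : k) ^ v.length • (bar (fun v z => g (v ++ a :: z)) v
      + lastSum (fun v' x => (-1 : k) ^ v'.length • fun z => g (v' ++ (x * a) :: z)) v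
      - fun z => bar g (v ++ a :: z)) + headMul a (fun z => g (v ++ z)) := by
  funext z
  have h₁ := bar_append (k := k) g v (a :: z)
  have h₂ : bar (fun v z => g (v ++ a :: z)) v z = bar (fun v => g (v ++ a :: z)) v :=
    (map_bar (LinearMap.proj z : (List A → M) →ₗ[k] M) (fun v z => g (v ++ a :: z)) v).symm
  have h₃ : lastSum (fun v' x => (-1 : k) ^ v'.length • fun z => g (v' ++ (x * a) :: z)) v z =
      lastSum (fun v' x => (-1 : k) ^ v'.length • g (v' ++ (x * a) :: z)) v :=
    map_lastSum (LinearMap.proj z : (List A → M) →ₗ[k] M)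
      (fun v' x => (-1 : k) ^ v'.length • fun z => g (v' ++ (x * a) :: z)) v
  simp only [headMul_cons] at h₁
  simp only [Pi.add_apply, Pi.sub_apply, Pi.smul_apply, h₂, h₃, h₁, bar_cons]
  have h₄ : (-1 : k) ^ v.length * (-1 : k) ^ v.length = 1 := by
    rw [← mul_pow]; simp
  simp only [smul_sub, smul_add, smul_smul, h₄, one_smul]
  abel

/-- The bar differential of a sum over rotations. The bar differential of `g` also multiplies the
marked letter `a` with its neighbours. The products with the letter behind `a` are in the first
sum, and those with the letter in front of it, the last letter of `w`, in the last one. The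
hypothesis on the length of `w` is on its parity, which is that of the number of arguments of the
differential of the sum over rotations. -/
theorem bar_rotation {θ t : k} (hθ : θ * θ = 1) {T : (List A → M) →ₗ[k] (List A → M)}
    (hT : ∀ F, IsMulti k F → bar (T F) = t • T (bar F)) {g : List A → M} (hg : IsMulti k g)
    (a : A) {w : List A} (hw : (-1 : k) ^ w.length = -(t * θ)) :
    bar (rotation θ T g a) w =
      t • splitSum (fun u v => θ ^ v.length • T (headMul a fun z => g (v ++ z)) u) w
      - t • splitSum (fun u v => (-θ) ^ v.length • T (fun z => bar g (v ++ a :: z)) u) w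
      - lastSum (fun w' x => (-1 : k) ^ w'.length • rotation θ T g (x * a) w') w := by
  have hlast : lastSum (fun w' x => (-1 : k) ^ w'.length • rotation θ T g (x * a) w') w =
      (t * θ) • splitSum (fun u v => lastSum (fun v' x => θ ^ v'.length •
        T (fun z => g (v' ++ (x * a) :: z)) u) v) w := by
    rw [← lastSum_splitSum, ← lastSum_smul]
    refine lastSum_congr fun w' x e => ?_
    rw [← e, List.length_append, pow_add] at hw
    rw [rotation]
    congr 1
    simp only [List.length_singleton, pow_one] at hw
    linear_combination (-1 : k) * hw
  rw [hlast, ← splitSum_smul, ← splitSum_smul, ← splitSum_smul, ← splitSum_sub, ← splitSum_sub]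
  refine (bar_splitSum (k := k)
    (fun u v => θ ^ v.length • T (fun z => g (v ++ a :: z)) u) w).trans ?_
  refine splitSum_congr fun u v e => ?_
  have h₁ : bar (fun u => θ ^ v.length • T (fun z => g (v ++ a :: z)) u) u =
      θ ^ v.length • t • T (bar fun z => g (v ++ a :: z)) u := by
    rw [bar_smul]
    exact congrArg (fun F : List A → M => θ ^ v.length • F u) (hT _ ((hg.shift v).cons a))
  have h₂ : bar (fun v => θ ^ v.length • T (fun z => g (v ++ a :: z)) u) v =
      θ • θ ^ v.length • T (bar (fun v z => g (v ++ a :: z)) v) u := by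
    refine (congrFun (bar_twist hθ (fun v => T (fun z => g (v ++ a :: z)) u)) v).trans ?_
    rw [Pi.smul_apply, twist]
    congr 2
    exact map_bar ((LinearMap.proj u : (List A → M) →ₗ[k] M) ∘ₗ T) (fun v z => g (v ++ a :: z)) v
  have h₃ : lastSum (fun v' x => θ ^ v'.length • T (fun z => g (v' ++ (x * a) :: z)) u) v =
      - ((-1 : k) ^ v.length * (θ * θ ^ v.length)) • T (lastSum (fun v' x => (-1 : k) ^ v'.length •
        fun z => g (v' ++ (x * a) :: z)) v) u := by
    refine Eq.trans ?_ (congrArg (- ((-1 : k) ^ v.length * (θ * θ ^ v.length)) • ·)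
      (map_lastSum ((LinearMap.proj u : (List A → M) →ₗ[k] M) ∘ₗ T)
        (fun v' x => (-1 : k) ^ v'.length • fun z => g (v' ++ (x * a) :: z)) v).symm)
    rw [← lastSum_smul]
    refine lastSum_congr fun v' x e => ?_
    simp only [LinearMap.comp_apply, map_smul, LinearMap.proj_apply, smul_smul, ← e,
      List.length_append, List.length_singleton, pow_succ]
    congr 1
    have : (-1 : k) ^ v'.length * (-1 : k) ^ v'.length = 1 := by
      rw [← mul_pow]; simp
    linear_combination (-θ ^ v'.length * (θ * θ)) * this - θ ^ v'.length * hθ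
  rw [h₁, h₂, h₃, bar_tail (k := k)]
  simp only [map_add, map_sub, map_smul, Pi.add_apply, Pi.sub_apply, Pi.smul_apply]
  have h₄ : (-1 : k) ^ u.length = -(t * θ) * (-1 : k) ^ v.length := by
    rw [← hw, ← e, List.length_append, pow_add, mul_assoc, ← mul_pow]; simp
  have h₅ : (-θ) ^ v.length = (-1 : k) ^ v.length * θ ^ v.length := by
    rw [← mul_pow]; simp
  rw [h₄, h₅]
  match_scalars <;>
    first | ring1 | linear_combination (-(θ ^ v.length * t * (-1) ^ v.length)) * hθ

theorem splitSum_singleton_left (H : A → List A → M) (w : List A) :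
    splitSum (fun y z => match y with | [x] => H x z | _ => 0) w = headTerm H w := by
  rcases w with _ | ⟨x, w⟩
  · simp
  · rw [splitSum_cons, headTerm_cons, zero_add]
    rcases w with _ | ⟨y, w⟩
    · simp
    · rw [splitSum_cons, splitSum_eq_zero fun u v _ => rfl, add_zero]

/-- The first letter of `v` and the last letter of `u` are at the same place of a cyclic word. -/
theorem splitSum_conv_letter_right (σ : k) (Y : List A → List A → A) (w : List A) :
    splitSum (fun u v => σ ^ v.length • (Y v ⌢ letter) u) w =
      splitSum (fun u v => headTerm (fun x v' => σ ^ v'.length • (Y v' u * x)) v) w := by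
  refine Eq.trans ?_ ((splitSum_assoc (fun u y v =>
    match y with | [x] => σ ^ v.length • (Y v u * x) | _ => 0) w).trans
    (splitSum_congr fun u v _ => splitSum_singleton_left _ _))
  refine splitSum_congr fun u v _ => ?_
  rw [conv_letter, ← lastSum_smul (k := k)]
  refine splitSum_congr fun u' y _ => ?_
  rcases y with _ | ⟨x, _ | ⟨y, v⟩⟩ <;> rfl

/-- The function of words with value `x` on the empty word and zero elsewhere. -/
def onNil (x : M) : List A → M
  | [] => x
  | _ => 0

@[simp] theorem onNil_nil (x : M) : onNil x ([] : List A) = x := rfl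
@[simp] theorem onNil_cons (x : M) (a : A) (w : List A) : onNil x (a :: w) = 0 := rfl

theorem insertion_onNil (θ : k) (f : List A → A) (x : M) (w : List A) :
    insertion θ f (onNil x) w = 0 := by
  rw [insertion, sweep_apply]
  refine splitSum_eq_zero fun u v _ => ?_
  rw [headThen_apply, splitSum_eq_zero fun y z _ => ?_, smul_zero]
  rcases u with _ | ⟨b, u⟩ <;> rfl

section Trace

variable {tr : A →ₗ[k] k}

/-- The rotations of a product with a letter: this letter is the marked one, or by the trace
property it can be moved to the end of the other factor. -/
theorem trace_letter_conv_rotation (htr : ∀ a b, tr (a * b) = tr (b * a)) (σ : k)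
    {T : (List A → A) →ₗ[k] (List A → A)} (hmul : ∀ (x : A) F w, T (fun z => x * F z) w = x * T F w)
    (g : List A → A) (a : A) (w : List A) :
    tr (rotation σ T (letter ⌢ g) a w) = tr (a * T g w)
      + σ * tr (splitSum (fun u v =>
          σ ^ v.length • (T (fun z => g (v ++ a :: z)) ⌢ letter) u) w) := by
  have h₁ : ∀ u v : List A, σ ^ v.length • T (fun z => (letter ⌢ g) (v ++ a :: z)) u =
      (match v with | [] => a * T g u | _ => 0) + σ • headTerm (fun x v' =>
        σ ^ v'.length • (x * T (fun z => g (v' ++ a :: z)) u)) v := by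
    rintro u (_ | ⟨x, v⟩)
    · simp [letter_conv, hmul]
    · simp [letter_conv, hmul, pow_succ', smul_smul]
  have h₂ : ∀ (w : List A) (H : List A → A),
      splitSum (fun u v => match v with | [] => H u | _ => 0) w = H w := by
    intro w
    induction w with
    | nil => simp
    | cons b w ih => intro H; rw [splitSum_cons, ih fun u => H (b :: u)]; simp
  rw [splitSum_conv_letter_right σ fun v => T fun z => g (v ++ a :: z)]
  simp only [rotation, h₁, splitSum_add]
  rw [h₂, map_add, splitSum_smul (k := k), map_smul, smul_eq_mul, map_splitSum tr, map_splitSum tr]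
  congr 2
  refine splitSum_congr fun u v _ => ?_
  rcases v with _ | ⟨x, v⟩
  · simp
  · simp only [headTerm_cons, map_smul]
    rw [htr]

theorem conv_letter_append (g : List A → A) (v : List A) (a : A) (z : List A) :
    (g ⌢ letter) (v ++ a :: z) =
      ((fun z => g (v ++ a :: z)) ⌢ letter) z + onNil (g v * a) z := by
  rw [conv, splitSum_append_cons, add_comm]
  congr 1
  have h : ∀ (v : List A) (g : List A → A),
      splitSum (fun v₁ v₂ => g v₁ * letter (v₂ ++ a :: z)) v = g v * letter (a :: z) := by
    intro v
    induction v with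
    | nil => simp
    | cons b v ih =>
      intro g
      rw [splitSum_cons, ih fun u => g (b :: u)]
      rcases v with _ | ⟨c, v⟩ <;> simp
  rw [h]
  rcases z with _ | ⟨c, z⟩ <;> simp

theorem form_wordDiff (htr : ∀ a b, tr (a * b) = tr (b * a)) (F : List A → A) (a : A)
    (w : List A) :
    tr (a * wordDiff k F w) = headTerm (fun c w' => tr (a * c * F w')) w
      - lastSum (fun w' x => (-1 : k) ^ w'.length • tr (x * a * F w')) w
      - bar (fun z => tr (a * F z)) w := by
  rw [wordDiff, Pi.sub_apply, Pi.sub_apply, mul_sub, mul_sub, map_sub, map_sub, letter_conv,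
    conv_letter]
  congr 2
  · cases w <;> simp [mul_assoc]
  · refine (map_lastSum (tr ∘ₗ LinearMap.mulLeft k a) _ w).trans (lastSum_congr fun u x _ => ?_)
    simp only [LinearMap.comp_apply, LinearMap.mulLeft_apply, twist, smul_mul_assoc,
      map_smul]
    rw [← mul_assoc, htr, mul_assoc]
  · exact (map_bar (tr ∘ₗ LinearMap.mulLeft k a) F w).symm

/-- The differential of the cochain `K` whose form is a sum over rotations. By the trace property
the multiplication of the value of `K` from the right becomes the product of the last letter with
`a`, and it cancels the last term of `bar_rotation`. -/
theorem form_wordDiff_of_rotation (htr : ∀ a b, tr (a * b) = tr (b * a)) {θ t : k}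
    (hθ : θ * θ = 1) {T : (List A → A) →ₗ[k] (List A → A)}
    (hT : ∀ F, IsMulti k F → bar (T F) = t • T (bar F)) {g K : List A → A} (hg : IsMulti k g)
    (hK : ∀ a w, tr (a * K w) = tr (rotation θ T g a w))
    (a : A) {w : List A} (hw : (-1 : k) ^ w.length = -(t * θ)) :
    tr (a * wordDiff k K w) = tr (headTerm (fun c w' => rotation θ T g (a * c) w') w)
      - t * tr (splitSum (fun u v => θ ^ v.length • T (headMul a fun z => g (v ++ z)) u) w)
      + t * tr (rotation (-θ) T (bar g) a w) := by
  rw [form_wordDiff htr]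
  simp only [hK]
  rw [map_bar tr, bar_rotation hθ hT hg a hw]
  simp only [map_sub, map_smul, smul_eq_mul, map_lastSum tr]
  have : headTerm (fun c w' => tr (rotation θ T g (a * c) w')) w =
    tr (headTerm (fun c w' => rotation θ T g (a * c) w') w) := by cases w <;> simp
  rw [this, rotation]
  ring

/-- For the plain sum over rotations the products of `a` with the letter behind it cancel as
well. -/
theorem form_wordDiff_rotation_id (htr : ∀ a b, tr (a * b) = tr (b * a)) {θ : k}
    (hθ : θ * θ = 1) {g K : List A → A} (hg : IsMulti k g)
    (hK : ∀ a w, tr (a * K w) = tr (rotation θ LinearMap.id g a w))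
    (a : A) {w : List A} (hw : (-1 : k) ^ w.length = -θ) :
    tr (a * wordDiff k K w) = tr (rotation (-θ) LinearMap.id (bar g) a w) := by
  rw [form_wordDiff_of_rotation htr (t := 1) hθ (by simp) hg hK a (by simpa using hw)]
  have : headTerm (fun c w' => rotation θ LinearMap.id g (a * c) w') w =
      splitSum (fun u v => θ ^ v.length •
        (LinearMap.id : (List A → A) →ₗ[k] (List A → A)) (headMul a fun z => g (v ++ z)) u) w := by
    rcases w with _ | ⟨c, w⟩
    · simp
    · simp [splitSum_cons, rotation]
  rw [this]
  ring

/-- Under the trace, rotations do not distinguish the two products with a letter. -/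
theorem trace_rotation_conv_letter (htr : ∀ a b, tr (a * b) = tr (b * a)) {σ : k}
    (hσ : σ * σ = 1) (g : List A → A) (a : A) {w : List A} (hw : (-1 : k) ^ w.length = σ) :
    tr (rotation σ LinearMap.id (letter ⌢ g) a w) =
      σ * tr (rotation σ LinearMap.id (g ⌢ letter) a w) := by
  rw [trace_letter_conv_rotation htr σ (by simp)]
  have h : rotation σ LinearMap.id (g ⌢ letter) a w =
      splitSum (fun u v => σ ^ v.length • ((fun z => g (v ++ a :: z)) ⌢ letter) u) w
      + σ ^ w.length • (g w * a) := by
    rw [rotation]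
    simp only [LinearMap.id_apply, conv_letter_append, smul_add, splitSum_add]
    congr 1
    rcases w with _ | ⟨b, w⟩
    · simp
    · rw [splitSum_cons, splitSum_eq_zero fun u v _ => by simp, add_zero, onNil_nil]
  have hσ' : σ * σ ^ w.length = 1 := by
    rcases mul_self_eq_one_iff.1 hσ with rfl | rfl
    · simp
    · rw [hw, hσ]
  rw [h, map_add, map_smul, mul_add, smul_eq_mul, ← mul_assoc, hσ', one_mul, htr (g w)]
  simp only [LinearMap.id_apply]
  ring

end Trace

end Rotation

/-! ### Homotopies for the bracket -/

section Bracket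

variable {k : Type*} [Field k] {A : Type*} [Ring A] [Algebra k A]
variable {M : Type*} [AddCommGroup M] [Module k M]

/-- The rotation operator as a function of words: the first letter is the marked one. -/
def rotationWord (θ : k) (T : (List A → M) →ₗ[k] (List A → M)) (g : List A → M) : List A → M :=
  headTerm (rotation θ T g)

theorem IsMulti.rotationWord {T : (List A → M) →ₗ[k] (List A → M)}
    (hT : ∀ F, IsMulti k F → IsMulti k (T F)) {g : List A → M} (hg : IsMulti k g) (θ : k) :
    IsMulti k (rotationWord θ T g) := by
  have h₁ : ∀ a, IsMulti k (rotation θ T g a) := by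
    intro a
    refine IsMulti.splitSum (H := fun u v => θ ^ v.length • T (fun z => g (v ++ a :: z)) u)
      (fun v => (hT _ ((hg.shift v).cons a)).smul' _)
      fun u => ⟨fun v x y v' => ?_, fun v c x v' => ?_⟩
    · have : (fun z => g (v ++ (x + y) :: v' ++ a :: z)) =
          (fun z => g (v ++ x :: v' ++ a :: z)) + fun z => g (v ++ y :: v' ++ a :: z) := by
        funext z; simpa using hg.add v x y (v' ++ a :: z)
      simp only [this, map_add, Pi.add_apply, smul_add, List.length_append, List.length_cons]
    · have : (fun z => g (v ++ (c • x) :: v' ++ a :: z)) =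
          c • fun z => g (v ++ x :: v' ++ a :: z) := by
        funext z; simpa using hg.smul v c x (v' ++ a :: z)
      simp only [this, map_smul, Pi.smul_apply, List.length_append, List.length_cons, smul_comm c]
  constructor
  · rintro (_ | ⟨a, u⟩) x y w
    · simp only [List.nil_append, HochschildBV.rotationWord, headTerm_cons, rotation,
        ← splitSum_add]
      refine splitSum_congr fun u v _ => ?_
      have : (fun z => g (v ++ (x + y) :: z)) =
          (fun z => g (v ++ x :: z)) + fun z => g (v ++ y :: z) := funext fun z => hg.add v x y z
      rw [this, map_add, Pi.add_apply, smul_add]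
    · exact (h₁ a).add u x y w
  · rintro (_ | ⟨a, u⟩) c x w
    · simp only [List.nil_append, HochschildBV.rotationWord, headTerm_cons, rotation,
        ← splitSum_smul]
      refine splitSum_congr fun u v _ => ?_
      have : (fun z => g (v ++ (c • x) :: z)) = c • fun z => g (v ++ x :: z) :=
        funext fun z => hg.smul v c x z
      rw [this, map_smul, Pi.smul_apply, smul_comm]
    · exact (h₁ a).smul u c x w

/-- A homotopy between the part of the BV operator on a product in which the marked letter lies in
the second factor, and the sum of `f Δ g` and the circle product. The cochain `K` is the sum over
the rotations of `g` with `f` inserted behind the marked letter. -/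
theorem form_wordDiff_of_rotation_insertion {tr : A →ₗ[k] k}
    (htr : ∀ a b, tr (a * b) = tr (b * a)) {τ θ : k} (hτ : τ * τ = 1) (hθ : θ * θ = 1)
    {f g D K : List A → A} (hg : IsMulti k g)
    (hfτ : twist (-1 : k) f = -τ • f) (hgθ : twist (-1 : k) g = -θ • g)
    (hf' : wordDiff k f = 0) (hg' : wordDiff k g = 0)
    (hD : ∀ a w, tr (a * D w) = tr (rotation θ LinearMap.id g a w))
    (hK : ∀ a w, tr (a * K w) = tr (rotation θ (insertion τ f) g a w))
    (a : A) {w : List A} (hw : (-1 : k) ^ w.length = -(τ * θ)) :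
    tr (a * wordDiff k K w) = - τ * tr (a * (f ⌢ D) w) + τ * tr (a * insertion τ f g w)
      + τ * θ * tr (splitSum (fun u v => (-θ) ^ v.length •
          (twist τ (fun z => g (v ++ a :: z)) ⌢ f) u) w) := by
  rw [form_wordDiff_of_rotation htr hθ
    (fun F hF => bar_insertion_of_cocycle hτ hfτ hf' hF) hg hK a hw]
  -- the marked letter multiplied with the inserted value, or with the letter behind it
  have h₁ : splitSum (fun u v => θ ^ v.length • insertion τ f (headMul a fun z => g (v ++ z)) u) w =
      splitSum (fun y z => rotation θ LinearMap.id g (a * f y) z) w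
      + τ • headTerm (fun c w' => rotation θ (insertion τ f) g (a * c) w') w := by
    have e₁ := splitSum_assoc (fun y z v => θ ^ v.length • g (v ++ (a * f y) :: z)) w
    have e₂ : splitSum (fun u v => θ ^ v.length • headTerm (fun c y =>
        insertion τ f (fun z => g (v ++ (a * c) :: z)) y) u) w =
        headTerm (fun c w' => rotation θ (insertion τ f) g (a * c) w') w := by
      rcases w with _ | ⟨c, w⟩
      · simp
      · simp [splitSum_cons, rotation]
    rw [← e₂, ← splitSum_smul (k := k)]
    refine Eq.trans ?_ (congrArg (· + _) e₁)
    rw [← splitSum_add]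
    refine splitSum_congr fun u v _ => ?_
    rw [insertion_headMul, smul_add, ← splitSum_smul (k := k), smul_comm τ]
  have h₂ : tr (splitSum (fun y z => rotation θ LinearMap.id g (a * f y) z) w) =
      tr (a * (f ⌢ D) w) := by
    rw [conv, mul_splitSum, map_splitSum tr, map_splitSum tr]
    refine splitSum_congr fun y z _ => ?_
    rw [← hD, mul_assoc]
  -- the part with the bar differential of `g`, which is known because `g` is a cocycle
  set Z := splitSum (fun u v => (-θ) ^ v.length •
    (insertion τ f (fun z => g (v ++ a :: z)) ⌢ letter) u) w with hZ
  have h₃ : bar g = letter ⌢ g + θ • (g ⌢ letter) := by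
    rw [bar_of_cocycle hg', hgθ, smul_conv, neg_smul, sub_neg_eq_add]
  have h₄ : rotation (-θ) (insertion τ f) (bar g) a w =
      rotation (-θ) (insertion τ f) (letter ⌢ g) a w
      + θ • rotation (-θ) (insertion τ f) (g ⌢ letter) a w := by
    rw [h₃, rotation, rotation, rotation, ← splitSum_smul (k := k), ← splitSum_add]
    refine splitSum_congr fun u v _ => ?_
    have : (fun z => (letter ⌢ g + θ • (g ⌢ letter)) (v ++ a :: z)) =
      (fun z => (letter ⌢ g) (v ++ a :: z)) + θ • fun z => (g ⌢ letter) (v ++ a :: z) := rfl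
    rw [this, map_add, map_smul, Pi.add_apply, Pi.smul_apply, smul_add, smul_comm θ]
  have h₅ : rotation (-θ) (insertion τ f) (g ⌢ letter) a w = Z + splitSum (fun u v =>
      (-θ) ^ v.length • (twist τ (fun z => g (v ++ a :: z)) ⌢ f) u) w := by
    rw [rotation, hZ, ← splitSum_add]
    refine splitSum_congr fun u v _ => ?_
    have : (fun z => (g ⌢ letter) (v ++ a :: z)) = (fun z => g (v ++ a :: z)) ⌢ letter +
        onNil (g v * a) :=
      funext fun z => conv_letter_append g v a z
    rw [this, map_add, Pi.add_apply, insertion_onNil, add_zero,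
      insertion_conv τ f ((hg.shift v).cons a), insertion_letter, Pi.add_apply, smul_add]
  rw [h₁, h₄, h₅, map_add, map_add, trace_letter_conv_rotation htr (-θ) (insertion_mul_left τ f),
    ← hZ, h₂]
  simp only [map_smul, map_add, smul_eq_mul]
  linear_combination (-tr (headTerm (fun c w' => rotation θ (insertion τ f) g (a * c) w') w)) * hτ

/-- The rotations of a product: the marked letter lies in the first or in the second factor. -/
theorem rotation_conv {tr : A →ₗ[k] k} (htr : ∀ a b, tr (a * b) = tr (b * a)) {σ c : k}
    {f g : List A → A} (hf : twist σ f = c • f) (a : A) (w : List A) :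
    tr (rotation σ LinearMap.id (f ⌢ g) a w) =
      tr (splitSum (fun u v => σ ^ v.length • ((fun z => f (v ++ a :: z)) ⌢ g) u) w)
      + c * tr (splitSum (fun u v => σ ^ v.length • ((fun z => g (v ++ a :: z)) ⌢ f) u) w) := by
  have h₁ : rotation σ LinearMap.id (f ⌢ g) a w =
      splitSum (fun u v => σ ^ v.length • ((fun z => f (v ++ a :: z)) ⌢ g) u) w
      + splitSum (fun u v => splitSum (fun v₁ v₂ => σ ^ v.length •
        (f v₁ * g (v₂ ++ a :: u))) v) w := by
    rw [rotation, ← splitSum_add]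
    refine splitSum_congr fun u v _ => ?_
    rw [LinearMap.id_apply, conv, splitSum_append_cons, add_comm, smul_add,
      splitSum_smul (k := k)]
    rfl
  rw [h₁, map_add]
  congr 1
  have h₂ := splitSum_assoc (fun u v₁ v₂ => c • σ ^ v₂.length • (g (v₂ ++ a :: u) * f v₁)) w
  rw [← smul_eq_mul, ← map_smul, ← splitSum_smul (k := k)]
  have h₃ : (fun u v => c • σ ^ v.length • ((fun z => g (v ++ a :: z)) ⌢ f) u) =
      fun u v => splitSum (fun u₁ u₂ => c • σ ^ v.length • (g (v ++ a :: u₁) * f u₂)) u := by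
    funext u v
    rw [splitSum_smul (k := k), splitSum_smul (k := k)]
    rfl
  rw [h₃, h₂, map_splitSum tr, map_splitSum tr]
  refine splitSum_congr fun u v _ => ?_
  rw [map_splitSum tr, map_splitSum tr]
  refine splitSum_congr fun v₁ v₂ e => ?_
  have h₄ : σ ^ v₁.length • f v₁ = c • f v₁ := congrFun hf v₁
  rw [← e, List.length_append, pow_add, mul_comm, mul_smul, ← smul_mul_assoc (σ ^ v₁.length), h₄,
    smul_mul_assoc, map_smul, map_smul, htr, map_smul, map_smul, smul_comm]

end Bracket

/-! ### Multilinear maps as functions of words -/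

section Extension

variable {k : Type*} [Field k] {A : Type*} [Ring A] [Algebra k A]
variable {M : Type*} [AddCommGroup M] [Module k M]

/-- A multilinear map as a function of words, zero on the words of any other length. -/
def toWord {n : ℕ} (f : MultilinearMap k (fun _ : Fin n => A) M) (w : List A) : M :=
  if h : w.length = n then f (fun i => w.get (i.cast h.symm)) else 0

theorem toWord_of_ne {n : ℕ} (f : MultilinearMap k (fun _ : Fin n => A) M) {w : List A}
    (h : w.length ≠ n) : toWord f w = 0 := dif_neg h

theorem toWord_of_eq {n : ℕ} (f : MultilinearMap k (fun _ : Fin n => A) M) {w : List A}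
    (h : w.length = n) : toWord f w = f (fun i => w.get (i.cast h.symm)) := dif_pos h

theorem toWord_ofFn {n : ℕ} (f : MultilinearMap k (fun _ : Fin n => A) M) (a : Fin n → A) :
    toWord f (List.ofFn a) = f a := by
  rw [toWord_of_eq f (List.length_ofFn)]
  congr 1
  funext i
  simp

theorem eq_of_toWord {n : ℕ} {f g : MultilinearMap k (fun _ : Fin n => A) M}
    (h : ∀ w : List A, w.length = n → toWord f w = toWord g w) : f = g := by
  ext a
  rw [← toWord_ofFn, ← toWord_ofFn, h _ List.length_ofFn]

theorem toWord_add {n : ℕ} (f g : MultilinearMap k (fun _ : Fin n => A) M) :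
    toWord (f + g) = toWord f + toWord g := by
  funext w
  by_cases h : w.length = n
  · simp [toWord_of_eq _ h]
  · simp [toWord_of_ne _ h]

theorem toWord_smul {n : ℕ} (c : k) (f : MultilinearMap k (fun _ : Fin n => A) M) :
    toWord (c • f) = c • toWord f := by
  funext w
  by_cases h : w.length = n
  · simp [toWord_of_eq _ h]
  · simp [toWord_of_ne _ h]

/-- `toWord` as a linear map. -/
def toWordₗ (k A M : Type*) [Field k] [Ring A] [Algebra k A] [AddCommGroup M] [Module k M]
    (n : ℕ) : MultilinearMap k (fun _ : Fin n => A) M →ₗ[k] (List A → M) where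
  toFun := toWord
  map_add' := toWord_add
  map_smul' := toWord_smul

theorem twist_toWord {n : ℕ} (θ : k) (f : MultilinearMap k (fun _ : Fin n => A) M) :
    twist θ (toWord f) = θ ^ n • toWord f := by
  funext w
  by_cases h : w.length = n
  · simp [twist, h]
  · simp [twist, toWord_of_ne _ h]

theorem ofFn_update {n : ℕ} (a : Fin n → A) (i : Fin n) (x : A) :
    List.ofFn (Function.update a i x) =
      (List.ofFn a).take i ++ x :: (List.ofFn a).drop (i + 1) := by
  have : List.ofFn (Function.update a i x) = (List.ofFn a).set i x := by
    refine List.ext_getElem (by simp) fun j h₁ h₂ => ?_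
    simp [List.getElem_set, Function.update_apply, Fin.ext_iff, eq_comm]
  rw [this, List.set_eq_take_append_cons_drop, if_pos (by simp)]

/-- The multilinear map of `n` arguments given by a multilinear function of words. -/
def ofWord {F : List A → M} (hF : IsMulti k F) (n : ℕ) :
    MultilinearMap k (fun _ : Fin n => A) M :=
  MultilinearMap.mk' (fun a => F (List.ofFn a))
    (by intro a i x y; simp only [ofFn_update, hF.add])
    (by intro a i c x; simp only [ofFn_update, hF.smul])

theorem toWord_ofWord {F : List A → M} (hF : IsMulti k F) {n : ℕ} {w : List A}
    (h : w.length = n) : toWord (ofWord hF n) w = F w := by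
  subst h
  rw [toWord_of_eq _ rfl]
  exact congrArg F (List.ofFn_get w)

theorem isMulti_toWord {n : ℕ} (f : MultilinearMap k (fun _ : Fin n => A) M) :
    IsMulti k (toWord f) := by
  have key : ∀ (u v : List A) (x : A) (h : (u ++ x :: v).length = n),
      toWord f (u ++ x :: v) = f (Function.update (fun i => (u ++ 0 :: v).get
        (i.cast (by simpa using h.symm))) ⟨u.length, by simp at h; omega⟩ x) := by
    intro u v x h
    rw [toWord_of_eq f h]
    congr 1
    funext i
    simp only [Function.update_apply, Fin.ext_iff, List.get_eq_getElem, Fin.val_cast]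
    split_ifs with e
    · simp [e]
    · rcases lt_or_gt_of_ne e with e | e
      · simp [List.getElem_append_left, e]
      · rw [List.getElem_append_right (by omega), List.getElem_append_right (by omega)]
        obtain ⟨j, hj⟩ : ∃ j, (i : ℕ) - u.length = j + 1 := ⟨i - u.length - 1, by omega⟩
        simp [hj]
  constructor
  · intro u x y v
    by_cases h : (u ++ x :: v).length = n
    · have h' : ∀ z, (u ++ z :: v).length = n := fun z => by simpa using h
      simp only [key _ _ _ (h' _), MultilinearMap.map_update_add]
    · have h' : ∀ z, (u ++ z :: v).length ≠ n := fun z => by simpa using h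
      simp only [toWord_of_ne _ (h' _), add_zero]
  · intro u c x v
    by_cases h : (u ++ x :: v).length = n
    · have h' : ∀ z, (u ++ z :: v).length = n := fun z => by simpa using h
      simp only [key _ _ _ (h' _), MultilinearMap.map_update_smul]
    · have h' : ∀ z, (u ++ z :: v).length ≠ n := fun z => by simpa using h
      simp only [toWord_of_ne _ (h' _), smul_zero]

/-- A sum over splittings with only one non-zero term. -/
theorem splitSum_eq_single {H : List A → List A → M} {w : List A} {m : ℕ} (hm : m ≤ w.length)
    (h : ∀ u v, u.length ≠ m → H u v = 0) : splitSum H w = H (w.take m) (w.drop m) := by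
  refine Finset.sum_eq_single m (fun i hi hne => h _ _ ?_) fun hi => ?_
  · simp only [Finset.mem_range] at hi
    rw [List.length_take]; omega
  · simp only [Finset.mem_range] at hi
    omega

theorem toWord_cup {m n p : ℕ} (h : m + n = p) (f : Cochain k A m) (g : Cochain k A n) :
    toWord (cup h f g) = toWord f ⌢ toWord g := by
  funext w
  by_cases hw : w.length = p
  · rw [toWord_of_eq _ hw, conv, splitSum_eq_single (m := m) (by omega)
      fun u v e => by rw [toWord_of_ne f e, zero_mul],
      toWord_of_eq f (by rw [List.length_take]; omega),
      toWord_of_eq g (by rw [List.length_drop]; omega)]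
    simp [cup, cupFun]
  · rw [toWord_of_ne _ hw]
    refine (splitSum_eq_zero fun u v e => ?_).symm
    by_cases hu : u.length = m
    · rw [toWord_of_ne g, mul_zero]
      intro hv
      rw [← e, List.length_append] at hw
      omega
    · rw [toWord_of_ne f hu, zero_mul]

theorem toWord_circ {m n p : ℕ} (h : m + n = p + 1) (f : Cochain k A m) (g : Cochain k A n) :
    toWord (circ h f g) = insertion ((-1 : k) ^ (n + 1)) (toWord g) (toWord f) := by
  have hf := isMulti_toWord f
  funext w
  rw [insertion, sweep_apply]
  by_cases hw : w.length = p
  · have h₁ : ∀ u v : List A, u ++ v = w →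
        headThen (toWord g) (LinearMap.id (R := k)) (fun z => toWord f (u ++ z)) v =
        if hu : u.length < m then insertAt h f g ⟨u.length, hu⟩
          (fun i => w.get (i.cast hw.symm)) else 0 := by
      rintro u v rfl
      rw [List.length_append] at hw
      rw [headThen_apply]
      split_ifs with hu
      · rw [splitSum_eq_single (m := n) (by omega) fun y z hy => by
          rw [toWord_of_ne g hy]; exact hf.zero u z, LinearMap.id_apply,
          toWord_of_eq f (by simp; omega), toWord_of_eq g (by simp; omega)]
        simp only [insertAt, MultilinearMap.mk'_apply]
        congr 1
        funext j
        simp only [insertArgs, List.get_eq_getElem, Fin.val_cast]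
        split_ifs with e₁ e₂
        · rw [List.getElem_append_left e₁, List.getElem_append_left e₁]
        · simp [e₂, List.getElem_append_right]
        · rw [List.getElem_append_right (by omega), List.getElem_append_right (by omega)]
          obtain ⟨i, hi⟩ : ∃ i, (j : ℕ) - u.length = i + 1 := ⟨j - u.length - 1, by omega⟩
          simp only [hi, List.getElem_cons_succ, List.getElem_drop]
          congr 1
          omega
      · refine splitSum_eq_zero fun y z e => ?_
        by_cases hy : y.length = n
        · exact toWord_of_ne f (by
            rw [← e, List.length_append] at hw
            simp; omega)
        · rw [toWord_of_ne g hy]; exact hf.zero u z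
    rw [splitSum_congr fun u v e => by rw [h₁ u v e], toWord_of_eq _ hw]
    simp only [circ, sum_apply, smul_apply]
    set G : ℕ → A := fun i => if hi : i < m then (-1 : k) ^ (i * (n + 1)) • insertAt h f g ⟨i, hi⟩
      (fun i => w.get (i.cast hw.symm)) else 0 with hG
    have h₂ : ∑ i ∈ Finset.range m, G i = ∑ i ∈ Finset.range (w.length + 1), G i := by
      refine Finset.sum_subset (Finset.range_mono (by omega)) fun i _ hi => ?_
      exact dif_neg (by simpa using hi)
    rw [splitSum]
    refine Eq.trans ?_ (h₂.trans (Finset.sum_congr rfl fun i hi => ?_))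
    · rw [Finset.sum_range]
      exact Finset.sum_congr rfl fun i _ => by simp [hG]
    · have hi' : (w.take i).length = i := by
        simp only [Finset.mem_range] at hi
        rw [List.length_take]; omega
      simp only [hG, hi', ← pow_mul, mul_comm i]
      split_ifs <;> simp
  · rw [toWord_of_ne _ hw]
    refine (splitSum_eq_zero fun u v e => ?_).symm
    rw [headThen_apply, splitSum_eq_zero fun y z e' => ?_, smul_zero]
    by_cases hy : y.length = n
    · exact toWord_of_ne f (by
        rw [← e, ← e', List.length_append, List.length_append] at hw
        simp; omega)
    · rw [toWord_of_ne g hy]; exact hf.zero u z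

theorem toWord_idCochain : toWord (idCochain : Cochain k A 1) = letter := by
  funext w
  rcases w with _ | ⟨x, _ | ⟨y, w⟩⟩
  · exact toWord_of_ne _ (by simp)
  · rw [toWord_of_eq _ (by simp)]; simp [idCochain]
  · exact toWord_of_ne _ (by simp)

theorem insertion_toWord_mulCochain {F : List A → M} (hF : IsMulti k F) :
    insertion (-1 : k) (toWord (mulCochain : Cochain k A 2)) F = bar F := by
  funext w
  induction w generalizing F with
  | nil => rw [insertion, sweep_nil, headThen_apply, splitSum_nil, bar_nil,
      toWord_of_ne _ (by simp)]; exact hF.head_zero _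
  | cons a w ih =>
    have h : headThen (toWord (mulCochain : Cochain k A 2)) (LinearMap.id (R := k)) F (a :: w) =
        headMul a F w := by
      rw [headThen_apply]
      rcases w with _ | ⟨c, w⟩
      · refine splitSum_eq_zero fun u v e => ?_
        rw [toWord_of_ne _ fun hu => ?_]
        · exact hF.head_zero _
        · have := congrArg List.length e
          rw [List.length_append] at this
          simp at this
          omega
      · rw [splitSum_eq_single (m := 2) (by simp) fun u v hu => by
          rw [toWord_of_ne _ hu]; exact hF.head_zero _]
        simp [toWord, mulCochain]
    have hs := ih (hF.cons a)
    rw [insertion] at hs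
    rw [insertion, sweep_cons, h, hs, bar_cons, neg_smul, one_smul, sub_eq_add_neg]

/-- The middle terms of the Hochschild differential are the circle product with the multiplication
of `A`, whose coderivation is the bar differential. -/
theorem toWord_differential {n : ℕ} (f : Cochain k A n) :
    toWord (differential n f) = wordDiff k (toWord f) := by
  have h : differential n f = cup (by omega : 1 + n = n + 1) (idCochain : Cochain k A 1) f
      - circ (by omega : n + 2 = n + 1 + 1) f (mulCochain : Cochain k A 2)
      + (-1 : k) ^ (n + 1) • cup (by omega) f (idCochain : Cochain k A 1) := by
    have : circ (by omega : n + 2 = n + 1 + 1) f (mulCochain : Cochain k A 2) =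
        -∑ i : Fin n, (-1 : k) ^ ((i : ℕ) + 1) •
          insertAt (by omega : n + 2 = n + 1 + 1) f (mulCochain : Cochain k A 2) i := by
      rw [circ, ← Finset.sum_neg_distrib]
      refine Finset.sum_congr rfl fun i _ => ?_
      have hi : (-1 : k) ^ ((i : ℕ) * (2 + 1)) = -(-1) ^ ((i : ℕ) + 1) := by
        rw [pow_mul', pow_succ (-1 : k) i]
        norm_num
      rw [hi]
      exact neg_smul ((-1 : k) ^ ((i : ℕ) + 1))
        (insertAt (by omega : n + 2 = n + 1 + 1) f (mulCochain : Cochain k A 2) i)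
    rw [this, sub_neg_eq_add]
    rfl
  have h₂ : toWord (differential n f) =
      toWord (cup (by omega : 1 + n = n + 1) (idCochain : Cochain k A 1) f)
      - toWord (circ (by omega : n + 2 = n + 1 + 1) f (mulCochain : Cochain k A 2))
      + (-1 : k) ^ (n + 1) • toWord (cup (by omega : n + 1 = n + 1) f
        (idCochain : Cochain k A 1)) := by
    rw [h]
    generalize cup (by omega : 1 + n = n + 1) (idCochain : Cochain k A 1) f = X
    generalize circ (by omega : n + 2 = n + 1 + 1) f (mulCochain : Cochain k A 2) = Y
    generalize cup (by omega : n + 1 = n + 1) f (idCochain : Cochain k A 1) = Z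
    exact (map_add (toWordₗ k A A (n + 1)) _ _).trans (congrArg₂ (· + ·)
      (map_sub (toWordₗ k A A (n + 1)) X Y) (map_smul (toWordₗ k A A (n + 1)) _ Z))
  rw [h₂, toWord_cup, toWord_cup, toWord_circ, toWord_idCochain, wordDiff, twist_toWord,
    show ((-1 : k) ^ (2 + 1)) = -1 by norm_num, insertion_toWord_mulCochain (isMulti_toWord f),
    smul_conv, pow_succ]
  simp only [mul_neg, mul_one, neg_smul]
  abel

theorem toWord_unitCochain : toWord (unitCochain : Cochain k A 0) = onNil 1 := by
  funext w
  rcases w with _ | ⟨x, w⟩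
  · rw [toWord_of_eq _ (by simp)]; simp [unitCochain]
  · exact toWord_of_ne _ (by simp)

theorem onNil_conv (F : List A → A) : onNil 1 ⌢ F = F := by
  funext w
  rcases w with _ | ⟨x, w⟩
  · simp
  · rw [conv_cons, onNil_nil, one_mul, conv, splitSum_eq_zero fun u v _ => by simp, add_zero]

theorem conv_onNil (F : List A → A) : F ⌢ onNil 1 = F := by
  funext w
  induction w generalizing F with
  | nil => simp
  | cons x w ih => rw [conv_cons, onNil_cons, mul_zero, zero_add, ih]

end Extension

/-! ### Identities up to coboundaries -/

section Coboundaries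

variable {k : Type*} [Field k] {A : Type*} [Ring A] [Algebra k A]
variable {M : Type*} [AddCommGroup M] [Module k M]

theorem wordDiff_add (F G : List A → A) :
    wordDiff k (F + G) = wordDiff k F + wordDiff k G := by
  have : bar (F + G) = bar F + bar G := funext (bar_add F G)
  simp only [wordDiff, this, twist_add, add_conv, conv_add]
  abel

theorem wordDiff_smul (c : k) (F : List A → A) : wordDiff k (c • F) = c • wordDiff k F := by
  have : bar (c • F) = c • bar F := funext (bar_smul c F)
  simp only [wordDiff, this, twist_smul, smul_conv, conv_smul, smul_sub]

variable (k) in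
/-- The Hochschild differential of functions of words, as a linear map. -/
def wordDiffₗ : (List A → A) →ₗ[k] (List A → A) where
  toFun := wordDiff k
  map_add' := wordDiff_add
  map_smul' := wordDiff_smul

variable (k A) in
/-- The multilinear functions of words. -/
def multiWords : Submodule k (List A → A) where
  carrier := {F | IsMulti k F}
  add_mem' := IsMulti.add'
  zero_mem' := IsMulti.zero'
  smul_mem' c _ h := h.smul' c

variable (k A) in
/-- The coboundaries among the functions of words. -/
def wordCoboundaries : Submodule k (List A → A) :=
  (multiWords k A).map (wordDiffₗ k)

theorem wordDiff_mem {F : List A → A} (hF : IsMulti k F) :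
    wordDiff k F ∈ wordCoboundaries k A :=
  Submodule.mem_map_of_mem (f := wordDiffₗ k) (p := multiWords k A) hF

theorem mem_wordCoboundaries {F : List A → A} :
    F ∈ wordCoboundaries k A ↔ ∃ H, IsMulti k H ∧ wordDiff k H = F := Iff.rfl

/-- The functions of words that vanish on words of length other than `n`. -/
def SupportedOn (n : ℕ) (F : List A → M) : Prop := ∀ w : List A, w.length ≠ n → F w = 0

theorem supportedOn_toWord {n : ℕ} (f : MultilinearMap k (fun _ : Fin n => A) M) :
    SupportedOn n (toWord f) := fun _ h => toWord_of_ne f h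

theorem toWord_ofWord_of_supportedOn {n : ℕ} {F : List A → M} (hF : IsMulti k F)
    (h : SupportedOn n F) : toWord (ofWord hF n) = F := by
  funext w
  by_cases hw : w.length = n
  · exact toWord_ofWord hF hw
  · rw [toWord_of_ne _ hw, h w hw]

namespace SupportedOn

variable {n : ℕ}

theorem sub {F G : List A → M} (hF : SupportedOn n F) (hG : SupportedOn n G) :
    SupportedOn n (F - G) := fun w h => by simp [hF w h, hG w h]

theorem twist {F : List A → M} (hF : SupportedOn n F) (θ : k) :
    HochschildBV.twist θ F = θ ^ n • F := by
  funext w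
  by_cases h : w.length = n
  · simp [HochschildBV.twist, h]
  · simp [HochschildBV.twist, hF w h]

theorem wordDiff {F : List A → A} (hF : SupportedOn n F) (h : IsMulti k F) :
    SupportedOn (n + 1) (wordDiff k F) := by
  rw [← toWord_ofWord_of_supportedOn h hF, ← toWord_differential]
  exact supportedOn_toWord _

end SupportedOn

/-- The Hochschild differential at words of length `n + 1` depends on words of length `n` only. -/
theorem wordDiff_toWord_ofWord {F : List A → A} (hF : IsMulti k F) {n : ℕ} {w : List A}
    (hw : w.length = n + 1) : wordDiff k (toWord (ofWord hF n)) w = wordDiff k F w := by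
  have h₁ : ∀ (m : ℕ) (F G : List A → A), (∀ w : List A, w.length = m → F w = G w) →
      ∀ w : List A, w.length = m + 1 → bar F w = bar G w := by
    intro m F G h w hw
    induction w generalizing m F G with
    | nil => simp
    | cons a w ih =>
      rw [bar_cons, bar_cons]
      rcases w with _ | ⟨c, w⟩
      · simp
      · simp only [List.length_cons, Nat.add_right_cancel_iff] at hw
        subst hw
        rw [headMul_cons, headMul_cons, h _ (by simp),
          ih w.length _ _ (fun z hz => h _ (by simp [hz])) (by simp)]
  have h₂ : ∀ w : List A, w.length = n → toWord (ofWord hF n) w = F w :=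
    fun w h => toWord_ofWord hF h
  simp only [wordDiff, Pi.sub_apply]
  congr 1
  · congr 1
    · rw [letter_conv, letter_conv]
      rcases w with _ | ⟨a, w⟩
      · simp
      · rw [headTerm_cons, headTerm_cons, h₂ w (by simpa using hw)]
    · rw [conv_letter, conv_letter]
      refine lastSum_congr fun u x e => ?_
      rw [twist, twist, h₂ u (by rw [← e] at hw; simpa using hw)]
  · exact h₁ n _ _ h₂ w hw

/-- A cochain that is a coboundary as a function of words of its degree is a coboundary. -/
theorem mem_coboundaries_of_eqOn {n : ℕ} {f : Cochain k A n} {H : List A → A}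
    (hH : IsMulti k H) (h : ∀ w : List A, w.length = n → toWord f w = wordDiff k H w) :
    f ∈ coboundaries k A n := by
  rcases n with _ | n
  · refine (Submodule.mem_bot k).2 (eq_of_toWord fun w hw => ?_)
    rw [h w hw, List.length_eq_zero_iff.1 hw, show toWord (0 : Cochain k A 0) [] = 0 from
      congrFun (map_zero (toWordₗ k A A 0)) []]
    simp [wordDiff]
  · refine ⟨ofWord hH n, eq_of_toWord fun w hw => ?_⟩
    rw [toWord_differential, wordDiff_toWord_ofWord hH hw, h w hw]

theorem toWord_mem_of_mem_coboundaries {n : ℕ} {f : Cochain k A n}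
    (hf : f ∈ coboundaries k A n) : toWord f ∈ wordCoboundaries k A := by
  rcases n with _ | n
  · rw [(Submodule.mem_bot k).1 hf, show toWord (0 : Cochain k A 0) = 0 from
      map_zero (toWordₗ k A A 0)]
    exact zero_mem _
  · obtain ⟨g, rfl⟩ := hf
    rw [toWord_differential]
    exact wordDiff_mem (isMulti_toWord g)

theorem mem_wordCoboundaries_of_eqOn {n : ℕ} {F H : List A → A} (hF : IsMulti k F)
    (hs : SupportedOn n F) (hH : IsMulti k H)
    (h : ∀ w : List A, w.length = n → F w = wordDiff k H w) : F ∈ wordCoboundaries k A := by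
  rw [← toWord_ofWord_of_supportedOn hF hs]
  exact toWord_mem_of_mem_coboundaries (mem_coboundaries_of_eqOn hH fun w hw => by
    rw [toWord_ofWord_of_supportedOn hF hs, h w hw])

theorem mem_cocycles_iff {n : ℕ} {f : Cochain k A n} :
    f ∈ cocycles k A n ↔ wordDiff k (toWord f) = 0 := by
  rw [← toWord_differential, cocycles, LinearMap.mem_ker]
  refine ⟨fun h => ?_, fun h => eq_of_toWord fun w _ => ?_⟩
  · rw [h]; exact map_zero (toWordₗ k A A _)
  · rw [h]; exact (congrFun (map_zero (toWordₗ k A A (n + 1))) w).symm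

theorem IsMulti.conv {F G : List A → A} (hF : IsMulti k F) (hG : IsMulti k G) :
    IsMulti k (F ⌢ G) :=
  IsMulti.splitSum (fun v => hF.map (LinearMap.mulRight k (G v)))
    fun u => hG.map (LinearMap.mulLeft k (F u))

theorem neg_one_pow_mul_self (n : ℕ) : (-1 : k) ^ n * (-1) ^ n = 1 := by
  rw [← mul_pow]; simp

theorem insertion_toWord_of_zero (θ : k) (g : List A → A)
    (f : MultilinearMap k (fun _ : Fin 0 => A) M) : insertion θ g (toWord f) = 0 := by
  funext w
  rw [insertion, sweep_apply]
  refine splitSum_eq_zero fun u v _ => ?_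
  rw [headThen_apply, splitSum_eq_zero fun y z _ => ?_, smul_zero]
  exact toWord_of_ne f (by simp)

theorem twist_insertion_toWord {σ : k} (hσ : σ * σ = 1) {m n : ℕ} (f : Cochain k A m)
    (g : Cochain k A n) : twist σ (insertion ((-1 : k) ^ (n + 1)) (toWord g) (toWord f)) =
      σ ^ (m + n + 1) • insertion ((-1 : k) ^ (n + 1)) (toWord g) (toWord f) := by
  rcases Nat.eq_zero_or_eq_succ_pred (m + n) with h | h
  · obtain rfl : m = 0 := by omega
    rw [insertion_toWord_of_zero, smul_zero]
    funext w
    simp [twist]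
  · generalize (m + n).pred = p at h
    rw [← toWord_circ h f g, twist_toWord, show m + n + 1 = p + 2 by omega, pow_add, pow_two, hσ,
      mul_one]

variable (k) in
/-- The Gerstenhaber bracket of functions of words, regarded as cochains of degrees `m` and `n`.
It is also defined, and zero, where both degrees are `0`. -/
def wordBracket (m n : ℕ) (f g : List A → A) : List A → A :=
  insertion ((-1 : k) ^ (n + 1)) g f - (-1 : k) ^ ((m + 1) * (n + 1)) •
    insertion ((-1 : k) ^ (m + 1)) f g

theorem toWord_gerstenhaberBracket {m n p : ℕ} (h : m + n = p + 1) (f : Cochain k A m)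
    (g : Cochain k A n) :
    toWord (gerstenhaberBracket h f g) = wordBracket k m n (toWord f) (toWord g) := by
  rw [wordBracket, ← toWord_circ h, ← toWord_circ (by omega : n + m = p + 1), gerstenhaberBracket]
  exact (map_sub (toWordₗ k A A p) _ _).trans (congrArg _ (map_smul (toWordₗ k A A p) _ _))

theorem twist_toWord_neg_one {n : ℕ} (f : Cochain k A n) :
    twist (-1 : k) (toWord f) = -(-1 : k) ^ (n + 1) • toWord f := by
  rw [twist_toWord, pow_succ]; simp

/-- The cup product of cocycles is graded commutative up to a coboundary. -/
theorem conv_comm_mem {m n : ℕ} {f : List A → A} {g : List A → A} (hf : IsMulti k f)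
    (hfs : SupportedOn m f) (hg : IsMulti k g) (hgs : SupportedOn n g)
    (hf' : wordDiff k f = 0) (hg' : wordDiff k g = 0) :
    f ⌢ g - (-1 : k) ^ (m * n) • (g ⌢ f) ∈ wordCoboundaries k A := by
  have h := wordDiff_mem (hg.insertion hf ((-1 : k) ^ (m + 1)))
  rw [wordDiff_insertion (neg_one_pow_mul_self _) (by rw [hfs.twist, pow_succ]; simp) hg' hf' hg,
    hgs.twist, twist_smul, hgs.twist, smul_smul] at h
  have := Submodule.smul_mem _ (-(-1 : k) ^ (m + 1)) h
  convert this using 1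
  have e : (-1 : k) ^ n * ((-1 : k) ^ (m + 1)) ^ n = (-1 : k) ^ (m * n) := by
    rw [← mul_pow, pow_succ, mul_neg_one, neg_mul_neg, one_mul, ← pow_mul]
  rw [smul_smul, e, neg_mul, neg_one_pow_mul_self, neg_smul, one_smul, neg_sub, smul_conv]

/-- The Gerstenhaber bracket with a cocycle is a derivation of the cup product up to a
coboundary. -/
theorem bracket_conv_mem {l m n : ℕ} {h : Cochain k A l} {f : Cochain k A m} {g : Cochain k A n}
    (hh : wordDiff k (toWord h) = 0) (hf : wordDiff k (toWord f) = 0)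
    (hg : wordDiff k (toWord g) = 0) :
    wordBracket k l (m + n) (toWord h) (toWord f ⌢ toWord g)
      - (toWord f ⌢ wordBracket k l n (toWord h) (toWord g)
        + (-1 : k) ^ ((l + 1) * n) • (wordBracket k l m (toWord h) (toWord f) ⌢ toWord g))
      ∈ wordCoboundaries k A := by
  have key := wordDiff_mem ((isMulti_toWord h).insertion₂ (isMulti_toWord f) (isMulti_toWord g)
    ((-1 : k) ^ (m + 1)) ((-1 : k) ^ (n + 1)))
  rw [wordDiff_insertion₂ (c := ((-1 : k) ^ (n + 1)) ^ m) (neg_one_pow_mul_self _)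
    (neg_one_pow_mul_self _) (by rw [← pow_mul]; exact neg_one_pow_mul_self _)
    (twist_toWord_neg_one f) (twist_toWord_neg_one g) (twist_toWord _ f) hf hg hh
    (isMulti_toWord h), twist_toWord, map_smul, twist_smul,
    twist_insertion_toWord (neg_one_pow_mul_self _), smul_conv, smul_conv] at key
  have hX : -((-1 : k) ^ (m + 1) * (-1) ^ (n + 1)) = (-1) ^ (m + n + 1) := by ring
  rw [hX] at key
  have h₃ : ((-1 : k) ^ (n + 1)) ^ m * ((-1) ^ l * ((-1) ^ (n + 1)) ^ (l + m + 1)) =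
      -(-1) ^ ((l + 1) * n) := by
    rw [← pow_mul, ← pow_mul, ← pow_add, ← pow_add, show (n + 1) * m + (l + (n + 1) * (l + m + 1)) =
      (l + 1) * n + 1 + 2 * ((n + 1) * m + l) by ring, pow_add _ _ (2 * _), pow_mul _ 2, pow_succ]
    simp
  have h₁ : (-1 : k) ^ ((l + 1) * (m + n + 1)) =
      (-1) ^ ((l + 1) * n) * (-1) ^ ((l + 1) * (m + 1)) := by
    rw [← pow_add]; congr 1; ring
  have h₂ : (-1 : k) ^ ((l + 1) * (m + n + 1)) * ((-1) ^ (l + 1)) ^ m =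
      (-1) ^ ((l + 1) * (n + 1)) := by
    rw [show (l + 1) * (m + n + 1) = (l + 1) * (n + 1) + (l + 1) * m by ring, pow_add, mul_assoc,
      ← pow_mul, neg_one_pow_mul_self, mul_one]
  rw [wordBracket, wordBracket, wordBracket, insertion_conv _ _ (isMulti_toWord f), twist_toWord,
    smul_conv]
  have := Submodule.smul_mem _ ((-1 : k) ^ (m + 1) * (-1) ^ (n + 1)) key
  rw [smul_smul, show (-1 : k) ^ (m + 1) * (-1) ^ (n + 1) * ((-1) ^ (m + 1) * (-1) ^ (n + 1)) = 1
    by rw [← pow_add]; exact neg_one_pow_mul_self _, one_smul, smul_smul, smul_smul,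
    mul_assoc _ ((-1 : k) ^ l), h₃] at this
  convert this using 1
  rw [conv_sub, sub_conv, conv_smul, smul_conv, smul_add, smul_smul, h₂, h₁]
  module

end Coboundaries

/-! ### Frobenius duality and Connes' operator -/

section Frobenius

variable {k : Type*} [Field k] {A : Type*} [Ring A] [Algebra k A]
variable {η : LinearMap.BilinForm k A}

theorem form_one_mul (hinv : ∀ a b c : A, η (a * b) c = η a (b * c)) (a x : A) :
    η 1 (a * x) = η a x := by
  rw [← hinv, one_mul]

theorem form_one_mul_comm (hsymm : ∀ a b : A, η a b = η b a)
    (hinv : ∀ a b c : A, η (a * b) c = η a (b * c)) (a b : A) :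
    η 1 (a * b) = η 1 (b * a) := by
  rw [form_one_mul hinv, form_one_mul hinv, hsymm]

theorem eq_of_form (hη : η.Nondegenerate) (hsymm : ∀ a b : A, η a b = η b a)
    (hinv : ∀ a b c : A, η (a * b) c = η a (b * c)) {x y : A}
    (h : ∀ a, η 1 (a * x) = η 1 (a * y)) : x = y := by
  refine sub_eq_zero.1 (hη.1 _ fun a => ?_)
  rw [hsymm, map_sub, ← form_one_mul hinv a x, ← form_one_mul hinv a y, h, sub_self]

/-- The Hochschild differential anticommutes with the sum over rotations: the two sides belong to
the differential of `K`, the cochain of the rotations of `g`, and to the rotations of the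
differential of `g`. -/
theorem form_wordDiff_of_rotation_wordDiff {tr : A →ₗ[k] k}
    (htr : ∀ a b, tr (a * b) = tr (b * a)) {θ : k} (hθ : θ * θ = 1) {g K : List A → A}
    (hg : IsMulti k g) (hgθ : twist (-1 : k) g = -θ • g)
    (hK : ∀ a w, tr (a * K w) = tr (rotation θ LinearMap.id g a w)) (a : A) {w : List A}
    (hw : (-1 : k) ^ w.length = -θ) :
    tr (a * wordDiff k K w) = -tr (rotation (-θ) LinearMap.id (wordDiff k g) a w) := by
  rw [form_wordDiff_rotation_id htr hθ hg hK a hw]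
  have h₁ : bar g = letter ⌢ g + θ • (g ⌢ letter) - wordDiff k g := by
    rw [wordDiff, hgθ, smul_conv, neg_smul]
    abel
  have h₂ : rotation (-θ) LinearMap.id (bar g) a w =
      rotation (-θ) LinearMap.id (letter ⌢ g) a w
      + θ • rotation (-θ) LinearMap.id (g ⌢ letter) a w
      - rotation (-θ) LinearMap.id (wordDiff k g) a w := by
    rw [h₁, rotation, rotation, rotation, rotation, ← splitSum_smul (k := k), ← splitSum_add,
      ← splitSum_sub]
    refine splitSum_congr fun u v _ => ?_
    simp only [LinearMap.id_apply, Pi.add_apply, Pi.sub_apply, Pi.smul_apply, smul_add, smul_sub]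
    rw [smul_comm θ]
  rw [h₂, map_sub, map_add, map_smul, smul_eq_mul,
    trace_rotation_conv_letter htr (by linear_combination hθ) g a hw]
  ring

variable [FiniteDimensional k A] (η) (hη : η.Nondegenerate)

/-- The function of words with values in `A` that corresponds under `η` to a scalar valued function
of words, whose first letter is the one paired with the value. -/
noncomputable def dualWord {φ : List A → k} (hφ : IsMulti k φ) : List A → A :=
  fun w => (η.toDual hη).symm ((LinearMap.proj w : (List A → k) →ₗ[k] k) ∘ₗ hφ.headLin)

variable {η} {hη}

theorem form_dualWord (hsymm : ∀ a b : A, η a b = η b a)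
    (hinv : ∀ a b c : A, η (a * b) c = η a (b * c)) {φ : List A → k} (hφ : IsMulti k φ) (a : A)
    (w : List A) : η 1 (a * dualWord η hη hφ w) = φ (a :: w) := by
  rw [form_one_mul hinv, hsymm, dualWord, LinearMap.BilinForm.apply_toDual_symm_apply]
  rfl

theorem isMulti_dualWord {φ : List A → k} (hφ : IsMulti k φ) :
    IsMulti k (dualWord η hη hφ) := by
  constructor
  · intro u x y v
    simp only [dualWord]
    rw [← map_add]
    congr 1
    ext a
    exact hφ.add (a :: u) x y v
  · intro u c x v
    simp only [dualWord]
    rw [← map_smul]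
    congr 1
    ext a
    exact hφ.smul (a :: u) c x v

theorem isMulti_form_rotationWord {T : (List A → A) →ₗ[k] (List A → A)}
    (hT : ∀ F, IsMulti k F → IsMulti k (T F)) {g : List A → A} (hg : IsMulti k g) (θ : k) :
    IsMulti k (fun w => η 1 (rotationWord θ T g w)) :=
  (hg.rotationWord hT θ).map (η 1)

variable (η hη) in
/-- The cochain whose form is the sum over the rotations of a cochain `f`. It differs from the
value of the BV operator by the terms in which `f` has the unit as its first argument. -/
noncomputable def rotationCochain {n : ℕ} (f : Cochain k A n) : List A → A :=
  dualWord η hη (isMulti_form_rotationWord (η := η) (T := LinearMap.id (R := k)) (fun _ h => h)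
    (isMulti_toWord f) ((-1 : k) ^ (n + 1)))

theorem form_rotationCochain (hsymm : ∀ a b : A, η a b = η b a)
    (hinv : ∀ a b c : A, η (a * b) c = η a (b * c)) {n : ℕ} (f : Cochain k A n) (a : A)
    (w : List A) : η 1 (a * rotationCochain η hη f w) =
      η 1 (rotation ((-1 : k) ^ (n + 1)) LinearMap.id (toWord f) a w) :=
  form_dualWord hsymm hinv _ a w

theorem isMulti_rotationCochain {n : ℕ} (f : Cochain k A n) :
    IsMulti k (rotationCochain η hη f) :=
  isMulti_dualWord _

theorem rotation_toWord_of_ne {n : ℕ} (f : Cochain k A n) (θ : k) (a : A) {w : List A}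
    (hw : w.length + 1 ≠ n) : rotation θ LinearMap.id (toWord f) a w = 0 := by
  refine splitSum_eq_zero fun u v e => ?_
  rw [LinearMap.id_apply, toWord_of_ne f, smul_zero]
  rw [← e, List.length_append] at hw
  rw [List.length_append, List.length_cons]
  omega

theorem rotationCochain_of_ne (hsymm : ∀ a b : A, η a b = η b a)
    (hinv : ∀ a b c : A, η (a * b) c = η a (b * c)) {n : ℕ} (f : Cochain k A n) {w : List A}
    (hw : w.length + 1 ≠ n) : rotationCochain η hη f w = 0 :=
  eq_of_form hη hsymm hinv fun a => by
    rw [form_rotationCochain hsymm hinv, rotation_toWord_of_ne f _ a hw, mul_zero]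

theorem rotationCochain_of_zero (hsymm : ∀ a b : A, η a b = η b a)
    (hinv : ∀ a b c : A, η (a * b) c = η a (b * c)) (f : Cochain k A 0) :
    rotationCochain η hη f = 0 :=
  funext fun _ => rotationCochain_of_ne hsymm hinv f (Nat.succ_ne_zero _)

theorem supportedOn_rotationCochain (hsymm : ∀ a b : A, η a b = η b a)
    (hinv : ∀ a b c : A, η (a * b) c = η a (b * c)) {n : ℕ} (f : Cochain k A (n + 1)) :
    SupportedOn n (rotationCochain η hη f) :=
  fun _ h => rotationCochain_of_ne hsymm hinv f (by omega)

/-- The sum over rotations anticommutes with the Hochschild differential. -/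
theorem wordDiff_rotationCochain (hsymm : ∀ a b : A, η a b = η b a)
    (hinv : ∀ a b c : A, η (a * b) c = η a (b * c)) {n : ℕ} (f : Cochain k A n) {w : List A}
    (hw : w.length = n) :
    wordDiff k (rotationCochain η hη f) w = -rotationCochain η hη (differential n f) w := by
  refine eq_of_form hη hsymm hinv fun a => ?_
  rw [form_wordDiff_of_rotation_wordDiff (form_one_mul_comm hsymm hinv) (neg_one_pow_mul_self _)
    (isMulti_toWord f) (twist_toWord_neg_one f) (form_rotationCochain hsymm hinv f) a
    (by rw [hw, pow_succ]; simp), mul_neg, map_neg, form_rotationCochain hsymm hinv,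
    toWord_differential, pow_succ _ (n + 1), mul_neg_one]

theorem wordDiff_rotationCochain_of_cocycle (hsymm : ∀ a b : A, η a b = η b a)
    (hinv : ∀ a b c : A, η (a * b) c = η a (b * c)) {n : ℕ} {f : Cochain k A n}
    (hf : f ∈ cocycles k A n) : wordDiff k (rotationCochain η hη f) = 0 := by
  rcases n with _ | n
  · rw [rotationCochain_of_zero hsymm hinv]
    exact map_zero (wordDiffₗ k)
  · funext w
    by_cases hw : w.length = n + 1
    · rw [wordDiff_rotationCochain hsymm hinv f hw]
      refine neg_eq_zero.2 (eq_of_form hη hsymm hinv fun a => ?_)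
      rw [form_rotationCochain hsymm hinv, toWord_differential, mem_cocycles_iff.1 hf]
      simp [rotation]
    · exact (supportedOn_rotationCochain hsymm hinv f).wordDiff (isMulti_rotationCochain f) w hw

theorem rotationCochain_differential_mem (hsymm : ∀ a b : A, η a b = η b a)
    (hinv : ∀ a b c : A, η (a * b) c = η a (b * c)) {n : ℕ} (f : Cochain k A n) :
    rotationCochain η hη (differential n f) ∈ wordCoboundaries k A := by
  refine mem_wordCoboundaries_of_eqOn (isMulti_rotationCochain _)
    (supportedOn_rotationCochain hsymm hinv _)
    ((isMulti_rotationCochain (η := η) (hη := hη) f).smul' (-1)) fun w hw => ?_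
  rw [wordDiff_smul, Pi.smul_apply, wordDiff_rotationCochain hsymm hinv f hw]
  simp

end Frobenius

section Connes

variable {k : Type*} [Field k] {A : Type*} [Ring A] [Algebra k A]

theorem lastSum_append_singleton {M : Type*} [AddCommGroup M] (H : List A → A → M) (l : List A)
    (x : A) : lastSum H (l ++ [x]) = H l x := by
  induction l generalizing H with
  | nil => simp
  | cons a l ih =>
    rcases l with _ | ⟨b, l⟩
    · simp [lastSum_cons_cons]
    · rw [List.cons_append, List.cons_append, lastSum_cons_cons, ← List.cons_append, ih]

theorem toWord_toForm (η : LinearMap.BilinForm k A) {n : ℕ} (f : Cochain k A n) (a : A)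
    (w : List A) : toWord (toForm η f) (a :: w) = η a (toWord f w) := by
  by_cases hw : w.length = n
  · rw [toWord_of_eq _ (by simpa using hw), toWord_of_eq _ hw, toForm_apply]
    rfl
  · rw [toWord_of_ne _ (by simpa using hw), toWord_of_ne _ hw, map_zero]

theorem toWord_dualS {n : ℕ} (φ : Form k A (n + 1)) (w : List A) :
    toWord (dualS φ) w = toWord φ (1 :: w) := by
  by_cases hw : w.length = n + 1
  · rw [toWord_of_eq (dualS φ) hw, toWord_of_eq φ (w := 1 :: w) (by simpa using hw), dualS_apply]
    congr 1
    funext j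
    refine Fin.cases ?_ (fun j => ?_) j <;> rfl
  · rw [toWord_of_ne (dualS φ) hw, toWord_of_ne φ (w := 1 :: w) (by simpa using hw)]

theorem toWord_dualT {n : ℕ} (φ : Form k A n) {l : List A} (hl : l.length = n) (x : A) :
    toWord (dualT φ) (l ++ [x]) = (-1 : k) ^ n • toWord φ (x :: l) := by
  rw [toWord_of_eq _ (by simpa using hl), toWord_of_eq _ (by simpa using hl), dualT_apply]
  congr 2
  funext j
  refine Fin.cases ?_ (fun j => ?_) j
  · simp [← hl]
  · simp [hl]

theorem toWord_dualT_iterate {n : ℕ} (φ : Form k A n) (v p : List A)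
    (h : p.length + v.length = n + 1) :
    toWord (dualT^[v.length] φ) (p ++ v) = ((-1 : k) ^ n) ^ v.length • toWord φ (v ++ p) := by
  induction v using List.reverseRecOn generalizing p with
  | nil => simp
  | append_singleton v x ih =>
    rw [List.length_append, List.length_singleton] at h ⊢
    rw [Function.iterate_succ_apply', ← List.append_assoc,
      toWord_dualT _ (by rw [List.length_append]; omega), ← List.cons_append,
      ih (x :: p) (by rw [List.length_cons]; omega), smul_smul, pow_succ', List.append_assoc]
    rfl

/-- Since `N` rotates the last letters to the front, it gives the sum over rotations. -/
theorem toWord_dualN {n : ℕ} (φ : Form k A n) (a : A) {w : List A} (hw : w.length = n) :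
    toWord (dualN φ) (a :: w) =
      splitSum (fun u v => ((-1 : k) ^ n) ^ v.length • toWord φ (v ++ a :: u)) w := by
  have h : toWord (dualN φ) = ∑ i ∈ Finset.range (n + 1), toWord (dualT^[i] φ) :=
    map_sum (toWordₗ k A k (n + 1)) _ _
  rw [h, Finset.sum_apply, ← Finset.sum_range_reflect, splitSum, hw]
  refine Finset.sum_congr rfl fun i hi => ?_
  have hi' : (w.drop i).length = n + 1 - 1 - i := by rw [List.length_drop]; omega
  rw [Finset.mem_range] at hi
  rw [← toWord_dualT_iterate φ (w.drop i) (a :: w.take i)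
    (by rw [hi', List.length_cons, List.length_take]; omega), hi', List.cons_append,
    List.take_append_drop]

theorem dualT_iterate_eq {n : ℕ} (φ : Form k A n) : dualT^[n + 1] φ = φ := by
  refine eq_of_toWord fun w hw => ?_
  have h := toWord_dualT_iterate φ w [] (by simpa using hw)
  rw [hw, List.nil_append, List.append_nil] at h
  rw [h, ← pow_mul, Even.neg_one_pow (Nat.even_mul_succ_self n), one_smul]

theorem dualT_sum {n : ℕ} {ι : Type*} (s : Finset ι) (φ : ι → Form k A n) :
    dualT (∑ i ∈ s, φ i) = ∑ i ∈ s, dualT (φ i) := by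
  have h := map_sum ((-1 : k) ^ n • (MultilinearMap.domDomCongrLinearEquiv k k A k
    (finRotate (n + 1)).symm : Form k A n →ₗ[k] Form k A n)) φ s
  exact h

theorem dualT_dualN {n : ℕ} (φ : Form k A n) : dualT (dualN φ) = dualN φ := by
  rw [dualN, dualT_sum]
  simp only [← Function.iterate_succ_apply' dualT]
  rw [← sub_eq_zero, ← Finset.sum_sub_distrib, Finset.sum_range_sub (fun i => dualT^[i] φ),
    dualT_iterate_eq, Function.iterate_zero, id_eq, sub_self]

/-- `B ∘ B = 0`: the form `φ ∘ B` is invariant under `t`, so that `1 - t` kills it. -/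
theorem dualConnesB_dualConnesB {n : ℕ} (φ : Form k A (n + 2)) :
    dualConnesB (dualConnesB φ) = 0 := by
  have hT : dualT (0 : Form k A n) = 0 := dualT_sum (∅ : Finset ℕ) fun _ => 0
  rw [dualConnesB, dualConnesB, dualT_dualN, sub_self]
  refine Finset.sum_eq_zero fun i _ => ?_
  exact Function.iterate_fixed hT i

end Connes

/-! ### The BV operator and the bracket formula -/

section BVOperator

variable {k : Type*} [Field k] {A : Type*} [Ring A] [Algebra k A]
variable {η : LinearMap.BilinForm k A}

/-- The form `f̃ ∘ (1 - t) s`: the unit becomes the argument paired with the value of `f`, or the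
first argument of `f`. -/
theorem toWord_dualS_sub_dualT (hinv : ∀ a b c : A, η (a * b) c = η a (b * c))
    (hsymm : ∀ a b : A, η a b = η b a) {n : ℕ} (f : Cochain k A (n + 1)) {w : List A}
    (hw : w.length = n + 1) :
    toWord (dualS (toForm η f - dualT (toForm η f))) w =
      η 1 ((toWord f + (-1 : k) ^ n • ((fun z => toWord f (1 :: z)) ⌢ letter)) w) := by
  have h : toWord (toForm η f - dualT (toForm η f)) =
    toWord (toForm η f) - toWord (dualT (toForm η f)) := map_sub (toWordₗ k A k (n + 2)) _ _
  rw [toWord_dualS, h, Pi.sub_apply, toWord_toForm]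
  rcases List.eq_nil_or_concat' w with rfl | ⟨l, x, rfl⟩
  · simp at hw
  · rw [← List.cons_append, toWord_dualT _ (by simpa using hw), toWord_toForm, Pi.add_apply,
      Pi.smul_apply, conv_letter, lastSum_append_singleton, map_add, map_smul,
      form_one_mul_comm hsymm hinv, form_one_mul hinv, pow_succ]
    simp [sub_eq_add_neg]

variable [FiniteDimensional k A] {hη : η.Nondegenerate}

/-- The BV operator as a sum over rotations. -/
theorem form_bvOperator (hsymm : ∀ a b : A, η a b = η b a)
    (hinv : ∀ a b c : A, η (a * b) c = η a (b * c)) {n : ℕ} (f : Cochain k A (n + 1)) (a : A)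
    {w : List A} (hw : w.length = n) :
    η 1 (a * toWord (bvOperator η hη f) w) = η 1 (rotation ((-1 : k) ^ n) LinearMap.id
      (toWord f + (-1 : k) ^ n • ((fun z => toWord f (1 :: z)) ⌢ letter)) a w) := by
  rw [form_one_mul hinv, ← toWord_toForm, toForm_bvOperator η hη hsymm, dualConnesB,
    toWord_dualN _ a hw, rotation, map_splitSum (η 1)]
  refine splitSum_congr fun u v e => ?_
  rw [toWord_dualS_sub_dualT hinv hsymm, map_smul, LinearMap.id_apply]
  rw [← hw, ← e]
  simp only [List.length_append, List.length_cons]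
  omega

theorem bvOperator_add (hsymm : ∀ a b : A, η a b = η b a)
    (hinv : ∀ a b c : A, η (a * b) c = η a (b * c)) {n : ℕ} (f g : Cochain k A (n + 1)) :
    bvOperator η hη (f + g) = bvOperator η hη f + bvOperator η hη g := by
  refine eq_of_toWord fun w hw => eq_of_form hη hsymm hinv fun a => ?_
  have h : (fun z => toWord (f + g) (1 :: z)) =
      (fun z => toWord f (1 :: z)) + fun z => toWord g (1 :: z) := by
    rw [toWord_add]; rfl
  rw [toWord_add, Pi.add_apply, mul_add, map_add, form_bvOperator hsymm hinv f a hw,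
    form_bvOperator hsymm hinv g a hw, form_bvOperator hsymm hinv _ a hw, h, toWord_add, add_conv,
    ← map_add, rotation, rotation, rotation, ← splitSum_add]
  congr 1
  refine splitSum_congr fun u v _ => ?_
  simp only [LinearMap.id_apply, Pi.add_apply, Pi.smul_apply, smul_add]
  abel

theorem bvOperator_smul (hsymm : ∀ a b : A, η a b = η b a)
    (hinv : ∀ a b c : A, η (a * b) c = η a (b * c)) {n : ℕ} (c : k) (f : Cochain k A (n + 1)) :
    bvOperator η hη (c • f) = c • bvOperator η hη f := by
  refine eq_of_toWord fun w hw => eq_of_form hη hsymm hinv fun a => ?_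
  have h : (fun z => toWord (c • f) (1 :: z)) = c • fun z => toWord f (1 :: z) := by
    rw [toWord_smul]; rfl
  rw [toWord_smul, Pi.smul_apply, mul_smul_comm, map_smul, form_bvOperator hsymm hinv f a hw,
    form_bvOperator hsymm hinv _ a hw, h, toWord_smul, smul_conv,
    ← map_smul, rotation, rotation, ← splitSum_smul (k := k)]
  congr 1
  refine splitSum_congr fun u v _ => ?_
  simp only [LinearMap.id_apply, Pi.add_apply, Pi.smul_apply, smul_add]
  module

theorem twist_toWord_cons {n : ℕ} (f : Cochain k A (n + 1)) (a : A) :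
    twist (-1 : k) (fun z => toWord f (a :: z)) = (-1 : k) ^ n • fun z => toWord f (a :: z) := by
  funext w
  have := congrFun (twist_toWord (-1 : k) f) (a :: w)
  simp only [twist, List.length_cons, Pi.smul_apply, pow_succ, mul_neg_one, neg_smul,
    neg_inj] at this
  exact this

/-- Inserting the unit as the first argument of a cocycle `f` gives a cochain whose differential
is the product of the identity and this cochain. -/
theorem wordDiff_cons_one {n : ℕ} {f : Cochain k A (n + 1)} (hf : f ∈ cocycles k A (n + 1)) :
    wordDiff k (fun z => toWord f (1 :: z)) = letter ⌢ fun z => toWord f (1 :: z) := by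
  set g : List A → A := fun z => toWord f (1 :: z) with hg
  have hgt : twist (-1 : k) g = (-1 : k) ^ n • g := twist_toWord_cons f 1
  have hbar : bar g + (-1 : k) ^ n • (g ⌢ letter) = 0 := by
    funext w
    have h := congrFun (mem_cocycles_iff.1 hf) (1 :: w)
    rw [wordDiff, twist_toWord, Pi.sub_apply, Pi.sub_apply, letter_conv, headTerm_cons, one_mul,
      smul_conv, Pi.smul_apply, conv_cons, toWord_of_ne f (w := []) (by simp), zero_mul, zero_add,
      bar_cons] at h
    have h₁ : headMul 1 (toWord f) w = toWord f w := by
      rcases w with _ | ⟨c, w⟩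
      · exact (toWord_of_ne f (by simp)).symm
      · rw [headMul_cons, one_mul]
    rw [h₁, pow_succ] at h
    simp only [mul_neg_one, neg_smul, sub_neg_eq_add, Pi.zero_apply] at h
    rw [Pi.add_apply, Pi.smul_apply, Pi.zero_apply, ← h]
    simp only [hg]
    abel
  rw [wordDiff, hgt, smul_conv, sub_sub, add_comm _ (bar g), hbar, sub_zero]

/-- On cocycles, the BV operator is the sum over rotations up to a coboundary. By
`wordDiff_cons_one` the difference is the sum over the rotations of the coboundary of `f (1, ·)`. -/
theorem bvOperator_sub_rotationCochain_mem (hsymm : ∀ a b : A, η a b = η b a)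
    (hinv : ∀ a b c : A, η (a * b) c = η a (b * c)) {n : ℕ} {f : Cochain k A (n + 1)}
    (hf : f ∈ cocycles k A (n + 1)) :
    toWord (bvOperator η hη f) - rotationCochain η hη f ∈ wordCoboundaries k A := by
  have htr := form_one_mul_comm hsymm hinv
  set g : List A → A := fun z => toWord f (1 :: z) with hg
  have hgm : IsMulti k g := (isMulti_toWord f).cons 1
  have hgt : twist (-1 : k) g = -(-(-1 : k) ^ n) • g := by rw [neg_neg, hg, twist_toWord_cons]
  have hφ := isMulti_form_rotationWord (η := η) (T := LinearMap.id (R := k)) (fun _ h => h) hgm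
    (-(-1 : k) ^ n)
  have hs := neg_one_pow_mul_self (k := k) n
  refine mem_wordCoboundaries_of_eqOn (n := n)
    ((multiWords k A).sub_mem (isMulti_toWord _) (isMulti_rotationCochain f))
    ((supportedOn_toWord _).sub (supportedOn_rotationCochain hsymm hinv f))
    ((isMulti_dualWord (η := η) (hη := hη) hφ).smul' (-1)) fun w hw => ?_
  rw [wordDiff_smul, Pi.smul_apply, Pi.sub_apply, neg_one_smul]
  refine eq_of_form hη hsymm hinv fun a => ?_
  rw [mul_neg, mul_sub, map_neg, map_sub,
    form_wordDiff_of_rotation_wordDiff htr (θ := -(-1 : k) ^ n) (by linear_combination hs) hgm hgt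
    (fun a w => form_dualWord hsymm hinv hφ a w) a (by rw [hw, neg_neg]), neg_neg, neg_neg,
    wordDiff_cons_one hf, trace_rotation_conv_letter htr hs _ a (by rw [hw]),
    form_bvOperator hsymm hinv f a hw, form_rotationCochain hsymm hinv, pow_succ, pow_succ,
    mul_neg_one, mul_neg_one, neg_neg, ← map_sub, ← smul_eq_mul, ← map_smul, rotation, rotation,
    rotation, ← splitSum_sub, ← splitSum_smul (k := k)]
  congr 1
  refine splitSum_congr fun u v _ => ?_
  simp only [LinearMap.id_apply, Pi.add_apply, Pi.smul_apply, smul_add]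
  rw [add_sub_cancel_left, smul_comm]

end BVOperator

section BracketFormula

variable {k : Type*} [Field k] {A : Type*} [Ring A] [Algebra k A]
variable {η : LinearMap.BilinForm k A} [FiniteDimensional k A] {hη : η.Nondegenerate}

theorem conv_apply_eq_zero {F G : List A → A} {i j m n : ℕ}
    (hF : ∀ u : List A, u.length + i ≠ m → F u = 0) (hG : ∀ v : List A, v.length + j ≠ n → G v = 0)
    {w : List A} (hw : w.length + i + j ≠ m + n) : (F ⌢ G) w = 0 := by
  refine splitSum_eq_zero fun u v e => ?_
  by_cases hu : u.length + i = m
  · rw [hG v, mul_zero]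
    rw [← e, List.length_append] at hw
    omega
  · rw [hF u hu, zero_mul]

/-- The homotopy of `form_wordDiff_of_rotation_insertion` for cocycles `f` and `g` of given degrees,
at words of the degree of their bracket. -/
theorem exists_form_wordDiff (hsymm : ∀ a b : A, η a b = η b a)
    (hinv : ∀ a b c : A, η (a * b) c = η a (b * c)) (hη : η.Nondegenerate) {m n p : ℕ}
    (hp : m + n = p + 1)
    {f : Cochain k A m} {g : Cochain k A n} (hf : f ∈ cocycles k A m) (hg : g ∈ cocycles k A n) :
    ∃ K, IsMulti k K ∧ ∀ (a : A) (w : List A), w.length = p → η 1 (a * wordDiff k K w) =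
      -(-1 : k) ^ (m + 1) * η 1 (a * (toWord f ⌢ rotationCochain η hη g) w)
      + (-1 : k) ^ (m + 1) * η 1 (a * insertion ((-1 : k) ^ (m + 1)) (toWord f) (toWord g) w)
      + (-1 : k) ^ (m * n + 1) * η 1 (splitSum (fun u v => ((-1 : k) ^ (m + n + 1)) ^ v.length •
          ((fun z => toWord g (v ++ a :: z)) ⌢ toWord f) u) w) := by
  have hφ := isMulti_form_rotationWord (η := η) (T := insertion ((-1 : k) ^ (m + 1)) (toWord f))
    (fun F hF => hF.insertion (isMulti_toWord f) _) (isMulti_toWord g) ((-1 : k) ^ (n + 1))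
  refine ⟨dualWord η hη hφ, isMulti_dualWord hφ, fun a w hw => ?_⟩
  have hτ := neg_one_pow_mul_self (k := k) (m + 1)
  have hσ : -(-1 : k) ^ (n + 1) = (-1) ^ n := by rw [pow_succ]; simp
  rw [form_wordDiff_of_rotation_insertion (form_one_mul_comm hsymm hinv)
    hτ (neg_one_pow_mul_self _)
    (isMulti_toWord g) (twist_toWord_neg_one f) (twist_toWord_neg_one g) (mem_cocycles_iff.1 hf)
    (mem_cocycles_iff.1 hg) (form_rotationCochain (hη := hη) hsymm hinv g)
    (form_dualWord hsymm hinv hφ) a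
    (by rw [hw, ← pow_add, show m + 1 + (n + 1) = p + 1 + 2 by omega, pow_add _ (p + 1),
      pow_succ]; simp)]
  congr 1
  rw [← smul_eq_mul, ← smul_eq_mul (_ ^ (m * n + 1)), ← map_smul, ← map_smul,
    ← splitSum_smul (k := k), ← splitSum_smul (k := k)]
  congr 1
  refine splitSum_congr fun u v _ => ?_
  -- `g (v, a, ·)` is nonzero only on words of `n - 1 - |v|` letters
  have ht : twist ((-1 : k) ^ (m + 1)) (fun z => toWord g (v ++ a :: z)) =
      (((-1 : k) ^ (m + 1)) ^ (n + 1) * ((-1) ^ (m + 1)) ^ v.length) •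
        fun z => toWord g (v ++ a :: z) := by
    funext z
    rw [twist, Pi.smul_apply]
    by_cases hz : (v ++ a :: z).length = n
    · rw [List.length_append, List.length_cons] at hz
      rw [← pow_add, show n + 1 + v.length = z.length + 2 * (v.length + 1) by omega,
        pow_add _ z.length, pow_mul _ 2, pow_two, hτ, one_pow, mul_one]
    · rw [toWord_of_ne g hz, smul_zero, smul_zero]
  rw [ht, smul_conv, Pi.smul_apply, smul_smul, smul_smul, smul_smul]
  congr 1
  rw [hσ]
  have e : ((-1 : k) ^ (m + n + 1)) ^ v.length =
      ((-1 : k) ^ n) ^ v.length * ((-1) ^ (m + 1)) ^ v.length := by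
    rw [← mul_pow, ← pow_add]; congr 2; ring
  have e' : (-1 : k) ^ (m * n + 1) =
      (-1) ^ (m + 1) * (-1) ^ (n + 1) * ((-1) ^ (m + 1)) ^ (n + 1) := by
    rw [← pow_mul, ← pow_add, ← pow_add, show m + 1 + (n + 1) + (m + 1) * (n + 1) =
      m * n + 1 + 2 * (m + n + 1) by ring, pow_add _ (m * n + 1), pow_mul _ 2]
    simp
  rw [e, e']
  ring

/-- The sum over rotations of a cocycle commutes with cocycles up to a coboundary. -/
theorem rotationCochain_conv_comm_mem (hsymm : ∀ a b : A, η a b = η b a)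
    (hinv : ∀ a b c : A, η (a * b) c = η a (b * c)) {m n : ℕ} {f : Cochain k A m}
    {g : Cochain k A n} (hf : f ∈ cocycles k A m) (hg : g ∈ cocycles k A n) :
    rotationCochain η hη f ⌢ toWord g
      - (-1 : k) ^ ((m + 1) * n) • (toWord g ⌢ rotationCochain η hη f) ∈ wordCoboundaries k A := by
  rcases m with _ | m
  · rw [rotationCochain_of_zero hsymm hinv, zero_conv, conv_zero, smul_zero, sub_zero]
    exact zero_mem _
  · have e : (-1 : k) ^ ((m + 1 + 1) * n) = (-1) ^ (m * n) := by
      rw [show (m + 1 + 1) * n = m * n + 2 * n by ring, pow_add, pow_mul (-1) 2]; simp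
    rw [e]
    exact conv_comm_mem (isMulti_rotationCochain f) (supportedOn_rotationCochain hsymm hinv f)
      (isMulti_toWord g) (supportedOn_toWord g) (wordDiff_rotationCochain_of_cocycle hsymm hinv hf)
      (mem_cocycles_iff.1 hg)

/-- The Gerstenhaber bracket of two cocycles is, up to a coboundary, the deviation of the sum over
rotations from being a derivation. -/
theorem bracket_add_mem (hsymm : ∀ a b : A, η a b = η b a)
    (hinv : ∀ a b c : A, η (a * b) c = η a (b * c)) {m n : ℕ}
    {f : Cochain k A m} {g : Cochain k A n} (hf : f ∈ cocycles k A m) (hg : g ∈ cocycles k A n) :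
    wordBracket k m n (toWord f) (toWord g) + (-1 : k) ^ ((m + 1) * n) •
      (rotationCochain η hη (cup rfl f g) - rotationCochain η hη f ⌢ toWord g
        - (-1 : k) ^ m • (toWord f ⌢ rotationCochain η hη g)) ∈ wordCoboundaries k A := by
  -- in degrees `0` and `0` there is no bracket, and all terms vanish
  rcases Nat.eq_zero_or_eq_succ_pred (m + n) with hp | hp
  · obtain rfl : m = 0 := by omega
    obtain rfl : n = 0 := by omega
    have h0 : rotationCochain η hη (cup (rfl : 0 + 0 = 0 + 0) f g) = 0 :=
      rotationCochain_of_zero hsymm hinv _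
    rw [wordBracket, insertion_toWord_of_zero, insertion_toWord_of_zero, h0,
      rotationCochain_of_zero hsymm hinv, rotationCochain_of_zero hsymm hinv, zero_conv, conv_zero]
    simp
  generalize (m + n).pred = p at hp
  have hfm := isMulti_toWord f
  have hgm := isMulti_toWord g
  have hfD := isMulti_rotationCochain (η := η) (hη := hη) f
  have hgD := isMulti_rotationCochain (η := η) (hη := hη) g
  have hcD := isMulti_rotationCochain (η := η) (hη := hη) (cup rfl f g)
  -- the products in the other order, as they come from the homotopies
  have h₁ : wordBracket k m n (toWord f) (toWord g) + (-1 : k) ^ ((m + 1) * n) •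
      (rotationCochain η hη (cup rfl f g)
        - (-1 : k) ^ ((m + 1) * n) • (toWord g ⌢ rotationCochain η hη f)
        - (-1 : k) ^ m • (toWord f ⌢ rotationCochain η hη g)) ∈ wordCoboundaries k A := by
    obtain ⟨K, hK, hK'⟩ := exists_form_wordDiff hsymm hinv hη hp hf hg
    -- the coefficients of `K` and `L` are those for which both kinds of rotations of `f ⌢ g` cancel
    obtain ⟨L, hL, hL'⟩ := exists_form_wordDiff hsymm hinv hη (by omega : n + m = p + 1) hg hf
    refine mem_wordCoboundaries_of_eqOn (n := p) (H := (-1 : k) ^ ((m + 1) * n) •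
        ((-1 : k) ^ (m * n + 1) • L + (-1 : k) • K)) ?_ (fun w hw => ?_)
      (((hL.smul' _).add' (hK.smul' _)).smul' _) fun w hw => ?_
    · rw [← toWord_gerstenhaberBracket hp]
      refine (isMulti_toWord _).add' (IsMulti.smul' ((multiWords k A).sub_mem
        ((multiWords k A).sub_mem hcD ?_) ?_) _)
      · exact (hgm.conv hfD).smul' _
      · exact (hfm.conv hgD).smul' _
    · rw [← toWord_gerstenhaberBracket hp, Pi.add_apply, Pi.smul_apply, Pi.sub_apply, Pi.sub_apply,
        Pi.smul_apply, Pi.smul_apply,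
        toWord_of_ne _ hw, rotationCochain_of_ne hsymm hinv _ (by omega),
        conv_apply_eq_zero (i := 0) (j := 1) (m := n) (n := m) (fun u h => toWord_of_ne g h)
          (fun v h => rotationCochain_of_ne hsymm hinv f h) (by omega),
        conv_apply_eq_zero (i := 0) (j := 1) (m := m) (n := n) (fun u h => toWord_of_ne f h)
          (fun v h => rotationCochain_of_ne hsymm hinv g h) (by omega)]
      simp
    · refine eq_of_form hη hsymm hinv fun a => ?_
      have e₁ : ((-1 : k) ^ (m + n + 1)) ^ m = (-1) ^ (m * n) := by
        rw [← pow_mul, show (m + n + 1) * m = m * n + m * (m + 1) by ring, pow_add,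
          Even.neg_one_pow (n := m * (m + 1)) (Nat.even_mul_succ_self m), mul_one]
      have e₂ := neg_one_pow_mul_self (k := k) (m * n)
      have e₃ := neg_one_pow_mul_self (k := k) m
      have e₄ := neg_one_pow_mul_self (k := k) n
      have e₅ : (-1 : k) ^ ((m + 1) * n) = (-1) ^ (m * n) * (-1) ^ n := by
        rw [← pow_add]; congr 1; ring
      have e₆ : (-1 : k) ^ ((m + 1) * (n + 1)) = -((-1) ^ (m * n) * (-1) ^ n * (-1) ^ m) := by
        rw [show (m + 1) * (n + 1) = m * n + n + m + 1 by ring, pow_succ, pow_add, pow_add]; ring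
      rw [wordDiff_smul, wordDiff_add, wordDiff_smul, wordDiff_smul, wordBracket,
        e₆]
      simp only [Pi.add_apply, Pi.sub_apply, Pi.smul_apply, mul_add, mul_sub, mul_smul_comm,
        map_add, map_sub, map_smul, smul_eq_mul]
      rw [hK' a w hw, hL' a w hw, form_rotationCochain hsymm hinv, toWord_cup,
        rotation_conv (form_one_mul_comm hsymm hinv) (twist_toWord _ f) a w, add_comm n m,
        mul_comm n m]
      rw [e₁, e₅]
      generalize η 1 (a * insertion ((-1 : k) ^ (n + 1)) (toWord g) (toWord f) w) = P
      generalize η 1 (splitSum (fun u v => ((-1 : k) ^ (m + n + 1)) ^ v.length •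
          ((fun z => toWord f (v ++ a :: z)) ⌢ toWord g) u) w) = S
      rw [pow_succ _ (m * n), pow_succ _ n]
      generalize (-1 : k) ^ (m * n) = x at *
      generalize (-1 : k) ^ n = z at *
      linear_combination (-(P * z * z) - x * z * S) * e₂ - P * e₄
  -- the products in the right order
  have h₂ := rotationCochain_conv_comm_mem hsymm hinv (hη := hη) hf hg
  convert sub_mem h₁ (Submodule.smul_mem _ ((-1 : k) ^ ((m + 1) * n)) h₂) using 1
  module

end BracketFormula

/-! ### Cohomology and its product -/

section Cohomology

variable {k : Type*} [Field k] {A : Type*} [Ring A] [Algebra k A]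

theorem wordDiff_zero : wordDiff k (0 : List A → A) = 0 := map_zero (wordDiffₗ k)

theorem twist_zero (θ : k) : twist θ (0 : List A → A) = 0 :=
  funext fun _ => smul_zero _

theorem wordDiff_twist (F : List A → A) :
    wordDiff k (twist (-1 : k) F) = -twist (-1 : k) (wordDiff k F) := by
  simp only [wordDiff, twist_sub, twist_conv, twist_letter,
    bar_twist (show (-1 : k) * -1 = 1 by simp), neg_smul, one_smul, neg_conv, conv_neg]
  abel

theorem wordDiff_conv_of_cocycle {F G : List A → A} (hF : wordDiff k F = 0)
    (hG : wordDiff k G = 0) : wordDiff k (F ⌢ G) = 0 := by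
  rw [wordDiff_conv, hF, hG, zero_conv, conv_zero, add_zero]

theorem wordDiff_eq_zero_of_mem {F : List A → A} (hF : F ∈ wordCoboundaries k A) :
    wordDiff k F = 0 := by
  obtain ⟨H, -, rfl⟩ := mem_wordCoboundaries.1 hF
  exact wordDiff_wordDiff H

theorem conv_mem_left {F G : List A → A} (hF : F ∈ wordCoboundaries k A) (hG : IsMulti k G)
    (hG' : wordDiff k G = 0) : F ⌢ G ∈ wordCoboundaries k A := by
  obtain ⟨H, hH, rfl⟩ := mem_wordCoboundaries.1 hF
  have h := wordDiff_mem (hH.conv hG)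
  rwa [wordDiff_conv, hG', conv_zero, add_zero] at h

theorem conv_mem_right {F G : List A → A} (hF : IsMulti k F) (hF' : wordDiff k F = 0)
    (hG : G ∈ wordCoboundaries k A) : F ⌢ G ∈ wordCoboundaries k A := by
  obtain ⟨H, hH, rfl⟩ := mem_wordCoboundaries.1 hG
  have h := wordDiff_mem ((hF.twist (-1)).conv hH)
  rwa [wordDiff_conv, twist_twist (by simp), wordDiff_twist, hF', twist_zero, neg_zero, zero_conv,
    zero_add] at h

theorem cup_mem_cocycles {m n p : ℕ} (h : m + n = p) {f : Cochain k A m} {g : Cochain k A n}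
    (hf : f ∈ cocycles k A m) (hg : g ∈ cocycles k A n) : cup h f g ∈ cocycles k A p := by
  rw [mem_cocycles_iff, toWord_cup]
  exact wordDiff_conv_of_cocycle (mem_cocycles_iff.1 hf) (mem_cocycles_iff.1 hg)

theorem mem_coboundaries_of_toWord_mem {n : ℕ} {f : Cochain k A n}
    (h : toWord f ∈ wordCoboundaries k A) : f ∈ coboundaries k A n := by
  obtain ⟨H, hH, e⟩ := mem_wordCoboundaries.1 h
  exact mem_coboundaries_of_eqOn hH fun w _ => (congrFun e w).symm

variable (k A) in
/-- The map from the cohomology to the functions of words modulo coboundaries. -/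
def wordClass : (⨁ n, HH k A n) →ₗ[k] (List A → A) ⧸ wordCoboundaries k A :=
  DirectSum.toModule k ℕ _ fun n => Submodule.liftQ _
    ((wordCoboundaries k A).mkQ ∘ₗ toWordₗ k A A n ∘ₗ (cocycles k A n).subtype) fun _ hf =>
      (Submodule.Quotient.mk_eq_zero _).2 (toWord_mem_of_mem_coboundaries hf)

theorem wordClass_cohomologyClass {n : ℕ} (f : Cochain k A n) (hf : f ∈ cocycles k A n) :
    wordClass k A (cohomologyClass f hf) = Submodule.Quotient.mk (toWord f) := by
  rw [wordClass, cohomologyClass, DirectSum.toModule_lof]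
  rfl

theorem cohomologyClass_surjective {n : ℕ} (a : HH k A n) :
    ∃ f, ∃ hf : f ∈ cocycles k A n, DirectSum.lof k ℕ (HH k A) n a = cohomologyClass f hf := by
  obtain ⟨⟨f, hf⟩, rfl⟩ := Submodule.Quotient.mk_surjective _ a
  exact ⟨f, hf, rfl⟩

/-- If a sum of cocycles of different degrees is the differential of a function of words, then each
of them is the differential of the component of the degree below. -/
theorem wordClass_injective : Function.Injective (wordClass k A) := by
  classical
  rw [injective_iff_map_eq_zero]
  intro x hx
  choose f hf using fun n => Submodule.Quotient.mk_surjective _ (x n)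
  have hx' : x = ∑ n ∈ DFinsupp.support x, cohomologyClass (f n).1 (f n).2 := by
    conv_lhs => rw [← DirectSum.sum_support_of x]
    exact Finset.sum_congr rfl fun n _ => by rw [← hf]; rfl
  have hs : ∑ n ∈ DFinsupp.support x, toWord (f n).1 ∈ wordCoboundaries k A := by
    rw [← Submodule.Quotient.mk_eq_zero, ← hx]
    conv_rhs => rw [hx']
    rw [map_sum, ← Submodule.mkQ_apply, map_sum]
    exact Finset.sum_congr rfl fun n _ => (wordClass_cohomologyClass _ _).symm
  obtain ⟨H, hH, e⟩ := mem_wordCoboundaries.1 hs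
  refine DFinsupp.ext fun n => ?_
  by_cases hn : n ∈ DFinsupp.support x
  · refine (hf n).symm.trans ((Submodule.Quotient.mk_eq_zero _).2 ?_)
    refine mem_coboundaries_of_eqOn hH fun w hw => ?_
    rw [e, Finset.sum_apply]
    exact (Finset.sum_eq_single_of_mem (f := fun m => toWord (f m).1 w) n hn fun m _ hm =>
      toWord_of_ne _ fun h => hm (h.symm.trans hw)).symm
  · exact DFinsupp.notMem_support_iff.1 hn

/-- The cohomology class `x` is the class of the cocycle `F`, a function of words which need not be
homogeneous. -/
structure Represents (x : ⨁ n, HH k A n) (F : List A → A) : Prop where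
  isMulti : IsMulti k F
  cocycle : wordDiff k F = 0
  wordClass_eq : wordClass k A x = Submodule.Quotient.mk F

theorem represents_cohomologyClass {n : ℕ} {f : Cochain k A n} (hf : f ∈ cocycles k A n) :
    Represents (cohomologyClass f hf) (toWord f) :=
  ⟨isMulti_toWord f, mem_cocycles_iff.1 hf, wordClass_cohomologyClass f hf⟩

namespace Represents

variable {x y : ⨁ n, HH k A n} {F G : List A → A}

theorem zero : Represents (0 : ⨁ n, HH k A n) 0 :=
  ⟨IsMulti.zero', wordDiff_zero, map_zero _⟩

theorem add (hx : Represents x F) (hy : Represents y G) : Represents (x + y) (F + G) :=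
  ⟨hx.isMulti.add' hy.isMulti, by rw [wordDiff_add, hx.cocycle, hy.cocycle, add_zero],
    by rw [map_add, hx.wordClass_eq, hy.wordClass_eq]; rfl⟩

theorem smul (hx : Represents x F) (c : k) : Represents (c • x) (c • F) :=
  ⟨hx.isMulti.smul' c, by rw [wordDiff_smul, hx.cocycle, smul_zero],
    by rw [map_smul, hx.wordClass_eq]; rfl⟩

theorem neg (hx : Represents x F) : Represents (-x) (-F) := by
  rw [← neg_one_smul k x, ← neg_one_smul k F]
  exact hx.smul _

theorem sub (hx : Represents x F) (hy : Represents y G) : Represents (x - y) (F - G) := by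
  rw [sub_eq_add_neg, sub_eq_add_neg]
  exact hx.add hy.neg

theorem eq_of_sub_mem (hx : Represents x F) (hy : Represents y G)
    (h : F - G ∈ wordCoboundaries k A) : x = y := by
  refine wordClass_injective ?_
  rw [hx.wordClass_eq, hy.wordClass_eq]
  exact (Submodule.Quotient.eq _).2 h

theorem sub_mem (hx : Represents x F) (hy : Represents x G) : F - G ∈ wordCoboundaries k A :=
  (Submodule.Quotient.eq _).1 (hx.wordClass_eq.symm.trans hy.wordClass_eq)

theorem congr (hx : Represents x F) (hG : IsMulti k G) (h : G - F ∈ wordCoboundaries k A) :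
    Represents x G := by
  refine ⟨hG, ?_, hx.wordClass_eq.trans ((Submodule.Quotient.eq _).2 h).symm⟩
  rw [← sub_add_cancel G F, wordDiff_add, wordDiff_eq_zero_of_mem h, hx.cocycle, add_zero]

end Represents

theorem exists_represents (x : ⨁ n, HH k A n) : ∃ F, Represents x F := by
  induction x using DirectSum.induction_on with
  | zero => exact ⟨0, Represents.zero⟩
  | of n a =>
    obtain ⟨f, hf, e⟩ := cohomologyClass_surjective a
    exact ⟨toWord f, e ▸ represents_cohomologyClass hf⟩
  | add x y hx hy =>
    obtain ⟨F, hF⟩ := hx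
    obtain ⟨G, hG⟩ := hy
    exact ⟨F + G, hF.add hG⟩

variable (k A) in
/-- The class of the cup product of two cocycles. -/
def cupClass (m n : ℕ) : cocycles k A m →ₗ[k] cocycles k A n →ₗ[k] HH k A (m + n) :=
  LinearMap.mk₂ k (fun f g => Submodule.Quotient.mk ⟨cup rfl f.1 g.1, cup_mem_cocycles rfl f.2 g.2⟩)
    (fun f f' g => congrArg Submodule.Quotient.mk (Subtype.ext (eq_of_toWord fun w _ => by
      simp only [Submodule.coe_add, toWord_add, toWord_cup, add_conv])))
    (fun c f g => congrArg Submodule.Quotient.mk (Subtype.ext (eq_of_toWord fun w _ => by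
      simp only [Submodule.coe_smul, toWord_smul, toWord_cup, smul_conv])))
    (fun f g g' => congrArg Submodule.Quotient.mk (Subtype.ext (eq_of_toWord fun w _ => by
      simp only [Submodule.coe_add, toWord_add, toWord_cup, conv_add])))
    (fun c f g => congrArg Submodule.Quotient.mk (Subtype.ext (eq_of_toWord fun w _ => by
      simp only [Submodule.coe_smul, toWord_smul, toWord_cup, conv_smul])))

variable (k A) in
/-- The product of cohomology classes of degrees `m` and `n`. -/
def mulHH (m n : ℕ) : HH k A m →ₗ[k] HH k A n →ₗ[k] HH k A (m + n) :=
  (Submodule.liftQ _ (Submodule.liftQ _ (cupClass k A m n) fun f hf => by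
    ext g
    refine (Submodule.Quotient.mk_eq_zero _).2 (mem_coboundaries_of_toWord_mem ?_)
    rw [Submodule.subtype_apply, toWord_cup]
    exact conv_mem_left (toWord_mem_of_mem_coboundaries hf) (isMulti_toWord g.1)
      (mem_cocycles_iff.1 g.2)).flip fun g hg => by
    ext f
    refine (Submodule.Quotient.mk_eq_zero _).2 (mem_coboundaries_of_toWord_mem ?_)
    rw [Submodule.subtype_apply, toWord_cup]
    exact conv_mem_right (isMulti_toWord f.1) (mem_cocycles_iff.1 f.2)
      (toWord_mem_of_mem_coboundaries hg)).flip

variable (k A) in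
/-- The product of the total cohomology. -/
noncomputable def cohomologyMul :
    (⨁ n, HH k A n) →ₗ[k] (⨁ n, HH k A n) →ₗ[k] (⨁ n, HH k A n) :=
  DirectSum.toModule k ℕ _ fun m => (DirectSum.toModule k ℕ _ fun n =>
    ((mulHH k A m n).compr₂ (DirectSum.lof k ℕ (HH k A) (m + n))).flip).flip

theorem cohomologyMul_lof {m n : ℕ} (a : HH k A m) (b : HH k A n) :
    cohomologyMul k A (DirectSum.lof k ℕ (HH k A) m a) (DirectSum.lof k ℕ (HH k A) n b) =
      DirectSum.lof k ℕ (HH k A) (m + n) (mulHH k A m n a b) := by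
  rw [cohomologyMul, DirectSum.toModule_lof, LinearMap.flip_apply, DirectSum.toModule_lof]
  rfl

theorem cohomologyMul_cohomologyClass {m n : ℕ} {f : Cochain k A m} {g : Cochain k A n}
    (hf : f ∈ cocycles k A m) (hg : g ∈ cocycles k A n) :
    cohomologyMul k A (cohomologyClass f hf) (cohomologyClass g hg) =
      cohomologyClass (cup rfl f g) (cup_mem_cocycles rfl hf hg) :=
  cohomologyMul_lof _ _

/-- The product of classes is represented by the convolution product, also for representatives that
are not homogeneous. -/
theorem Represents.mul {x y : ⨁ n, HH k A n} {F G : List A → A} (hx : Represents x F)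
    (hy : Represents y G) : Represents (cohomologyMul k A x y) (F ⌢ G) := by
  have key : ∀ x : ⨁ n, HH k A n, ∃ F, Represents x F ∧ ∀ y G, Represents y G →
      Represents (cohomologyMul k A x y) (F ⌢ G) := by
    intro x
    induction x using DirectSum.induction_on with
    | zero =>
      refine ⟨0, Represents.zero, fun y G _ => ?_⟩
      rw [map_zero, LinearMap.zero_apply, zero_conv]
      exact Represents.zero
    | of m a =>
      obtain ⟨f, hf, e⟩ := cohomologyClass_surjective a
      rw [show DirectSum.of (HH k A) m a = cohomologyClass f hf from e]
      have hr := represents_cohomologyClass hf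
      refine ⟨toWord f, hr, fun y G hy => ?_⟩
      have key' : ∀ y, ∃ G, Represents y G ∧
          Represents (cohomologyMul k A (cohomologyClass f hf) y) (toWord f ⌢ G) := by
        intro y
        induction y using DirectSum.induction_on with
        | zero =>
          refine ⟨0, Represents.zero, ?_⟩
          rw [map_zero, conv_zero]
          exact Represents.zero
        | of n b =>
          obtain ⟨g, hg, e⟩ := cohomologyClass_surjective b
          rw [show DirectSum.of (HH k A) n b = cohomologyClass g hg from e]
          refine ⟨toWord g, represents_cohomologyClass hg, ?_⟩
          rw [cohomologyMul_cohomologyClass, ← toWord_cup rfl]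
          exact represents_cohomologyClass _
        | add y z hy hz =>
          obtain ⟨G, hG, hG'⟩ := hy
          obtain ⟨H, hH, hH'⟩ := hz
          refine ⟨G + H, hG.add hH, ?_⟩
          rw [map_add, conv_add]
          exact hG'.add hH'
      obtain ⟨G', hG', h⟩ := key' y
      refine h.congr (hr.isMulti.conv hy.isMulti) ?_
      rw [← conv_sub]
      exact conv_mem_right hr.isMulti hr.cocycle (hy.sub_mem hG')
    | add x z hx hz =>
      obtain ⟨F, hF, hF'⟩ := hx
      obtain ⟨H, hH, hH'⟩ := hz
      refine ⟨F + H, hF.add hH, fun y G hy => ?_⟩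
      rw [map_add, LinearMap.add_apply, add_conv]
      exact (hF' y G hy).add (hH' y G hy)
  obtain ⟨F', hF', h⟩ := key x
  refine (h y G hy).congr (hx.isMulti.conv hy.isMulti) ?_
  rw [← sub_conv]
  exact conv_mem_left (hx.sub_mem hF') hy.isMulti hy.cocycle

end Cohomology

/-! ### The BV algebra -/

section CohomologyBV

variable {k : Type*} [Field k] {A : Type*} [Ring A] [Algebra k A] [FiniteDimensional k A]
variable {η : LinearMap.BilinForm k A} {hη : η.Nondegenerate}

theorem bvOperator_mem_cocycles (hsymm : ∀ a b : A, η a b = η b a)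
    (hinv : ∀ a b c : A, η (a * b) c = η a (b * c)) {n : ℕ} {f : Cochain k A (n + 1)}
    (hf : f ∈ cocycles k A (n + 1)) : bvOperator η hη f ∈ cocycles k A n := by
  rw [mem_cocycles_iff, ← sub_add_cancel (toWord (bvOperator η hη f)) (rotationCochain η hη f),
    wordDiff_add, wordDiff_eq_zero_of_mem (bvOperator_sub_rotationCochain_mem hsymm hinv hf),
    wordDiff_rotationCochain_of_cocycle hsymm hinv hf, add_zero]

theorem bvOperator_mem_coboundaries (hsymm : ∀ a b : A, η a b = η b a)
    (hinv : ∀ a b c : A, η (a * b) c = η a (b * c)) {n : ℕ} {f : Cochain k A (n + 1)}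
    (hf : f ∈ cocycles k A (n + 1)) (hf' : f ∈ coboundaries k A (n + 1)) :
    bvOperator η hη f ∈ coboundaries k A n := by
  refine mem_coboundaries_of_toWord_mem ?_
  rw [← sub_add_cancel (toWord (bvOperator η hη f)) (rotationCochain η hη f)]
  refine add_mem (bvOperator_sub_rotationCochain_mem hsymm hinv hf) ?_
  obtain ⟨g, rfl⟩ := hf'
  exact rotationCochain_differential_mem hsymm hinv g

theorem bvOperator_bvOperator (hsymm : ∀ a b : A, η a b = η b a)
    (hinv : ∀ a b c : A, η (a * b) c = η a (b * c)) {n : ℕ} (f : Cochain k A (n + 2)) :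
    bvOperator η hη (bvOperator η hη f) = 0 := by
  refine eq_of_toWord fun w hw => eq_of_form hη hsymm hinv fun a => ?_
  rw [form_one_mul hinv, ← toWord_toForm, toForm_bvOperator η hη hsymm,
    toForm_bvOperator η hη hsymm, dualConnesB_dualConnesB,
    show toWord (0 : Form k A n) = 0 from map_zero (toWordₗ k A k (n + 1)),
    show toWord (0 : Cochain k A n) = 0 from map_zero (toWordₗ k A A n)]
  simp

/-- The second order identity of the BV operator for the sums over rotations: the bracket with a
cocycle is the deviation from the product rule, and it is a derivation. -/
theorem rotationCochain_conv_conv_mem (hsymm : ∀ a b : A, η a b = η b a)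
    (hinv : ∀ a b c : A, η (a * b) c = η a (b * c)) {l m n : ℕ}
    {h : Cochain k A l} {f : Cochain k A m} {g : Cochain k A n} (hh : h ∈ cocycles k A l)
    (hf : f ∈ cocycles k A m) (hg : g ∈ cocycles k A n) :
    rotationCochain η hη (cup rfl h (cup rfl f g))
      - (rotationCochain η hη (cup rfl h f) ⌢ toWord g
        + (-1 : k) ^ l • (toWord h ⌢ rotationCochain η hη (cup rfl f g))
        + (-1 : k) ^ ((l + 1) * m) • (toWord f ⌢ rotationCochain η hη (cup rfl h g))
        - rotationCochain η hη h ⌢ toWord f ⌢ toWord g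
        - (-1 : k) ^ l • (toWord h ⌢ rotationCochain η hη f ⌢ toWord g)
        - (-1 : k) ^ (l + m) • (toWord h ⌢ toWord f ⌢ rotationCochain η hη g))
      ∈ wordCoboundaries k A := by
  have hh' := mem_cocycles_iff.1 hh
  have hf' := mem_cocycles_iff.1 hf
  have hg' := mem_cocycles_iff.1 hg
  have ea := bracket_add_mem (hη := hη) hsymm hinv hh (cup_mem_cocycles rfl hf hg)
  have eb := conv_mem_right (isMulti_toWord f) hf' (bracket_add_mem (hη := hη) hsymm hinv hh hg)
  have ec := conv_mem_left (bracket_add_mem (hη := hη) hsymm hinv hh hf) (isMulti_toWord g) hg'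
  have ed := bracket_conv_mem hh' hf' hg'
  have ee := conv_mem_left (rotationCochain_conv_comm_mem (hη := hη) hsymm hinv hh hf)
    (isMulti_toWord g) hg'
  have ef := conv_mem_left (conv_comm_mem (isMulti_toWord h) (supportedOn_toWord h)
    (isMulti_toWord f) (supportedOn_toWord f) hh' hf')
    (isMulti_rotationCochain (η := η) (hη := hη) g)
    (wordDiff_rotationCochain_of_cocycle hsymm hinv hg)
  rw [toWord_cup] at ea
  have e₁ : (-1 : k) ^ ((l + 1) * (m + n)) = (-1) ^ ((l + 1) * m) * (-1) ^ ((l + 1) * n) := by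
    rw [← pow_add]; congr 1; ring
  have e₂ : (-1 : k) ^ (l * m) = (-1) ^ ((l + 1) * m) * (-1) ^ m := by
    rw [← pow_add, show (l + 1) * m + m = l * m + 2 * m by ring, pow_add _ _ (2 * m), pow_mul _ 2]
    simp
  rw [e₁] at ea
  rw [e₂] at ef
  rw [pow_add]
  simp only [conv_add, add_conv, conv_sub, sub_conv, conv_smul, smul_conv, conv_assoc] at *
  have hσ := mul_self_eq_one_iff.1 (neg_one_pow_mul_self (k := k) ((l + 1) * m))
  have hρ := mul_self_eq_one_iff.1 (neg_one_pow_mul_self (k := k) ((l + 1) * n))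
  have hμ := mul_self_eq_one_iff.1 (neg_one_pow_mul_self (k := k) m)
  generalize (-1 : k) ^ ((l + 1) * m) = σ at *
  generalize (-1 : k) ^ ((l + 1) * n) = ρ at *
  generalize (-1 : k) ^ m = μ at *
  generalize (-1 : k) ^ l = s at *
  -- the bracket of `h` with the product cancels between `ea` and `ed`, those of `h` with `g` and `f`
  -- between `ed` and `eb`, `ec`; the products are reordered by `ee` and `ef`
  have := add_mem (add_mem (sub_mem (Submodule.smul_mem _ (σ * ρ) (sub_mem (sub_mem ea ed) eb))
    (Submodule.smul_mem _ σ ec)) ee) (Submodule.smul_mem _ (s * μ) ef)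
  convert this using 1
  rcases hσ with rfl | rfl <;> rcases hρ with rfl | rfl <;> rcases hμ with rfl | rfl <;> module

variable (η hη) in
/-- The BV operator on cohomology classes of degree `n + 1`. -/
noncomputable def bvHH (hsymm : ∀ a b : A, η a b = η b a)
    (hinv : ∀ a b c : A, η (a * b) c = η a (b * c)) (n : ℕ) : HH k A (n + 1) →ₗ[k] HH k A n :=
  Submodule.mapQ _ _
    { toFun := fun f => ⟨bvOperator η hη f.1, bvOperator_mem_cocycles hsymm hinv f.2⟩
      map_add' := fun f g => Subtype.ext (bvOperator_add hsymm hinv f.1 g.1)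
      map_smul' := fun c f => Subtype.ext (bvOperator_smul hsymm hinv c f.1) }
    fun f hf => bvOperator_mem_coboundaries hsymm hinv f.2 hf

variable (η hη) in
/-- The BV operator on the total cohomology, zero in degree `0`. -/
noncomputable def cohomologyBV (hsymm : ∀ a b : A, η a b = η b a)
    (hinv : ∀ a b c : A, η (a * b) c = η a (b * c)) :
    (⨁ n, HH k A n) →ₗ[k] (⨁ n, HH k A n) :=
  DirectSum.toModule k ℕ _ fun n => match n with
    | 0 => 0
    | n + 1 => DirectSum.lof k ℕ (HH k A) n ∘ₗ bvHH η hη hsymm hinv n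

variable (hsymm : ∀ a b : A, η a b = η b a) (hinv : ∀ a b c : A, η (a * b) c = η a (b * c))

theorem cohomologyBV_lof_zero (a : HH k A 0) :
    cohomologyBV η hη hsymm hinv (DirectSum.lof k ℕ (HH k A) 0 a) = 0 := by
  rw [cohomologyBV, DirectSum.toModule_lof]
  rfl

theorem cohomologyBV_lof_succ {n : ℕ} (a : HH k A (n + 1)) :
    cohomologyBV η hη hsymm hinv (DirectSum.lof k ℕ (HH k A) (n + 1) a) =
      DirectSum.lof k ℕ (HH k A) n (bvHH η hη hsymm hinv n a) := by
  rw [cohomologyBV, DirectSum.toModule_lof]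
  rfl

theorem cohomologyBV_cohomologyClass {n : ℕ} {f : Cochain k A (n + 1)}
    (hf : f ∈ cocycles k A (n + 1)) :
    cohomologyBV η hη hsymm hinv (cohomologyClass f hf) =
      cohomologyClass (bvOperator η hη f) (bvOperator_mem_cocycles hsymm hinv hf) :=
  cohomologyBV_lof_succ hsymm hinv _

/-- In all degrees the BV operator is represented by the sum over rotations, which vanishes in
degree `0`. -/
theorem represents_cohomologyBV {n : ℕ} {f : Cochain k A n} (hf : f ∈ cocycles k A n) :
    Represents (cohomologyBV η hη hsymm hinv (cohomologyClass f hf)) (rotationCochain η hη f) := by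
  rcases n with _ | n
  · rw [rotationCochain_of_zero hsymm hinv, cohomologyClass, cohomologyBV_lof_zero]
    exact Represents.zero
  · rw [cohomologyBV_cohomologyClass]
    refine (represents_cohomologyClass _).congr (isMulti_rotationCochain f) ?_
    rw [← neg_sub]
    exact neg_mem (bvOperator_sub_rotationCochain_mem hsymm hinv hf)

theorem cohomologyBV_cohomologyBV (x : ⨁ n, HH k A n) :
    cohomologyBV η hη hsymm hinv (cohomologyBV η hη hsymm hinv x) = 0 := by
  induction x using DirectSum.induction_on with
  | zero => simp
  | of n a =>
    obtain ⟨f, hf, e⟩ := cohomologyClass_surjective a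
    rw [show DirectSum.of (HH k A) n a = cohomologyClass f hf from e]
    rcases n with _ | _ | n
    · rw [cohomologyClass, cohomologyBV_lof_zero, map_zero]
    · rw [cohomologyBV_cohomologyClass, cohomologyClass, cohomologyBV_lof_zero]
    · rw [cohomologyBV_cohomologyClass, cohomologyBV_cohomologyClass]
      refine (represents_cohomologyClass _).eq_of_sub_mem Represents.zero ?_
      rw [bvOperator_bvOperator hsymm hinv, sub_zero,
        show toWord (0 : Cochain k A n) = 0 from map_zero (toWordₗ k A A n)]
      exact zero_mem _
  | add x y hx hy => rw [map_add, map_add, hx, hy, add_zero]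

theorem represents_bracket {m n : ℕ} {f : Cochain k A m} {g : Cochain k A n}
    (hf : f ∈ cocycles k A m) (hg : g ∈ cocycles k A n) {p : ℕ} (hp : m + n = p + 1) :
    Represents (-((-1 : k) ^ ((m + 1) * n) •
      (cohomologyBV η hη hsymm hinv
          (cohomologyMul k A (cohomologyClass f hf) (cohomologyClass g hg))
        - cohomologyMul k A (cohomologyBV η hη hsymm hinv (cohomologyClass f hf))
          (cohomologyClass g hg)
        - (-1 : k) ^ m • cohomologyMul k A (cohomologyClass f hf)
          (cohomologyBV η hη hsymm hinv (cohomologyClass g hg)))))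
      (toWord (gerstenhaberBracket hp f g)) := by
  have hf' := represents_cohomologyClass hf
  have hg' := represents_cohomologyClass hg
  rw [cohomologyMul_cohomologyClass]
  refine ((((represents_cohomologyBV hsymm hinv _).sub
    ((represents_cohomologyBV hsymm hinv hf).mul hg')).sub
    ((hf'.mul (represents_cohomologyBV hsymm hinv hg)).smul _)).smul _).neg.congr
    (isMulti_toWord _) ?_
  rw [sub_neg_eq_add, toWord_gerstenhaberBracket]
  exact bracket_add_mem hsymm hinv hf hg

theorem unitCochain_mem_cocycles : (unitCochain : Cochain k A 0) ∈ cocycles k A 0 := by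
  rw [mem_cocycles_iff, toWord_unitCochain, wordDiff]
  have h₁ : twist (-1 : k) (onNil (1 : A)) = (onNil 1 : List A → A) := by
    funext w
    rcases w with _ | ⟨a, w⟩ <;> simp [twist]
  have h₂ : bar (onNil (1 : A)) = (0 : List A → A) := by
    have h : ∀ F : List A → A, (∀ a w, F (a :: w) = 0) → ∀ w, bar F w = 0 := by
      intro F hF w
      induction w generalizing F with
      | nil => simp
      | cons a w ih =>
        rw [bar_cons, ih _ fun b w => hF a (b :: w)]
        rcases w with _ | ⟨c, w⟩ <;> simp [hF]
    exact funext (h _ fun a w => rfl)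
  rw [h₁, h₂, conv_onNil, onNil_conv, sub_self, sub_zero]

variable (η hη) in
/-- The BV algebra structure on Hochschild cohomology. -/
noncomputable def hochschildBVAlgebra : BVAlgebra k (HH k A) where
  mul := cohomologyMul k A
  one := Submodule.Quotient.mk ⟨unitCochain, unitCochain_mem_cocycles⟩
  Δ := cohomologyBV η hη hsymm hinv
  mul_mem m n a b := by
    rw [cohomologyMul_lof]
    exact LinearMap.mem_range_self _ _
  mul_assoc x y z := by
    obtain ⟨F, hF⟩ := exists_represents x
    obtain ⟨G, hG⟩ := exists_represents y
    obtain ⟨H, hH⟩ := exists_represents z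
    refine ((hF.mul hG).mul hH).eq_of_sub_mem (hF.mul (hG.mul hH)) ?_
    rw [conv_assoc, sub_self]
    exact zero_mem _
  one_mul x := by
    obtain ⟨F, hF⟩ := exists_represents x
    refine ((represents_cohomologyClass unitCochain_mem_cocycles).mul hF).eq_of_sub_mem hF ?_
    rw [toWord_unitCochain, onNil_conv, sub_self]
    exact zero_mem _
  mul_one x := by
    obtain ⟨F, hF⟩ := exists_represents x
    refine (hF.mul (represents_cohomologyClass unitCochain_mem_cocycles)).eq_of_sub_mem hF ?_
    rw [toWord_unitCochain, conv_onNil, sub_self]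
    exact zero_mem _
  mul_comm m n a b := by
    obtain ⟨f, hf, e⟩ := cohomologyClass_surjective a
    obtain ⟨g, hg, e'⟩ := cohomologyClass_surjective b
    rw [e, e']
    have hf' := represents_cohomologyClass hf
    have hg' := represents_cohomologyClass hg
    exact (hf'.mul hg').eq_of_sub_mem ((hg'.mul hf').smul _) (conv_comm_mem (isMulti_toWord f)
      (supportedOn_toWord f) (isMulti_toWord g) (supportedOn_toWord g) hf'.cocycle hg'.cocycle)
  Δ_zero := cohomologyBV_lof_zero hsymm hinv
  Δ_succ n a := by
    rw [cohomologyBV_lof_succ]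
    exact LinearMap.mem_range_self _ _
  Δ_Δ := cohomologyBV_cohomologyBV hsymm hinv
  Δ_mul_mul l m n a b c x y z hx hy hz := by
    obtain ⟨h, hh, ea⟩ := cohomologyClass_surjective a
    obtain ⟨f, hf, eb⟩ := cohomologyClass_surjective b
    obtain ⟨g, hg, ec⟩ := cohomologyClass_surjective c
    have hassoc : cohomologyMul k A (cohomologyMul k A (cohomologyClass h hh)
        (cohomologyClass f hf)) (cohomologyClass g hg) = cohomologyMul k A (cohomologyClass h hh)
        (cohomologyMul k A (cohomologyClass f hf) (cohomologyClass g hg)) := by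
      refine (((represents_cohomologyClass hh).mul (represents_cohomologyClass hf)).mul
        (represents_cohomologyClass hg)).eq_of_sub_mem ((represents_cohomologyClass hh).mul
        ((represents_cohomologyClass hf).mul (represents_cohomologyClass hg))) ?_
      rw [conv_assoc, sub_self]
      exact zero_mem _
    subst hx hy hz
    rw [ea, eb, ec, hassoc]
    have hh' := represents_cohomologyClass hh
    have hf' := represents_cohomologyClass hf
    have hg' := represents_cohomologyClass hg
    have hh'' := represents_cohomologyBV (hη := hη) hsymm hinv hh
    have hf'' := represents_cohomologyBV (hη := hη) hsymm hinv hf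
    have hg'' := represents_cohomologyBV (hη := hη) hsymm hinv hg
    have hhf := represents_cohomologyBV (hη := hη) hsymm hinv (cup_mem_cocycles rfl hh hf)
    have hhg := represents_cohomologyBV (hη := hη) hsymm hinv (cup_mem_cocycles rfl hh hg)
    have hfg := represents_cohomologyBV (hη := hη) hsymm hinv (cup_mem_cocycles rfl hf hg)
    have hhfg := represents_cohomologyBV (hη := hη) hsymm hinv
      (cup_mem_cocycles rfl hh (cup_mem_cocycles rfl hf hg))
    rw [← cohomologyMul_cohomologyClass hh hf] at hhf
    rw [← cohomologyMul_cohomologyClass hh hg] at hhg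
    rw [← cohomologyMul_cohomologyClass hf hg] at hfg
    rw [← cohomologyMul_cohomologyClass hh (cup_mem_cocycles rfl hf hg),
      ← cohomologyMul_cohomologyClass hf hg] at hhfg
    exact hhfg.eq_of_sub_mem (((((hhf.mul hg').add ((hh'.mul hfg).smul _)).add
      ((hf'.mul hhg).smul _)).sub ((hh''.mul hf').mul hg')).sub
      (((hh'.mul hf'').mul hg').smul _) |>.sub (((hh'.mul hf').mul hg'').smul _))
      (rotationCochain_conv_conv_mem hsymm hinv hh hf hg)

end CohomologyBV

end HochschildBV

open HochschildBV in
/-- The Hochschild cohomology of a finite-dimensional symmetric Frobenius algebra is a BV algebra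
under the cup product and the operator induced by the dual of Connes' `B`, and the bracket induced
by the BV operator is the Gerstenhaber bracket. -/
theorem mainTheorem5 {k : Type*} [Field k] {A : Type*} [Ring A] [Algebra k A]
    [FiniteDimensional k A] (η : LinearMap.BilinForm k A) (hη : η.Nondegenerate)
    (hsymm : ∀ a b : A, η a b = η b a) (hinv : ∀ a b c : A, η (a * b) c = η a (b * c)) :
    ∃ S : BVAlgebra k (HH k A),
      -- the unit is the class of `1`, and the product is induced by the cup product
      (∃ h : (unitCochain : Cochain k A 0) ∈ cocycles k A 0,
        DirectSum.lof k ℕ (HH k A) 0 S.one = cohomologyClass unitCochain h) ∧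
      (∀ (m n : ℕ) (f : Cochain k A m) (g : Cochain k A n)
        (hf : f ∈ cocycles k A m) (hg : g ∈ cocycles k A n),
        ∃ h : cup rfl f g ∈ cocycles k A (m + n),
          S.mul (cohomologyClass f hf) (cohomologyClass g hg) = cohomologyClass (cup rfl f g) h) ∧
      -- the BV operator is induced by the dual of Connes' operator
      (∀ (n : ℕ) (f : Cochain k A (n + 1)) (hf : f ∈ cocycles k A (n + 1)),
        ∃ h : bvOperator η hη f ∈ cocycles k A n,
          S.Δ (cohomologyClass f hf) = cohomologyClass (bvOperator η hη f) h) ∧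
      -- the bracket induced by the BV operator is the Gerstenhaber bracket
      (∀ (m n p : ℕ) (hp : m + n = p + 1) (f : Cochain k A m) (g : Cochain k A n)
        (hf : f ∈ cocycles k A m) (hg : g ∈ cocycles k A n),
        ∃ h : gerstenhaberBracket hp f g ∈ cocycles k A p,
          S.bracket m n (cohomologyClass f hf) (cohomologyClass g hg) =
            cohomologyClass (gerstenhaberBracket hp f g) h) := by
  refine ⟨hochschildBVAlgebra η hη hsymm hinv, ⟨unitCochain_mem_cocycles, rfl⟩,
    fun m n f g hf hg => ⟨cup_mem_cocycles rfl hf hg, cohomologyMul_cohomologyClass hf hg⟩,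
    fun n f hf => ⟨bvOperator_mem_cocycles hsymm hinv hf,
      cohomologyBV_cohomologyClass hsymm hinv hf⟩,
    fun m n p hp f g hf hg => ?_⟩
  have h := represents_bracket (hη := hη) hsymm hinv hf hg hp
  refine ⟨mem_cocycles_iff.2 h.cocycle, h.eq_of_sub_mem (represents_cohomologyClass _) ?_⟩
  rw [sub_self]
  exact zero_mem _
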